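/- Let $n\ge 1$ and $d\ge 1$. Write $V^d_n\subseteq M_n(\mathbb C)^d\cong\mathbb C^{dn^2}$ for the set of $d$-tuples $X=(X^1,\dots,X^d)$ of pairwise commuting $n\times n$ matrices, $T^d_n\subseteq V^d_n$ for the upper triangular ones, $\|X\|^2=\sum_{r,i,j}|X^r_{ij}|^2$, and operations such as $UXU^*$ and $\mathrm{Ad}_A(X)=AXA^{-1}$ componentwise. Let $dX$ be the Hausdorff measure of dimension $2n^2+2(d-1)n$ (normalized to agree with Lebesgue measure) restricted to $V^d_n$. Let $\nu$ be the probability measure on $U(n)/\mathbb T^n$ ($\mathbb T^n$ the diagonal unitaries) induced by Haar measure on $U(n)$, let $\mathfrak a_0(n)$ be the real space of skew-Hermitian matrices with zero diagonal, with the Frobenius inner product, and let $$C_n=\lim_{\varepsilon\to0^+}\frac{\mathrm{vol}\{S\in\mathfrak a_0(n):\|S\|<\varepsilon\}}{\nu\{[e^S]:S\in\mathfrak a_0(n),\ \|S\|<\varepsilon\}} .$$ For $Q\in T^d_n$ let $\Lambda_Q:\mathfrak a_0(n)\to\mathfrak a_0(n)$ be the real linear map with $\langle\Lambda_QS_1,S_2\rangle=\langle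 P^\perp\mathrm{ad}_Q(S_1),\mathrm{ad}_Q(S_2)\rangle$, where $\mathrm{ad}_Q(S)=([Q^r,S])_r$ and $P^\perp$ is the orthogonal projection with kernel the tangent space of $T^d_n$ at $Q$. Let $\mathfrak N$ be the group of upper triangular matrices $A$ with ones on the diagonal, with Lebesgue measure $dA$ in the entries above the diagonal. For $\lambda=(\lambda_1,\dots,\lambda_n)\in(\mathbb C^d)^n$ let $D$ be the diagonal tuple $D^r=\mathrm{diag}(\lambda^r_1,\dots,\lambda^r_n)$, let $d\lambda$ be Lebesgue measure, and at $Q=\mathrm{Ad}_A(D)$ let $\Gamma_Q=(dG)^*dG$ with $dG$ the complex derivative at $(D,A)$ of $G(\tilde D,\tilde A)=\tilde A\tilde D\tilde A^{-1}$, in the orthonormal coordinates given by the $\lambda_j^r$ and the entries of $A$ above the diagonal. **Theorem.** The limit $C_n$ exists and $0<C_n<\infty$, and there are measurable maps $s:U(n)/\mathbb T^n\to U(n)$ choosing a representative of each class. Assume that $V^d_n$ is irreducible as a complex algebraic set, let $\gamma,c_1,c_2>0$, $w(X)=c_1c_2e^{-\gamma\|X\|^2}$ (not necessarily normalized; the case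 of a random tuple is that in which $\int w(X)\,dX=1$), $w_1(t)=c_1e^{-\gamma t}$, $w_2(t)=c_2e^{-\gamma t}$, and $$J(\lambda,A)=C_n\,w_1(\|D\|^2)\,w_2(\|\mathrm{Ad}_A(D)-D\|^2)\sqrt{|\det\Lambda_{\mathrm{Ad}_A(D)}|}\;|\det\Gamma_{\mathrm{Ad}_A(D)}| .$$ 1. For every measurable $s$ as above, put $\Phi(\lambda,A,u)=UADA^{-1}U^*$ with $U=s(u)$. Then $w(X)\,dX=J(\lambda,A)\,d\lambda\,dA\,d\nu$ under $X=\Phi(\lambda,A,u)$: for every measurable set $B$ of parameters on which $\Phi$ is injective and every measurable $F\ge0$, $$\int_{\Phi(B)}F(X)\,w(X)\,dX=\int_BF(\Phi(\lambda,A,u))\,J(\lambda,A)\,d\lambda\,dA\,d\nu(u),$$ and, over all parameters (the eigenvalues can be ordered in $n!$ ways), $$\int_{V^d_n}F(X)\,w(X)\,dX=\frac1{n!}\int F(\Phi(\lambda,A,u))\,J(\lambda,A)\,d\lambda\,dA\,d\nu(u).$$ 2. The joint eigenvalues of $X$ under $w(X)\,dX$, listed in uniformly random order, have density $$\rho(\lambda)=\frac{C_n}{n!}\,w_1(\|D\|^2)\int_{\mathfrak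 N}w_2(\|\mathrm{Ad}_A(D)-D\|^2)\sqrt{|\det\Lambda_{\mathrm{Ad}_A(D)}|}\;|\det\Gamma_{\mathrm{Ad}_A(D)}|\,dA,$$ that is, for every measurable $S\subseteq(\mathbb C^d)^n$, $$\int_{V^d_n}p_S(X)\,w(X)\,dX=\int_S\rho(\lambda)\,d\lambda,$$ where $p_S(X)$ is the proportion of the orderings of the multi-spectrum of $X$ (the diagonals of the joint upper triangular forms $U^*XU$, $U\in U(n)$) that lie in $S$. -/

import Mathlib

open MeasureTheory
open scoped ENNReal Topology Matrix

noncomputable section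

namespace CommTuple

/-! ### Tuples of matrices -/

/-- The space of `d`-tuples of complex `n × n` matrices, with the Euclidean (Frobenius) norm
`‖X‖² = ∑ r i j, |X r i j|²`. The coordinate `X (r, i, j)` is the `(i, j)` entry of `X^r`. -/
abbrev MatTuple (d n : ℕ) := EuclideanSpace ℂ (Fin d × Fin n × Fin n)

variable {d n : ℕ}

/-- The `r`-th matrix of the tuple `X`. -/
def comp (X : MatTuple d n) (r : Fin d) : Matrix (Fin n) (Fin n) ℂ :=
  Matrix.of fun i j => X (r, i, j)

/-- The tuple with given component matrices. -/
def ofComp (M : Fin d → Matrix (Fin n) (Fin n) ℂ) : MatTuple d n :=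
  WithLp.toLp 2 fun p => M p.1 p.2.1 p.2.2

/-- The set of commuting `d`-tuples of `n × n` matrices. -/
def commVar (d n : ℕ) : Set (MatTuple d n) :=
  {X | ∀ r s, comp X r * comp X s = comp X s * comp X r}

/-- The set of commuting `d`-tuples of upper triangular `n × n` matrices. -/
def upperTri (d n : ℕ) : Set (MatTuple d n) :=
  {X | X ∈ commVar d n ∧ ∀ (r : Fin d) (i j : Fin n), j < i → X (r, i, j) = 0}

/-- Irreducibility of a set in complex affine space with respect to the Zariski topology:
it is nonempty, and it is not covered by two algebraic sets unless one of them covers it. -/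
def IsIrreducibleSet {ι : Type*} [Fintype ι] (V : Set (EuclideanSpace ℂ ι)) : Prop :=
  V.Nonempty ∧ ∀ I J : Ideal (MvPolynomial ι ℂ),
    (∀ X ∈ V, X.ofLp ∈ MvPolynomial.zeroLocus ℂ I ∪ MvPolynomial.zeroLocus ℂ J) →
      (∀ X ∈ V, X.ofLp ∈ MvPolynomial.zeroLocus ℂ I) ∨
      (∀ X ∈ V, X.ofLp ∈ MvPolynomial.zeroLocus ℂ J)

/-- The measure `dX`: Hausdorff measure of real dimension `2 n² + 2 (d - 1) n`, normalized so as to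
agree with Lebesgue measure on Euclidean spaces, restricted to the commuting tuples. -/
def volComm (d n : ℕ) : Measure (MatTuple d n) :=
  (μHE[2 * (n * (n - 1)) + 2 * (d * n)]).restrict (commVar d n)

/-- The `d`-tuple of diagonal matrices whose joint eigenvalues are `l 0, l 1, …` in `ℂ^d`. -/
def diagTuple (l : Fin n → Fin d → ℂ) : MatTuple d n :=
  ofComp fun r => Matrix.diagonal fun j => l j r

/-- Componentwise conjugation `Ad_A X = A X A⁻¹`. -/
def Ad (A : Matrix (Fin n) (Fin n) ℂ) (X : MatTuple d n) : MatTuple d n :=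
  ofComp fun r => A * comp X r * A⁻¹

/-- Componentwise conjugation `U X U^*` by a unitary. -/
def uconj (U : Matrix.unitaryGroup (Fin n) ℂ) (X : MatTuple d n) : MatTuple d n :=
  ofComp fun r => (U : Matrix (Fin n) (Fin n) ℂ) * comp X r * (U : Matrix (Fin n) (Fin n) ℂ)ᴴ

/-- Positions strictly above the diagonal. -/
abbrev UpperIdx (n : ℕ) := {p : Fin n × Fin n // p.1 < p.2}

/-- The upper triangular matrix with ones on the diagonal and the entries `a` above it. The
unipotent group is thus coordinatized by `ℂ^(n(n-1)/2)`, and `dA` is Lebesgue measure there. -/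
def unipotent (a : UpperIdx n → ℂ) : Matrix (Fin n) (Fin n) ℂ :=
  Matrix.of fun i j => if h : i < j then a ⟨(i, j), h⟩ else if i = j then 1 else 0

/-- The set of all orderings `(λ_1, …, λ_n)` of the multi-spectrum of a commuting tuple `X`: the
diagonals that occur when `X` is brought to joint upper triangular form by a unitary. -/
def orderings (X : MatTuple d n) : Set (Fin n → Fin d → ℂ) :=
  {l | ∃ U : Matrix.unitaryGroup (Fin n) ℂ,
    (∀ (r : Fin d) (i j : Fin n), j < i → (uconj U⁻¹ X) (r, i, j) = 0) ∧
    ∀ (r : Fin d) (j : Fin n), l j r = (uconj U⁻¹ X) (r, j, j)}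

/-- The probability that a uniformly random ordering of the multi-spectrum of `X` lies in `S`. -/
def orderingProb (X : MatTuple d n) (S : Set (Fin n → Fin d → ℂ)) : ℝ≥0∞ :=
  ((orderings X ∩ S).ncard : ℝ≥0∞) / ((orderings X).ncard : ℝ≥0∞)

/-! ### The unitary group modulo the diagonal torus -/

instance : CompactSpace (Matrix.unitaryGroup (Fin n) ℂ) := by
  suffices h : IsCompact (Matrix.unitaryGroup (Fin n) ℂ : Set (Matrix (Fin n) (Fin n) ℂ)) from
    isCompact_iff_compactSpace.mp h
  have hK : IsCompact (Set.univ.pi fun _ : Fin n => Set.univ.pi fun _ : Fin n =>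
      Metric.closedBall (0 : ℂ) 1) :=
    isCompact_univ_pi fun _ => isCompact_univ_pi fun _ => isCompact_closedBall 0 1
  refine IsCompact.of_isClosed_subset (s := Set.univ.pi fun _ : Fin n =>
    Set.univ.pi fun _ : Fin n => Metric.closedBall (0 : ℂ) 1) hK ?_ ?_
  · exact isClosed_unitary (R := Matrix (Fin n) (Fin n) ℂ)
  · intro U hU i _ j _
    simpa using entry_norm_bound_of_unitary hU i j

instance : MeasurableSpace (Matrix.unitaryGroup (Fin n) ℂ) := borel _

instance : BorelSpace (Matrix.unitaryGroup (Fin n) ℂ) := ⟨rfl⟩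

/-- The subgroup `𝕋^n` of diagonal unitary matrices. -/
def diagTorus (n : ℕ) : Subgroup (Matrix.unitaryGroup (Fin n) ℂ) where
  carrier := {U | (U : Matrix (Fin n) (Fin n) ℂ).IsDiag}
  one_mem' := Matrix.isDiag_one
  mul_mem' := by
    intro U V hU hV
    have hU' : (U : Matrix (Fin n) (Fin n) ℂ).IsDiag := hU
    have hV' : (V : Matrix (Fin n) (Fin n) ℂ).IsDiag := hV
    change ((U * V : Matrix.unitaryGroup (Fin n) ℂ) : Matrix (Fin n) (Fin n) ℂ).IsDiag
    rw [Matrix.UnitaryGroup.mul_val, ← hU'.diagonal_diag, ← hV'.diagonal_diag,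
      Matrix.diagonal_mul_diagonal]
    exact Matrix.isDiag_diagonal _
  inv_mem' := by
    intro U hU
    have hU' : (U : Matrix (Fin n) (Fin n) ℂ).IsDiag := hU
    exact hU'.conjTranspose

/-- The homogeneous space `U(n) / 𝕋^n`, with the quotient `σ`-algebra. -/
abbrev FlagSpace (n : ℕ) := Matrix.unitaryGroup (Fin n) ℂ ⧸ diagTorus n

/-- The Haar probability measure on `U(n)`. -/
def haarU (n : ℕ) : Measure (Matrix.unitaryGroup (Fin n) ℂ) :=
  Measure.haarMeasure ⊤

/-- The invariant probability measure `ν` on `U(n) / 𝕋^n`. -/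
def nu (n : ℕ) : Measure (FlagSpace n) :=
  (haarU n).map (QuotientGroup.mk : Matrix.unitaryGroup (Fin n) ℂ → FlagSpace n)

/-- A measurable choice of representatives of the classes in `U(n) / 𝕋^n`. -/
def IsSection (s : FlagSpace n → Matrix.unitaryGroup (Fin n) ℂ) : Prop :=
  Measurable s ∧ ∀ u, (QuotientGroup.mk (s u) : FlagSpace n) = u

/-- The real vector space of skew-Hermitian matrices with zero diagonal, with the
(real) Frobenius inner product. -/
def skewOff (n : ℕ) : Submodule ℝ (EuclideanSpace ℂ (Fin n × Fin n)) where
  carrier := {S | (∀ i j, S (i, j) = -star (S (j, i))) ∧ ∀ i, S (i, i) = 0}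
  zero_mem' := by simp
  add_mem' := by
    rintro S T ⟨hS, hS'⟩ ⟨hT, hT'⟩
    refine ⟨fun i j => ?_, fun i => ?_⟩
    · rw [PiLp.add_apply, PiLp.add_apply, hS i j, hT i j, star_add, neg_add]
    · rw [PiLp.add_apply, hS' i, hT' i, add_zero]
  smul_mem' := by
    rintro c S ⟨hS, hS'⟩
    refine ⟨fun i j => ?_, fun i => ?_⟩
    · rw [PiLp.smul_apply, PiLp.smul_apply, hS i j]
      simp
    · rw [PiLp.smul_apply, hS' i, smul_zero]

/-- Lebesgue measure on the Euclidean space of skew-Hermitian matrices with zero diagonal. -/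
def skewVol (n : ℕ) : Measure (skewOff n) := measureSpaceOfInnerProductSpace.volume

/-- An element of `skewOff n` as a matrix. -/
def skewMat (S : skewOff n) : Matrix (Fin n) (Fin n) ℂ :=
  Matrix.of fun i j => (S : EuclideanSpace ℂ (Fin n × Fin n)) (i, j)

/-- The set of classes in `U(n) / 𝕋^n` of the unitaries `e^S`, for `S` skew-Hermitian with zero
diagonal and `‖S‖ < ε`. -/
def expBall (n : ℕ) (ε : ℝ) : Set (FlagSpace n) :=
  {u | ∃ (S : skewOff n) (U : Matrix.unitaryGroup (Fin n) ℂ), ‖S‖ < ε ∧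
    (U : Matrix (Fin n) (Fin n) ℂ) = NormedSpace.exp (skewMat S) ∧ u = QuotientGroup.mk U}

/-! ### The two Jacobian operators -/

/-- The tuple of commutators `ad_Q S = ([Q^1, S], …, [Q^d, S])`, as a real linear map. -/
def ad (Q : MatTuple d n) : skewOff n →ₗ[ℝ] MatTuple d n where
  toFun S := ofComp fun r => comp Q r * skewMat S - skewMat S * comp Q r
  map_add' S T := by
    have h : skewMat (S + T) = skewMat S + skewMat T := by ext; simp [skewMat]
    ext p
    simp [ofComp, h, mul_add, add_mul]
    ring
  map_smul' c S := by
    have h : skewMat (c • S) = c • skewMat S := by ext; simp [skewMat]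
    ext p
    simp [ofComp, h, mul_sub]

/-- The tangent space at `Q` to the set of upper triangular commuting tuples: the real span of its
tangent cone (at smooth points the tangent cone is already a linear space). -/
def tangentUpper (Q : MatTuple d n) : Submodule ℝ (MatTuple d n) :=
  Submodule.span ℝ (tangentConeAt ℝ (upperTri d n) Q)

/-- The real linear operator `Λ_Q` on zero-diagonal skew-Hermitian matrices with
`⟪Λ_Q S₁, S₂⟫ = ⟪P^⊥ (ad_Q S₁), ad_Q S₂⟫`, where `P^⊥` is the orthogonal projection
with kernel the tangent space at `Q` to the upper triangular commuting tuples. (As `ad_Q S` is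
tangent to the commuting tuples, it does not matter whether the orthogonal complement is
taken there or in the whole space.) -/
def Lam (Q : MatTuple d n) : skewOff n →ₗ[ℝ] skewOff n :=
  LinearMap.adjoint (𝕜 := ℝ) (E := skewOff n) (F := MatTuple d n) (ad Q) ∘ₗ
    ((tangentUpper Q)ᗮ.starProjection : MatTuple d n →ₗ[ℝ] MatTuple d n) ∘ₗ
    ad Q

/-- The Euclidean coordinate space of the pairs (diagonal tuple, unipotent matrix). -/
abbrev DiagUni (d n : ℕ) := EuclideanSpace ℂ ((Fin n × Fin d) ⊕ UpperIdx n)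

/-- The parametrization `(D, A) ↦ A D A⁻¹`, in Euclidean coordinates. -/
def triParam (d n : ℕ) (x : DiagUni d n) : MatTuple d n :=
  Ad (unipotent fun p => x (Sum.inr p)) (diagTuple fun j r => x (Sum.inl (j, r)))

/-- The complex linear operator `Γ_Q = dG^* dG` at `Q = A D A⁻¹`, where `dG` is the derivative of
`(D, A) ↦ A D A⁻¹` at the point with `D = diag l` and `A = unipotent a`. -/
def Gam (l : Fin n → Fin d → ℂ) (a : UpperIdx n → ℂ) : DiagUni d n →ₗ[ℂ] DiagUni d n :=
  let dG : DiagUni d n →ₗ[ℂ] MatTuple d n :=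
    (fderiv ℂ (triParam d n) (WithLp.toLp 2 (Sum.elim (fun p => l p.1 p.2) a)) :
      DiagUni d n →L[ℂ] MatTuple d n)
  LinearMap.adjoint dG ∘ₗ dG

/-! ### The densities -/

/-- The Gaussian profile `t ↦ c e^{-γ t}`. -/
def gauss (c γ t : ℝ) : ℝ := c * Real.exp (-γ * t)

/-- The map `(λ, A, [U]) ↦ U A D A⁻¹ U^*`, with `D` the diagonal tuple with eigenvalues `λ`, where
the representative `U` of its class is chosen by `s`. -/
def fullParam (s : FlagSpace n → Matrix.unitaryGroup (Fin n) ℂ)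
    (p : (Fin n → Fin d → ℂ) × (UpperIdx n → ℂ) × FlagSpace n) : MatTuple d n :=
  uconj (s p.2.2) (Ad (unipotent p.2.1) (diagTuple p.1))

/-- The factor `w₂(‖Ad_A D - D‖²) √|det Λ| |det Γ|`, for `D = diag l` and `A = unipotent a`. -/
def innerDensity (w₂ : ℝ → ℝ) (l : Fin n → Fin d → ℂ) (a : UpperIdx n → ℂ) : ℝ :=
  w₂ (‖Ad (unipotent a) (diagTuple l) - diagTuple l‖ ^ 2) *
    Real.sqrt |LinearMap.det (Lam (Ad (unipotent a) (diagTuple l)))| *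
    ‖LinearMap.det (Gam l a)‖

end CommTuple

end

open CommTuple

namespace CommTuple

variable {d n : ℕ}

/-! ### Componentwise operations and unitary conjugation -/

section Components

/-! Write `N = n(n-1) + dn`, so that `dX` is Hausdorff measure of real dimension `2N`. Call a
commuting tuple generic if its first component has distinct eigenvalues. Irreducibility makes almost
every tuple generic (`volComm_compl_genericSet`). Off the zeros of `det p'(X^0)`, where `p` is the
characteristic polynomial of the first component `X^0`, a commuting tuple is simultaneously
diagonalizable. By irreducibility every polynomial vanishing on the diagonalizable tuples vanishes
on all of `V`. Hence `V` lies in the zero locus of the kernel of a homomorphism to a polynomial ring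
in `N` variables, and the exceptional zeros on `V` have real dimension at most `2(N-1)`. This uses a
bound of Hausdorff dimension by transcendence degree (`MvPolynomial.dimH_zeroLocus_le`).

A generic tuple is `U A D A⁻¹ U^*`: diagonalize the first component, observe that the others become
diagonal too, and apply QR to the eigenbasis. Once the order of the eigenvalues is fixed, the class
of `U` modulo the torus is unique, and so are `D` and `A` for a given representative `U`. Replacing
`U` by `U t⁻¹` with `t` diagonal replaces `A` by `t A t^*`, which changes neither Lebesgue measure
nor the Jacobian. To fix the order, the first coordinates of the eigenvalues are sorted by a Borel
order on `ℂ` along a permutation `σ`; each of the `n!` choices of `σ` parametrizes all generic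
tuples.

The Jacobian is needed only at `U = 1`. There `(x, S) ↦ e^S Q e^{-S}`, with `Q = A D A⁻¹` at `x`,
has derivative `(q, S) ↦ dG q - ad_Q S`. The range of `dG` is the tangent space of the triangular
tuples, so the norm determinant splits along its orthogonal complement into `|det Γ|` and `√|det Λ|`
(`tubeJac_eq`). The area formula for thin tubes `‖S‖ < ε` then gives their measure to first order in
the volume of the ball (`tendsto_measure_image_prodBall`).

Symmetry does the rest. For a torus-invariant set of sorted parameters, the measure of the
corresponding tuples with class in `N` is a measure in `N` invariant under `U(n)`, hence a multiple
`M` of `ν`. Comparing with the thin tubes shows both that the limit `C` of `vol / ν` exists and that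
`M` is `C` times the integral of the Jacobian (`tendsto_div_nu`, `tupleVol_tupleSet`). This
determines integrals of conjugation-invariant functions; averaging over Haar measure and Tonelli
extend the formula to all integrands (`lintegral_genericSet`).

The Gaussian weight splits because `‖A D A⁻¹‖² = ‖D‖² + ‖A D A⁻¹ - D‖²`. Summing over the sorting
permutations gives the factor `n!` and the law of the randomly ordered eigenvalues. -/

@[simp] lemma comp_ofComp (M : Fin d → Matrix (Fin n) (Fin n) ℂ) (r : Fin d) :
    comp (ofComp M) r = M r := by
  ext i j; simp [comp, ofComp]

lemma comp_apply (X : MatTuple d n) (r : Fin d) (i j : Fin n) : comp X r i j = X (r, i, j) := rfl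

lemma matTuple_ext {X Y : MatTuple d n} (h : ∀ r, comp X r = comp Y r) : X = Y := by
  ext ⟨r, i, j⟩
  exact congrFun (congrFun (h r) i) j

@[simp] lemma comp_uconj (U : Matrix.unitaryGroup (Fin n) ℂ) (X : MatTuple d n) (r : Fin d) :
    comp (uconj U X) r = U.1 * comp X r * U.1ᴴ := by simp [uconj]

@[simp] lemma comp_Ad (A : Matrix (Fin n) (Fin n) ℂ) (X : MatTuple d n) (r : Fin d) :
    comp (Ad A X) r = A * comp X r * A⁻¹ := by simp [Ad]

@[simp] lemma comp_diagTuple (l : Fin n → Fin d → ℂ) (r : Fin d) :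
    comp (diagTuple l) r = Matrix.diagonal fun j => l j r := by simp [diagTuple]

lemma unitary_conjTranspose_mul (U : Matrix.unitaryGroup (Fin n) ℂ) : U.1ᴴ * U.1 = 1 := by
  simpa [Matrix.star_eq_conjTranspose] using Matrix.mem_unitaryGroup_iff'.1 U.2

lemma unitary_mul_conjTranspose (U : Matrix.unitaryGroup (Fin n) ℂ) : U.1 * U.1ᴴ = 1 := by
  simpa [Matrix.star_eq_conjTranspose] using Matrix.mem_unitaryGroup_iff.1 U.2

lemma uconj_mul (U V : Matrix.unitaryGroup (Fin n) ℂ) (X : MatTuple d n) :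
    uconj (U * V) X = uconj U (uconj V X) :=
  matTuple_ext fun r => by simp [Matrix.conjTranspose_mul, Matrix.mul_assoc]

@[simp] lemma uconj_one (X : MatTuple d n) : uconj 1 X = X :=
  matTuple_ext fun r => by simp

lemma uconj_inv_uconj (U : Matrix.unitaryGroup (Fin n) ℂ) (X : MatTuple d n) :
    uconj U⁻¹ (uconj U X) = X := by
  rw [← uconj_mul]; simp

lemma uconj_uconj_inv (U : Matrix.unitaryGroup (Fin n) ℂ) (X : MatTuple d n) :
    uconj U (uconj U⁻¹ X) = X := by
  rw [← uconj_mul]; simp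

end Components

/-! ### Triangular and unipotent matrices, QR decomposition -/

section Triangular

lemma unipotent_blockTriangular (a : UpperIdx n → ℂ) : (unipotent a).BlockTriangular id := by
  intro i j hij
  have h1 : ¬ i < j := not_lt.2 (le_of_lt hij)
  have h2 : i ≠ j := (ne_of_lt hij).symm
  simp [unipotent, h1, h2]

@[simp] lemma unipotent_apply_self (a : UpperIdx n → ℂ) (i : Fin n) : unipotent a i i = 1 := by
  simp [unipotent]

@[simp] lemma det_unipotent (a : UpperIdx n → ℂ) : (unipotent a).det = 1 := by
  rw [Matrix.det_of_isUpperTriangular (unipotent_blockTriangular a)]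
  simp

lemma isUnit_det_unipotent (a : UpperIdx n → ℂ) : IsUnit (unipotent a).det := by simp

lemma blockTriangular_inv {M : Matrix (Fin n) (Fin n) ℂ} (hM : M.BlockTriangular id)
    (h : IsUnit M.det) : M⁻¹.BlockTriangular id := by
  have := M.invertibleOfIsUnitDet h
  exact Matrix.blockTriangular_inv_of_blockTriangular hM

lemma diag_mul_of_blockTriangular {M N : Matrix (Fin n) (Fin n) ℂ} (hM : M.BlockTriangular id)
    (hN : N.BlockTriangular id) (i : Fin n) : (M * N) i i = M i i * N i i := by
  rw [Matrix.mul_apply, Finset.sum_eq_single i]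
  · intro j _ hj
    rcases lt_or_gt_of_ne hj with h | h
    · rw [hM h, zero_mul]
    · rw [hN h, mul_zero]
  · simp

lemma unipotent_of_blockTriangular {M : Matrix (Fin n) (Fin n) ℂ} (hM : M.BlockTriangular id)
    (h1 : ∀ i, M i i = 1) : M = unipotent fun p => M p.1.1 p.1.2 := by
  ext i j
  rcases lt_trichotomy i j with h | h | h
  · simp [unipotent, h]
  · subst h; simp [unipotent, h1]
  · simp [unipotent, h.not_gt, h.ne', hM h]

lemma unipotent_injective : Function.Injective (unipotent (n := n)) := by
  intro a b h
  ext ⟨⟨i, j⟩, hp⟩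
  have := congrFun (congrFun h i) j
  simpa [unipotent, show i < j from hp] using this

/-- The inverse of an upper triangular matrix is upper triangular, whereas `U⁻¹ = U^*` is lower
triangular. -/
lemma isDiag_of_blockTriangular_unitary (U : Matrix.unitaryGroup (Fin n) ℂ)
    (hU : U.1.BlockTriangular id) : U.1.IsDiag := by
  have hdet : IsUnit U.1.det :=
    Matrix.isUnit_det_of_left_inverse (unitary_conjTranspose_mul U)
  have hinv : U.1⁻¹ = U.1ᴴ := Matrix.inv_eq_left_inv (unitary_conjTranspose_mul U)
  have h2 := blockTriangular_inv hU hdet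
  rw [hinv] at h2
  intro i j hij
  rcases lt_or_gt_of_ne hij with h | h
  · have := h2 (i := j) (j := i) h
    simpa using this
  · exact hU h

/-- The `(i, j)` entry of the commutator is `M i j * (v j - v i)`. -/
lemma isDiag_of_commute_diagonal {R : Type*} [Field R] {M : Matrix (Fin n) (Fin n) R}
    {v : Fin n → R} (hv : Function.Injective v)
    (h : M * Matrix.diagonal v = Matrix.diagonal v * M) : M.IsDiag := by
  intro i j hij
  have := congrFun (congrFun h i) j
  rw [Matrix.mul_diagonal, Matrix.diagonal_mul] at this
  have h3 : M i j * (v j - v i) = 0 := by rw [mul_sub, this]; ring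
  rcases mul_eq_zero.1 h3 with h | h
  · exact h
  · exact absurd (hv (sub_eq_zero.1 h)) hij.symm

lemma blockTriangular_of_isDiag {M : Matrix (Fin n) (Fin n) ℂ} (h : M.IsDiag) :
    M.BlockTriangular id := fun _ _ hij => h (ne_of_gt hij)

/-- QR decomposition with the triangular factor split into unipotent and diagonal parts. -/
lemma exists_unitary_unipotent_diagonal {B : Matrix (Fin n) (Fin n) ℂ} (hB : IsUnit B.det) :
    ∃ (U : Matrix.unitaryGroup (Fin n) ℂ) (a : UpperIdx n → ℂ) (δ : Fin n → ℂ),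
      (∀ i, δ i ≠ 0) ∧ B = U.1 * unipotent a * Matrix.diagonal δ := by
  let f : Fin n → EuclideanSpace ℂ (Fin n) := fun j => WithLp.toLp 2 fun i => B i j
  have hcard : Module.finrank ℂ (EuclideanSpace ℂ (Fin n)) = Fintype.card (Fin n) := by simp
  let b := InnerProductSpace.gramSchmidtOrthonormalBasis hcard f
  let M : Matrix (Fin n) (Fin n) ℂ := Matrix.of fun i j => b j i
  have hMM : Mᴴ * M = 1 := by
    ext i j
    have := (orthonormal_iff_ite.1 b.orthonormal) i j
    simp only [EuclideanSpace.inner_eq_star_dotProduct, dotProduct] at this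
    rw [Matrix.mul_apply, Matrix.one_apply, ← this]
    refine Finset.sum_congr rfl fun k _ => ?_
    simp [M, mul_comm]
  have hM : M ∈ Matrix.unitaryGroup (Fin n) ℂ := Matrix.mem_unitaryGroup_iff'.2 hMM
  -- An entry below the diagonal is the inner product of an orthonormalized vector with an earlier
  -- column of `B`, which vanishes by Gram–Schmidt.
  have hR : (Mᴴ * B).BlockTriangular id := by
    intro i j hij
    have := InnerProductSpace.gramSchmidtOrthonormalBasis_inv_triangular hcard f
      (show j < i from hij)
    simp only [EuclideanSpace.inner_eq_star_dotProduct, dotProduct] at this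
    rw [Matrix.mul_apply, ← this]
    refine Finset.sum_congr rfl fun k _ => ?_
    simp [M, b, f, mul_comm]
  set R := Mᴴ * B with hRdef
  have hBR : B = M * R := by
    rw [hRdef, ← Matrix.mul_assoc, mul_eq_one_comm.1 hMM, Matrix.one_mul]
  have hdet : R.det ≠ 0 := by
    intro h
    rw [hBR, Matrix.det_mul, h, mul_zero] at hB
    simp at hB
  have hδ : ∀ i, R i i ≠ 0 := by
    rw [Matrix.det_of_isUpperTriangular hR] at hdet
    exact fun i => Finset.prod_ne_zero_iff.1 hdet i (Finset.mem_univ i)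
  -- Dividing the columns of `R` by its diagonal entries makes it unipotent; the divisors form `δ`.
  have hA : (R * Matrix.diagonal fun i => (R i i)⁻¹).BlockTriangular id :=
    hR.mul (Matrix.blockTriangular_diagonal _)
  have hA1 := unipotent_of_blockTriangular hA fun i => by simp [hδ i]
  refine ⟨⟨M, hM⟩, fun p => (R * Matrix.diagonal fun i => (R i i)⁻¹) p.1.1 p.1.2,
    fun i => R i i, hδ, ?_⟩
  rw [Matrix.mul_assoc, ← hA1, Matrix.mul_assoc, Matrix.diagonal_mul_diagonal]
  simp [hδ, ← hBR]

end Triangular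

end CommTuple

/-! ### Hausdorff dimension of complex algebraic sets -/

section AlgebraicSets

open MvPolynomial

/-- A transcendence basis of `A ⧸ Q` lifts to an independent family in `A ⧸ P`. An element of `Q`
outside `P` is transcendental over that family: it is not a zero divisor, so an algebraic relation
for it may be taken with nonzero constant coefficient, and its image in `A ⧸ Q`, where the element
dies, would be a relation among the basis elements. Hence `A ⧸ P` has at least one more independent
element. -/
lemma Algebra.trdeg_quotient_lt_of_lt {A : Type*} [CommRing A] [Algebra ℂ A]
    {P Q : Ideal A} [P.IsPrime] [Q.IsPrime] (hPQ : P < Q) {m : ℕ}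
    (hm : Algebra.trdeg ℂ (A ⧸ P) ≤ m) : Algebra.trdeg ℂ (A ⧸ Q) < m := by
  have : FaithfulSMul ℂ (A ⧸ Q) :=
    (faithfulSMul_iff_algebraMap_injective ℂ (A ⧸ Q)).2 (algebraMap ℂ (A ⧸ Q)).injective
  obtain ⟨t, ht⟩ := exists_isTranscendenceBasis ℂ (A ⧸ Q)
  obtain ⟨p, hpQ, hpP⟩ := SetLike.exists_of_lt hPQ
  let π : A ⧸ P →ₐ[ℂ] A ⧸ Q := Ideal.Quotient.factorₐ ℂ hPQ.le
  have hπ : Function.Surjective π := Ideal.Quotient.factor_surjective hPQ.le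
  choose g hg using hπ
  let y : t → A ⧸ P := fun i => g i
  have hy : AlgebraicIndependent ℂ (fun i => π (y i)) := by
    simp only [y, hg]
    exact ht.1
  have hy' : AlgebraicIndependent ℂ y := AlgebraicIndependent.of_comp π hy
  set b : A ⧸ P := Ideal.Quotient.mk P p with hb
  have hb0 : b ≠ 0 := fun h => hpP (Ideal.Quotient.eq_zero_iff_mem.1 h)
  have hπb : π b = 0 := by
    change Ideal.Quotient.mk Q p = 0
    exact Ideal.Quotient.eq_zero_iff_mem.2 hpQ
  have htr : Transcendental (Algebra.adjoin ℂ (Set.range y)) b := by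
    intro halg
    obtain ⟨q, hq0, hq⟩ := halg.exists_nonzero_coeff_and_aeval_eq_zero
      (mem_nonZeroDivisors_of_ne_zero hb0)
    have h1 : π (q.coeff 0 : A ⧸ P) = 0 := by
      have h2 := congrArg π hq
      rw [Polynomial.aeval_eq_sum_range, map_sum, map_zero, Finset.sum_range_succ'] at h2
      simpa [Algebra.smul_def, hπb] using h2
    obtain ⟨f, hf⟩ : ∃ f : MvPolynomial t ℂ, aeval y f = (q.coeff 0 : A ⧸ P) := by
      have h3 : ∀ z ∈ Algebra.adjoin ℂ (Set.range y), ∃ f : MvPolynomial t ℂ, aeval y f = z := by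
        intro z hz
        rwa [Algebra.adjoin_range_eq_range_aeval] at hz
      exact h3 _ (q.coeff 0).2
    have h3 : aeval (fun i => π (y i)) f = 0 := by
      rw [← h1, ← hf]
      exact (MvPolynomial.comp_aeval_apply y π f).symm
    have h4 : f = 0 := hy (by rw [h3, map_zero])
    rw [h4, map_zero] at hf
    exact hq0 (Subtype.ext hf.symm)
  have hopt := (hy'.option_iff_transcendental b).2 htr
  have hcard := hopt.cardinalMk_le_trdeg.trans hm
  rw [Cardinal.mk_option] at hcard
  rw [← ht.cardinalMk_eq_trdeg]
  have hfin : Cardinal.mk t < Cardinal.aleph0 :=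
    (self_le_add_right _ _).trans_lt (hcard.trans_lt (Cardinal.natCast_lt_aleph0))
  obtain ⟨k, hk⟩ := Cardinal.lt_aleph0.1 hfin
  rw [hk] at hcard ⊢
  exact_mod_cast hcard

/-- If the derivative of an annihilating polynomial also annihilates `b`, pass to the derivative.
The degree drops, and in characteristic zero the derivative of a nonconstant polynomial is nonzero,
so the descent stops at the required polynomial. -/
lemma Polynomial.exists_aeval_eq_zero_aeval_derivative_ne_zero {S B : Type*} [CommRing S]
    [CommRing B] [IsDomain S] [CharZero S] [Algebra S B]
    (hSB : Function.Injective (algebraMap S B)) {b : B} (hb : IsAlgebraic S b) :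
    ∃ f : Polynomial S, Polynomial.aeval b f = 0 ∧
      Polynomial.aeval b (Polynomial.derivative f) ≠ 0 := by
  obtain ⟨f, hf0, hf⟩ := hb
  induction hN : f.natDegree using Nat.strong_induction_on generalizing f with
  | _ N ih =>
    by_cases h : Polynomial.aeval b (Polynomial.derivative f) = 0
    · have hdeg : f.natDegree ≠ 0 := by
        intro h0
        rw [Polynomial.eq_C_of_natDegree_eq_zero h0, Polynomial.aeval_C] at hf
        have : f.coeff 0 = 0 := hSB (by rw [hf, map_zero])
        exact hf0 (by rw [Polynomial.eq_C_of_natDegree_eq_zero h0, this, Polynomial.C_0])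
      have hlt := Polynomial.natDegree_derivative_lt hdeg
      refine ih _ (hN ▸ hlt) _ (fun h0 => hdeg ?_) h rfl
      
      have : IsAddTorsionFree S := inferInstance
      exact Polynomial.derivative_eq_zero.1 h0
    · exact ⟨f, hf, h⟩

variable {ι : Type*}

/-- A polynomial relation for an algebraic coordinate which is nondegenerate in that coordinate. -/
lemma MvPolynomial.exists_relation {Q : Ideal (MvPolynomial ι ℂ)} [Q.IsPrime] {I : Set ι} {j : ι}
    (hj : j ∉ I) (halg : IsAlgebraic
      (Algebra.adjoin ℂ ((fun i => Ideal.Quotient.mk Q (X i)) '' I)) (Ideal.Quotient.mk Q (X j))) :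
    ∃ F ∈ Q, pderiv j F ∉ Q ∧ ∀ i, i ∉ I → i ≠ j → pderiv i F = 0 := by
  set S := Algebra.adjoin ℂ ((fun i => Ideal.Quotient.mk Q (X i)) '' I) with hS
  have : CharZero S := charZero_of_injective_algebraMap (algebraMap ℂ S).injective
  obtain ⟨f, hf0, hf1⟩ := Polynomial.exists_aeval_eq_zero_aeval_derivative_ne_zero
    (S := S) Subtype.val_injective halg
  -- Elements of the subalgebra lift to polynomials in the variables of `I` alone. Hence only the
  -- powers of `X j` contribute to the derivatives in directions outside `I`.
  have hlift : ∀ c : S, ∃ g : MvPolynomial ι ℂ, Ideal.Quotient.mk Q g = c ∧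
      ∀ i, i ∉ I → pderiv i g = 0 := by
    rintro ⟨c, hc⟩
    have key : ∃ g : MvPolynomial ι ℂ, Ideal.Quotient.mk Q g = c ∧
        ∀ i, i ∉ I → pderiv i g = 0 := by
      rw [hS] at hc
      induction hc using Algebra.adjoin_induction with
      | mem x hx =>
        obtain ⟨i, hi, rfl⟩ := hx
        exact ⟨X i, rfl, fun k hk => pderiv_X_of_ne (fun h => hk (h ▸ hi))⟩
      | algebraMap r => exact ⟨C r, rfl, fun k _ => pderiv_C⟩
      | add x y _ _ hx hy =>
        obtain ⟨g, hg, hg'⟩ := hx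
        obtain ⟨h, hh, hh'⟩ := hy
        exact ⟨g + h, by simp [hg, hh], fun k hk => by simp [hg' k hk, hh' k hk]⟩
      | mul x y _ _ hx hy =>
        obtain ⟨g, hg, hg'⟩ := hx
        obtain ⟨h, hh, hh'⟩ := hy
        exact ⟨g * h, by simp [hg, hh], fun k hk => by simp [hg' k hk, hh' k hk]⟩
    exact key
  choose g hg hg' using hlift
  have hmk : ∀ s : Finset ℕ, ∀ (c : ℕ → S) (e : ℕ → ℕ),
      Ideal.Quotient.mk Q (∑ k ∈ s, g (c k) * X j ^ e k) =
        ∑ k ∈ s, (c k : MvPolynomial ι ℂ ⧸ Q) * Ideal.Quotient.mk Q (X j) ^ e k := by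
    intro s c e
    simp [map_sum, hg]
  refine ⟨∑ k ∈ Finset.range (f.natDegree + 1), g (f.coeff k) * X j ^ k, ?_, ?_, ?_⟩
  · rw [← Ideal.Quotient.eq_zero_iff_mem, hmk _ (fun k => f.coeff k) (fun k => k)]
    rw [Polynomial.aeval_eq_sum_range] at hf0
    simpa [Algebra.smul_def] using hf0
  · rw [← Ideal.Quotient.eq_zero_iff_mem]
    -- Modulo `Q`, the derivative in the variable `j` is the value of `f'` at the class of `X j`.
    have h1 : pderiv j (∑ k ∈ Finset.range (f.natDegree + 1), g (f.coeff k) * X j ^ k) =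
        ∑ k ∈ Finset.range (f.natDegree + 1), g (f.coeff k) * ((k : MvPolynomial ι ℂ) * X j ^ (k - 1)) := by
      rw [map_sum]
      refine Finset.sum_congr rfl fun k _ => ?_
      rw [pderiv_mul, hg' _ j hj, zero_mul, zero_add, pderiv_pow, pderiv_X_self, mul_one]
    rw [h1]
    rw [f.as_sum_range_C_mul_X_pow] at hf1
    simpa [map_sum, hg, mul_assoc, Polynomial.derivative_X_pow] using hf1
  · intro i hi hij
    rw [map_sum]
    refine Finset.sum_eq_zero fun k _ => ?_
    rw [pderiv_mul, hg' _ i hi, pderiv_pow, pderiv_X_of_ne hij.symm]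
    simp

variable [Fintype ι]

lemma MvPolynomial.hasStrictFDerivAt_eval (p : MvPolynomial ι ℂ) (x : ι → ℂ) :
    HasStrictFDerivAt (fun x : ι → ℂ => eval x p)
      (∑ i, eval x (pderiv i p) • ContinuousLinearMap.proj (R := ℂ) (φ := fun _ : ι => ℂ) i) x := by
  classical
  induction p using MvPolynomial.induction_on with
  | C a =>
    have h1 := hasStrictFDerivAt_const (𝕜 := ℂ) a x
    simp only [eval_C]
    convert! h1 using 1
    ext v
    simp
  | add p q hp hq =>
    have h1 := hp.add hq
    simp only [map_add]
    convert! h1 using 1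
    ext v
    simp [add_mul, Finset.sum_add_distrib]
  | mul_X p j hp =>
    have h1 : HasStrictFDerivAt (fun x : ι → ℂ => x j)
      (ContinuousLinearMap.proj (R := ℂ) (φ := fun _ : ι => ℂ) j) x :=
      (ContinuousLinearMap.proj (R := ℂ) (φ := fun _ : ι => ℂ) j).hasStrictFDerivAt
    have h2 := hp.mul h1
    simp only [map_mul, eval_X]
    convert! h2 using 1
    ext v
    have hsum : ∀ i, eval x (pderiv i (p * X j)) * v i =
        x j * (eval x (pderiv i p) * v i) + if i = j then eval x p * v j else 0 := by
      intro i
      rw [pderiv_mul]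
      by_cases hij : i = j
      · subst hij
        simp
        ring
      · rw [pderiv_X_of_ne (Ne.symm hij)]
        simp [hij]
        ring
    simp only [add_apply, sum_apply, smul_apply, ContinuousLinearMap.proj_apply, smul_eq_mul, hsum,
      Finset.sum_add_distrib]
    rw [add_comm, Finset.mul_sum]
    simp

/-- The inverse is Lipschitz on the image, and Lipschitz maps do not raise the dimension. -/
lemma dimH_le_of_antilipschitzOn {E F : Type*} [EMetricSpace E] [EMetricSpace F] {f : E → F}
    {s : Set E} {K : NNReal} (h : ∀ x ∈ s, ∀ y ∈ s, edist x y ≤ K * edist (f x) (f y)) :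
    dimH s ≤ dimH (f '' s) := by
  rcases s.eq_empty_or_nonempty with rfl | ⟨x₀, hx₀⟩
  · simp
  have : Nonempty E := ⟨x₀⟩
  have hinj : Set.InjOn f s := by
    intro x hx y hy hxy
    have := h x hx y hy
    rw [hxy, edist_self, mul_zero] at this
    exact edist_le_zero.1 this
  have hL : LipschitzOnWith K (Function.invFunOn f s) (f '' s) := by
    rintro _ ⟨x, hx, rfl⟩ _ ⟨y, hy, rfl⟩
    rw [hinj.leftInvOn_invFunOn hx, hinj.leftInvOn_invFunOn hy]
    exact h x hx y hy
  have h2 := hL.dimH_image_le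
  rwa [hinj.leftInvOn_invFunOn.image_image] at h2

lemma HasStrictFDerivAt.exists_antilipschitzOn {𝕜 E F : Type*} [NontriviallyNormedField 𝕜]
    [CompleteSpace 𝕜] [NormedAddCommGroup E] [NormedSpace 𝕜 E] [FiniteDimensional 𝕜 E]
    [NormedAddCommGroup F] [NormedSpace 𝕜 F] {f : E → F} {f' : E →L[𝕜] F} {a : E}
    (hf : HasStrictFDerivAt f f' a) (hf' : Function.Injective f') :
    ∃ K : NNReal, ∃ s ∈ 𝓝 a, ∀ x ∈ s, ∀ y ∈ s, edist x y ≤ K * edist (f x) (f y) := by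
  obtain ⟨K, hK, hanti⟩ := f'.toLinearMap.exists_antilipschitzWith (LinearMap.ker_eq_bot.2 hf')
  -- The derivative expands distances by at least `1/K`. An error of half that rate leaves `f` the
  -- lower bound `1/(2K)`.
  obtain ⟨s, hs, happ⟩ := hf.approximates_deriv_on_nhds (c := K⁻¹ / 2)
    (Or.inr (by positivity))
  refine ⟨2 * K, s, hs, fun x hx y hy => ?_⟩
  have h1 : ‖x - y‖ ≤ K * ‖f' (x - y)‖ := by
    have := hanti.le_mul_dist x y
    rw [dist_eq_norm, dist_eq_norm, ← map_sub] at this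
    exact this
  have h2 := happ x hx y hy
  have h3 : ‖f' (x - y)‖ ≤ ‖f x - f y‖ + (K⁻¹ / 2 : NNReal) * ‖x - y‖ := by
    calc ‖f' (x - y)‖ = ‖(f x - f y) - (f x - f y - f' (x - y))‖ := by congr 1; abel
      _ ≤ _ := (norm_sub_le _ _).trans (by gcongr)
  have hK' : (0 : ℝ) < K := hK
  have h4 : ‖x - y‖ ≤ 2 * K * ‖f x - f y‖ := by
    have h5 : (K : ℝ) * ((K⁻¹ / 2 : NNReal) * ‖x - y‖) = ‖x - y‖ / 2 := by
      push_cast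
      field_simp
    have := mul_le_mul_of_nonneg_left h3 hK'.le
    rw [mul_add, h5] at this
    linarith
  rw [edist_dist, edist_dist, dist_eq_norm, dist_eq_norm]
  rw [show ((2 * K : NNReal) : ℝ≥0∞) = ENNReal.ofReal (2 * K) by
    rw [← ENNReal.ofReal_coe_nnreal]; push_cast; rfl, ← ENNReal.ofReal_mul (by positivity)]
  exact ENNReal.ofReal_le_ofReal h4

lemma dimH_le_of_forall_mem_nhds {E : Type*} [EMetricSpace E] [SecondCountableTopology E]
    {s : Set E} {r : ℝ≥0∞} (h : ∀ x ∈ s, ∃ t ∈ 𝓝 x, dimH (s ∩ t) ≤ r) : dimH s ≤ r := by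
  by_contra! hr
  obtain ⟨x, hx, hxt⟩ := exists_mem_nhdsWithin_lt_dimH_of_lt_dimH hr
  obtain ⟨t, ht, hle⟩ := h x hx
  exact (hxt _ (Filter.inter_mem self_mem_nhdsWithin (mem_nhdsWithin_of_mem_nhds ht))).not_ge hle

/-- The nondegenerate part of an algebraic set given by one relation for each coordinate outside
`I` has dimension at most that of the space of coordinates in `I`. -/
lemma MvPolynomial.dimH_nondegenerate_le (I : Finset ι) (F : ι → MvPolynomial ι ℂ)
    (hF : ∀ j, j ∉ I → ∀ i, i ∉ I → i ≠ j → pderiv i (F j) = 0) :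
    dimH {x : ι → ℂ | ∀ j, j ∉ I → eval x (F j) = 0 ∧ eval x (pderiv j (F j)) ≠ 0} ≤
      (2 * I.card : ℕ) := by
  classical
  refine dimH_le_of_forall_mem_nhds fun x hx => ?_
  -- `Φ` keeps the coordinates in `I` and replaces each other one by its relation. The derivative is
  -- injective: once `v` vanishes on `I`, row `j` reads `∂_j F_j · v_j`. On the set in question the
  -- relations vanish, so distances under `Φ` are distances of the projections to the coordinates in
  -- `I`.
  let Φ : (ι → ℂ) → (ι → ℂ) := fun x j => if j ∈ I then x j else eval x (F j)
  let Φ' : (ι → ℂ) →L[ℂ] (ι → ℂ) := ContinuousLinearMap.pi fun j =>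
    if j ∈ I then ContinuousLinearMap.proj (R := ℂ) (φ := fun _ : ι => ℂ) j else
      ∑ i, eval x (pderiv i (F j)) • ContinuousLinearMap.proj (R := ℂ) (φ := fun _ : ι => ℂ) i
  have hΦ : HasStrictFDerivAt Φ Φ' x := by
    rw [hasStrictFDerivAt_pi]
    intro j
    by_cases hj : j ∈ I
    · simp only [hj, if_true]
      exact (ContinuousLinearMap.proj (R := ℂ) (φ := fun _ : ι => ℂ) j).hasStrictFDerivAt
    · simp only [hj, if_false]
      exact hasStrictFDerivAt_eval (F j) x
  have hinj : Function.Injective Φ' := by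
    rw [injective_iff_map_eq_zero]
    intro v hv
    have hI : ∀ j ∈ I, v j = 0 := fun j hj => by
      have := congrFun hv j
      simpa [Φ', hj] using this
    ext j
    by_cases hj : j ∈ I
    · exact hI j hj
    · have := congrFun hv j
      simp only [Φ', ContinuousLinearMap.pi_apply, hj, if_false, sum_apply,
        smul_apply, ContinuousLinearMap.proj_apply, smul_eq_mul,
        Pi.zero_apply] at this
      rw [Finset.sum_eq_single j] at this
      · exact (mul_eq_zero.1 this).resolve_left (hx j hj).2
      · intro i _ hij
        by_cases hi : i ∈ I
        · rw [hI i hi, mul_zero]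
        · rw [hF j hj i hi hij, map_zero, zero_mul]
      · simp
  obtain ⟨K, t, ht, hK⟩ := hΦ.exists_antilipschitzOn hinj
  refine ⟨t, ht, ?_⟩
  let π : (ι → ℂ) → (I → ℂ) := fun x i => x i
  have h1 := dimH_le_of_antilipschitzOn (f := π) (K := K)
    (s := {x : ι → ℂ | ∀ j, j ∉ I → eval x (F j) = 0 ∧ eval x (pderiv j (F j)) ≠ 0} ∩ t) (by
      rintro y ⟨hy, hyt⟩ z ⟨hz, hzt⟩
      refine (hK y hyt z hzt).trans ?_
      gcongr
      rw [edist_pi_le_iff]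
      intro j
      by_cases hj : j ∈ I
      · simp only [Φ, hj, if_true]
        exact edist_le_pi_edist (π y) (π z) ⟨j, hj⟩
      · simp only [Φ, hj, if_false]
        rw [(hy j hj).1, (hz j hj).1, edist_self]
        exact bot_le)
  refine h1.trans ((dimH_mono (Set.subset_univ _)).trans ?_)
  rw [Real.dimH_univ_eq_finrank]
  simp [Module.finrank_pi_fintype, mul_comm]

/-- The set is covered by the zero loci of the finitely many minimal primes over `Q + (g)`. Each of
them contains `Q` strictly, so its transcendence degree is smaller. The dimension bound in lower
degree is a hypothesis because this lemma is also the inductive step of that bound. -/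
lemma MvPolynomial.dimH_zeroLocus_sup_lt {Q : Ideal (MvPolynomial ι ℂ)} [Q.IsPrime]
    {g : MvPolynomial ι ℂ} (hg : g ∉ Q) {m : ℕ}
    (hm : Algebra.trdeg ℂ (MvPolynomial ι ℂ ⧸ Q) ≤ m)
    (ih : ∀ k < m, ∀ P : Ideal (MvPolynomial ι ℂ), P.IsPrime →
      Algebra.trdeg ℂ (MvPolynomial ι ℂ ⧸ P) ≤ k →
        dimH {x : ι → ℂ | ∀ f ∈ P, eval x f = 0} ≤ (2 * k : ℕ)) :
    dimH {x : ι → ℂ | (∀ f ∈ Q, eval x f = 0) ∧ eval x g = 0} ≤ (2 * (m - 1) : ℕ) := by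
  set J := Q ⊔ Ideal.span {g}
  have hfin : J.minimalPrimes.Finite := Ideal.finite_minimalPrimes_of_isNoetherianRing _ J
  have hsub : {x : ι → ℂ | (∀ f ∈ Q, eval x f = 0) ∧ eval x g = 0} ⊆
      ⋃ P ∈ J.minimalPrimes, {x : ι → ℂ | ∀ f ∈ P, eval x f = 0} := by
    rintro x ⟨hx, hxg⟩
    have hprime : (RingHom.ker (eval x)).IsPrime := RingHom.ker_isPrime _
    have hle : J ≤ RingHom.ker (eval x) := by
      refine sup_le (fun f hf => hx f hf) ?_
      rw [Ideal.span_le, Set.singleton_subset_iff]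
      exact hxg
    obtain ⟨P, hP, hPx⟩ := Ideal.exists_minimalPrimes_le hle
    exact Set.mem_biUnion hP fun f hf => hPx hf
  refine (dimH_mono hsub).trans ?_
  rw [dimH_bUnion hfin.countable]
  refine iSup₂_le fun P hP => ?_
  have hPp : P.IsPrime := hP.1.1
  have hQP : Q < P := lt_of_le_of_ne (le_sup_left.trans hP.1.2) (by
    rintro rfl
    exact hg (hP.1.2 (Ideal.mem_sup_right (Ideal.mem_span_singleton_self g))))
  have hlt := Algebra.trdeg_quotient_lt_of_lt hQP hm
  obtain ⟨k, hk⟩ := Cardinal.lt_aleph0.1 (hlt.trans Cardinal.natCast_lt_aleph0)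
  rw [hk] at hlt
  have hkm : k < m := by exact_mod_cast hlt
  refine (ih k hkm P hPp hk.le).trans ?_
  exact_mod_cast (by omega : 2 * k ≤ 2 * (m - 1))

/-- Choose a maximal algebraically independent set `I` of coordinates. Every other coordinate is
algebraic over `I` and yields a relation nondegenerate in it. Where all these relations are
nondegenerate, the zero locus is locally controlled by the coordinates in `I`; the remaining points
satisfy one further equation outside `Q` and fall under the induction. -/
lemma MvPolynomial.dimH_zeroLocus_le (m : ℕ) (Q : Ideal (MvPolynomial ι ℂ)) (hQ : Q.IsPrime)
    (hm : Algebra.trdeg ℂ (MvPolynomial ι ℂ ⧸ Q) ≤ m) :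
    dimH {x : ι → ℂ | ∀ f ∈ Q, eval x f = 0} ≤ (2 * m : ℕ) := by
  classical
  induction m using Nat.strong_induction_on generalizing Q with
  | _ m ih =>
    let x : ι → MvPolynomial ι ℂ ⧸ Q := fun i => Ideal.Quotient.mk Q (X i)
    obtain ⟨I, hI⟩ : ∃ I : Finset ι, Maximal (fun I : Finset ι => AlgebraicIndepOn ℂ x (I : Set ι)) I := by
      refine Set.Finite.exists_maximal (Set.toFinite _) ⟨∅, ?_⟩
      have : FaithfulSMul ℂ (MvPolynomial ι ℂ ⧸ Q) :=
        (faithfulSMul_iff_algebraMap_injective ℂ _).2 (algebraMap ℂ (MvPolynomial ι ℂ ⧸ Q)).injective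
      have he : IsEmpty ((∅ : Finset ι) : Set ι) := by simp
      exact algebraicIndependent_empty_type_iff.2 (algebraMap ℂ (MvPolynomial ι ℂ ⧸ Q)).injective
    have hcard : I.card ≤ m := by
      have h1 := hI.prop.lift_cardinalMk_le_trdeg
      have h2 := (Cardinal.lift_le.2 hm)
      have h3 := h1.trans h2
      simp only [Cardinal.lift_natCast] at h3
      simpa using h3
    have hrel : ∀ j, j ∉ I → ∃ F ∈ Q, pderiv j F ∉ Q ∧ ∀ i, i ∉ I → i ≠ j → pderiv i F = 0 := by
      intro j hj
      refine exists_relation (I := (I : Set ι)) (by simpa using hj) ?_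
      by_contra htr
      have hins := AlgebraicIndepOn.insert hI.prop (i := j) htr
      have := hI.le_of_ge (y := insert j I) (by simpa using hins) (Finset.subset_insert j I)
      exact hj (this (Finset.mem_insert_self j I))
    choose! F hFQ hF1 hF2 using hrel
    have hsub : {x : ι → ℂ | ∀ f ∈ Q, eval x f = 0} ⊆
        {x : ι → ℂ | ∀ j, j ∉ I → eval x (F j) = 0 ∧ eval x (pderiv j (F j)) ≠ 0} ∪
        ⋃ j ∈ (Finset.univ \ I : Finset ι),
          {x : ι → ℂ | (∀ f ∈ Q, eval x f = 0) ∧ eval x (pderiv j (F j)) = 0} := by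
      intro x hx
      by_cases h : ∀ j, j ∉ I → eval x (pderiv j (F j)) ≠ 0
      · exact Or.inl fun j hj => ⟨hx _ (hFQ j hj), h j hj⟩
      · push Not at h
        obtain ⟨j, hj, h⟩ := h
        exact Or.inr (Set.mem_biUnion (by simpa using hj) ⟨hx, h⟩)
    refine (dimH_mono hsub).trans ?_
    rw [dimH_union]
    refine max_le ((dimH_nondegenerate_le I F hF2).trans ?_) ?_
    · exact_mod_cast Nat.mul_le_mul_left 2 hcard
    · rw [← Finset.set_biUnion_coe, dimH_bUnion (Finset.countable_toSet _)]
      refine iSup₂_le fun j hj => (dimH_zeroLocus_sup_lt (hF1 j (by simpa using hj)) hm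
        (fun k hk P hP hPk => ih k hk P hP hPk)).trans ?_
      exact_mod_cast (by omega : 2 * (m - 1) ≤ 2 * m)

/-- If `V` lies in the zero locus of the kernel of a homomorphism `φ` to a domain of transcendence
degree at most `m`, and `φ p ≠ 0`, then the zeros of `p` on `V` have real dimension at most
`2 (m - 1)`. -/
lemma MvPolynomial.dimH_inter_zeros_le {ι : Type} [Fintype ι] {V : Set (EuclideanSpace ℂ ι)}
    {K : Type} [CommRing K] [IsDomain K] [Algebra ℂ K] (φ : MvPolynomial ι ℂ →ₐ[ℂ] K) {m : ℕ}
    (hm : Algebra.trdeg ℂ K ≤ m) (hφ : ∀ f, φ f = 0 → ∀ X ∈ V, eval X.ofLp f = 0)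
    {p : MvPolynomial ι ℂ} (hp : φ p ≠ 0) :
    dimH {X | X ∈ V ∧ eval X.ofLp p = 0} ≤ (2 * (m - 1) : ℕ) := by
  have hprime : (RingHom.ker φ).IsPrime := RingHom.ker_isPrime φ
  have htr : Algebra.trdeg ℂ (MvPolynomial ι ℂ ⧸ RingHom.ker φ) ≤ m :=
    (trdeg_le_of_injective (Ideal.kerLiftAlg φ) (Ideal.kerLiftAlg_injective φ)).trans hm
  have h1 := dimH_zeroLocus_sup_lt (g := p) (show p ∉ RingHom.ker φ from hp) htr
    fun k _ P hP hPk => dimH_zeroLocus_le k P hP hPk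
  let e : EuclideanSpace ℂ ι ≃L[ℂ] (ι → ℂ) := EuclideanSpace.equiv ι ℂ
  rw [← e.dimH_image]
  refine (dimH_mono ?_).trans h1
  rintro _ ⟨X, ⟨hX, hXp⟩, rfl⟩
  exact ⟨fun f hf => hφ f hf X hX, hXp⟩

end AlgebraicSets

/-! ### The triangular commuting tuples -/

namespace CommTuple

variable {d n : ℕ}

/-- The upper triangular commuting tuple `A D A⁻¹`. -/
noncomputable abbrev triTuple (l : Fin n → Fin d → ℂ) (a : UpperIdx n → ℂ) : MatTuple d n :=
  Ad (unipotent a) (diagTuple l)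

lemma comp_triTuple_mul (l : Fin n → Fin d → ℂ) (a : UpperIdx n → ℂ) (r : Fin d) :
    comp (triTuple l a) r * unipotent a = unipotent a * Matrix.diagonal fun j => l j r := by
  simp [Matrix.mul_assoc, Matrix.nonsing_inv_mul _ (isUnit_det_unipotent a)]

lemma comp_triTuple_blockTriangular (l : Fin n → Fin d → ℂ) (a : UpperIdx n → ℂ) (r : Fin d) :
    (comp (triTuple l a) r).BlockTriangular id := by
  simp only [comp_Ad, comp_diagTuple]
  exact ((unipotent_blockTriangular a).mul (Matrix.blockTriangular_diagonal _)).mul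
    (blockTriangular_inv (unipotent_blockTriangular a) (isUnit_det_unipotent a))

lemma comp_triTuple_diag (l : Fin n → Fin d → ℂ) (a : UpperIdx n → ℂ) (r : Fin d) (j : Fin n) :
    comp (triTuple l a) r j j = l j r := by
  have h := congrFun (congrFun (comp_triTuple_mul l a r) j) j
  rw [diag_mul_of_blockTriangular (comp_triTuple_blockTriangular l a r)
    (unipotent_blockTriangular a)] at h
  simpa using h

lemma comp_conj_comm {B C : Matrix (Fin n) (Fin n) ℂ} (h : C * B = 1) (v w : Fin n → ℂ) :
    B * Matrix.diagonal v * C * (B * Matrix.diagonal w * C) =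
      B * Matrix.diagonal w * C * (B * Matrix.diagonal v * C) := by
  have : ∀ v w : Fin n → ℂ, B * Matrix.diagonal v * C * (B * Matrix.diagonal w * C) =
      B * (Matrix.diagonal fun i => v i * w i) * C := by
    intro v w
    rw [← Matrix.diagonal_mul_diagonal]
    calc _ = B * Matrix.diagonal v * (C * B) * Matrix.diagonal w * C := by
          simp only [Matrix.mul_assoc]
      _ = _ := by rw [h]; simp only [Matrix.mul_assoc, Matrix.one_mul]
  rw [this, this]
  simp [mul_comm]

lemma triTuple_mem_commVar (l : Fin n → Fin d → ℂ) (a : UpperIdx n → ℂ) :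
    triTuple l a ∈ commVar d n := by
  intro r s
  simp only [comp_Ad, comp_diagTuple]
  exact comp_conj_comm (Matrix.nonsing_inv_mul _ (isUnit_det_unipotent a)) _ _

lemma triTuple_mem_upperTri (l : Fin n → Fin d → ℂ) (a : UpperIdx n → ℂ) :
    triTuple l a ∈ upperTri d n :=
  ⟨triTuple_mem_commVar l a, fun r _ _ hij => comp_triTuple_blockTriangular l a r hij⟩

lemma uconj_mem_commVar {X : MatTuple d n} (hX : X ∈ commVar d n)
    (U : Matrix.unitaryGroup (Fin n) ℂ) : uconj U X ∈ commVar d n := by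
  intro r s
  have : ∀ r s, U.1 * comp X r * U.1ᴴ * (U.1 * comp X s * U.1ᴴ) =
      U.1 * (comp X r * comp X s) * U.1ᴴ := by
    intro r s
    calc _ = U.1 * comp X r * (U.1ᴴ * U.1) * comp X s * U.1ᴴ := by simp only [Matrix.mul_assoc]
      _ = _ := by rw [unitary_conjTranspose_mul]; simp only [Matrix.mul_assoc, Matrix.one_mul]
  simp only [comp_uconj, this, hX r s]

lemma triTuple_left_injective {l l' : Fin n → Fin d → ℂ} {a a' : UpperIdx n → ℂ}
    (h : triTuple l a = triTuple l' a') : l = l' := by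
  ext j r
  rw [← comp_triTuple_diag l a r j, h, comp_triTuple_diag]

/-! ### Uniqueness of the triangular form -/

section Generic

variable [NeZero d]

/-- Orderings whose first coordinates are pairwise distinct. -/
def Generic (d n : ℕ) [NeZero d] : Set (Fin n → Fin d → ℂ) :=
  {l | Function.Injective fun j => l j 0}

omit [NeZero d] in
/-- The matrix `A'⁻¹ V A` intertwines the diagonal tuples. -/
lemma intertwine {l l' : Fin n → Fin d → ℂ} {a a' : UpperIdx n → ℂ}
    {V : Matrix (Fin n) (Fin n) ℂ}
    (h : ∀ r, V * comp (triTuple l a) r = comp (triTuple l' a') r * V) (r : Fin d) :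
    ((unipotent a')⁻¹ * V * unipotent a) * (Matrix.diagonal fun j => l j r) =
      (Matrix.diagonal fun j => l' j r) * ((unipotent a')⁻¹ * V * unipotent a) := by
  have h1 := comp_triTuple_mul l a r
  have h2 := comp_triTuple_mul l' a' r
  have hi : (unipotent a')⁻¹ * unipotent a' = 1 :=
    Matrix.nonsing_inv_mul _ (isUnit_det_unipotent a')
  have hi' : unipotent a' * (unipotent a')⁻¹ = 1 :=
    Matrix.mul_nonsing_inv _ (isUnit_det_unipotent a')
  calc _ = (unipotent a')⁻¹ * V * (comp (triTuple l a) r * unipotent a) := by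
        rw [h1]; simp only [Matrix.mul_assoc]
    _ = (unipotent a')⁻¹ * (V * comp (triTuple l a) r) * unipotent a := by
        simp only [Matrix.mul_assoc]
    _ = (unipotent a')⁻¹ * comp (triTuple l' a') r * (unipotent a' * (unipotent a')⁻¹) * V *
          unipotent a := by rw [h r, hi']; simp only [Matrix.mul_assoc, Matrix.mul_one]
    _ = (unipotent a')⁻¹ * (comp (triTuple l' a') r * unipotent a') * (unipotent a')⁻¹ * V *
          unipotent a := by simp only [Matrix.mul_assoc]
    _ = ((unipotent a')⁻¹ * unipotent a') * (Matrix.diagonal fun j => l' j r) *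
          ((unipotent a')⁻¹ * V * unipotent a) := by
        rw [h2]; simp only [Matrix.mul_assoc]
    _ = _ := by rw [hi, Matrix.one_mul]

/-- The matrix `A'⁻¹ A` commutes with a diagonal matrix with distinct entries, so it is diagonal;
being unipotent, it is the identity. -/
lemma triTuple_injective {l l' : Fin n → Fin d → ℂ} {a a' : UpperIdx n → ℂ}
    (hl : l ∈ Generic d n) (h : triTuple l a = triTuple l' a') : l = l' ∧ a = a' := by
  have hll := triTuple_left_injective h
  subst hll
  refine ⟨rfl, unipotent_injective ?_⟩
  have h1 := intertwine (V := 1) (l := l) (l' := l) (a := a) (a' := a')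
    (fun r => by rw [h, Matrix.one_mul, Matrix.mul_one]) 0
  have hD : ((unipotent a')⁻¹ * 1 * unipotent a).IsDiag := isDiag_of_commute_diagonal hl h1
  rw [Matrix.mul_one] at hD
  have hone : (unipotent a')⁻¹ * unipotent a = 1 := by
    have hdiag : ∀ i, ((unipotent a')⁻¹ * unipotent a) i i = 1 := by
      intro i
      have hb := blockTriangular_inv (unipotent_blockTriangular a') (isUnit_det_unipotent a')
      rw [diag_mul_of_blockTriangular hb (unipotent_blockTriangular a)]
      have := diag_mul_of_blockTriangular hb (unipotent_blockTriangular a') i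
      rw [Matrix.nonsing_inv_mul _ (isUnit_det_unipotent a')] at this
      simpa using this.symm
    ext i j
    by_cases hij : i = j
    · subst hij; simp [hdiag]
    · rw [hD hij, Matrix.one_apply_ne hij]
  calc unipotent a = unipotent a' * ((unipotent a')⁻¹ * unipotent a) := by
        rw [← Matrix.mul_assoc, Matrix.mul_nonsing_inv _ (isUnit_det_unipotent a'), Matrix.one_mul]
    _ = unipotent a' := by rw [hone, Matrix.mul_one]

omit [NeZero d] in
lemma uconj_triTuple_intertwine {l l' : Fin n → Fin d → ℂ} {a a' : UpperIdx n → ℂ}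
    {U U' : Matrix.unitaryGroup (Fin n) ℂ}
    (h : uconj U (triTuple l a) = uconj U' (triTuple l' a')) (r : Fin d) :
    (U'⁻¹ * U).1 * comp (triTuple l a) r = comp (triTuple l' a') r * (U'⁻¹ * U).1 := by
  have h1 : uconj (U'⁻¹ * U) (triTuple l a) = triTuple l' a' := by
    rw [uconj_mul, h, uconj_inv_uconj]
  rw [← h1, comp_uconj, Matrix.mul_assoc _ (_ᴴ), unitary_conjTranspose_mul, Matrix.mul_one]

/-- Up to the diagonal torus, the unitary triangularization is determined by the ordering of the
first coordinates of the eigenvalues. -/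
lemma uconj_triTuple_injective {l l' : Fin n → Fin d → ℂ} {a a' : UpperIdx n → ℂ}
    {U U' : Matrix.unitaryGroup (Fin n) ℂ} (hl : l ∈ Generic d n)
    (h0 : ∀ j, l j 0 = l' j 0)
    (h : uconj U (triTuple l a) = uconj U' (triTuple l' a')) :
    l = l' ∧ U'⁻¹ * U ∈ diagTorus n := by
  have hint := intertwine (uconj_triTuple_intertwine h)
  set V := (U'⁻¹ * U) with hV
  set M := (unipotent a')⁻¹ * V.1 * unipotent a with hM
  have hD : M.IsDiag := by
    refine isDiag_of_commute_diagonal hl ?_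
    have := hint 0
    simp only [← h0] at this
    exact this
  -- `M` is diagonal, so `V` is both triangular and unitary, hence diagonal.
  have hVM : V.1 = unipotent a' * M * (unipotent a)⁻¹ := by
    rw [hM]
    calc V.1 = (unipotent a' * (unipotent a')⁻¹) * V.1 * (unipotent a * (unipotent a)⁻¹) := by
          rw [Matrix.mul_nonsing_inv _ (isUnit_det_unipotent a),
            Matrix.mul_nonsing_inv _ (isUnit_det_unipotent a'), Matrix.one_mul, Matrix.mul_one]
      _ = _ := by simp only [Matrix.mul_assoc]
  have hVt : V.1.BlockTriangular id := by
    rw [hVM]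
    exact ((unipotent_blockTriangular a').mul (blockTriangular_of_isDiag hD)).mul
      (blockTriangular_inv (unipotent_blockTriangular a) (isUnit_det_unipotent a))
  refine ⟨?_, isDiag_of_blockTriangular_unitary V hVt⟩
  -- The diagonal entries of the invertible `M` do not vanish and can be cancelled in the
  -- intertwining relations for all the other components.
  have hMdet : M.det ≠ 0 := by
    rw [hM, Matrix.det_mul, Matrix.det_mul, det_unipotent, mul_one, Matrix.det_nonsing_inv,
      det_unipotent]
    have : IsUnit V.1.det := Matrix.isUnit_det_of_left_inverse (unitary_conjTranspose_mul V)
    simpa using this.ne_zero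
  have hMi : ∀ i, M i i ≠ 0 := by
    rw [Matrix.det_of_isUpperTriangular (blockTriangular_of_isDiag hD)] at hMdet
    exact fun i => Finset.prod_ne_zero_iff.1 hMdet i (Finset.mem_univ i)
  ext j r
  have := congrFun (congrFun (hint r) j) j
  rw [Matrix.mul_diagonal, Matrix.diagonal_mul, mul_comm] at this
  exact mul_right_cancel₀ (hMi j) this

end Generic

/-! ### Characteristic polynomials and permutations of eigenvalues -/

section Spectrum

lemma charpoly_uconj (U : Matrix.unitaryGroup (Fin n) ℂ) (M : Matrix (Fin n) (Fin n) ℂ) :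
    (U.1 * M * U.1ᴴ).charpoly = M.charpoly := by
  let u : (Matrix (Fin n) (Fin n) ℂ)ˣ :=
    ⟨U.1, U.1ᴴ, unitary_mul_conjTranspose U, unitary_conjTranspose_mul U⟩
  have := Matrix.charpoly_units_conj u M
  rwa [← Matrix.coe_units_inv] at this

lemma roots_charpoly_of_blockTriangular {M : Matrix (Fin n) (Fin n) ℂ}
    (hM : M.BlockTriangular id) : M.charpoly.roots = Finset.univ.val.map fun i => M i i := by
  rw [Matrix.charpoly_of_isUpperTriangular M hM]
  have := Polynomial.roots_multiset_prod_X_sub_C (Finset.univ.val.map fun i => M i i)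
  rwa [Multiset.map_map] at this

lemma exists_perm_of_map_eq {α : Type*} {f g : Fin n → α} (hg : Function.Injective g)
    (h : Finset.univ.val.map f = Finset.univ.val.map g) :
    ∃ σ : Equiv.Perm (Fin n), f = g ∘ σ := by
  have hf : Function.Injective f := by
    have h1 : (Finset.univ.val.map g).Nodup := Finset.univ.nodup.map hg
    rw [← h] at h1
    intro i j hij
    exact Multiset.inj_on_of_nodup_map h1 i (Finset.mem_univ i) j (Finset.mem_univ j) hij
  have hmem : ∀ i, ∃ j, g j = f i := by
    intro i
    have : f i ∈ Finset.univ.val.map g := by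
      rw [← h]; exact Multiset.mem_map_of_mem f (Finset.mem_univ i)
    obtain ⟨j, -, hj⟩ := Multiset.mem_map.1 this
    exact ⟨j, hj⟩
  choose τ hτ using hmem
  have hτi : Function.Injective τ := fun i j hij => hf (by rw [← hτ, ← hτ, hij])
  exact ⟨Equiv.ofBijective τ (Finite.injective_iff_bijective.1 hτi), funext fun i => (hτ i).symm⟩

lemma roots_charpoly_uconj_triTuple [NeZero d] (U : Matrix.unitaryGroup (Fin n) ℂ)
    (l : Fin n → Fin d → ℂ) (a : UpperIdx n → ℂ) :
    (comp (uconj U (triTuple l a)) 0).charpoly.roots = Finset.univ.val.map fun j => l j 0 := by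
  rw [comp_uconj, charpoly_uconj,
    roots_charpoly_of_blockTriangular (comp_triTuple_blockTriangular l a 0)]
  simp only [comp_triTuple_diag]

end Spectrum

/-! ### Simultaneous diagonalization and orderings of the spectrum -/

section Diagonalization

open Polynomial in
/-- If `p'(M)` is invertible for the characteristic polynomial `p` of `M`, then `M` is
diagonalizable with distinct eigenvalues. -/
lemma exists_diagonalization (M : Matrix (Fin n) (Fin n) ℂ)
    (hM : (aeval M (derivative M.charpoly)).det ≠ 0) :
    ∃ (B : Matrix (Fin n) (Fin n) ℂ) (μ : Fin n → ℂ), IsUnit B.det ∧ Function.Injective μ ∧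
      M * B = B * Matrix.diagonal μ := by
  have hp0 : M.charpoly ≠ 0 := M.charpoly_monic.ne_zero
  let f : Module.End ℂ (Fin n → ℂ) := Matrix.toLin' M
  have hev : ∀ x ∈ M.charpoly.roots, f.HasEigenvalue x := by
    intro x hx
    rw [Module.End.hasEigenvalue_iff_isRoot_charpoly, Matrix.charpoly_toLin']
    exact isRoot_of_mem_roots hx
  -- At a multiple root `x` the derivative vanishes as well, so the matrix `p'(M)` kills the
  -- eigenvectors for `x`, against its invertibility.
  have hnodup : M.charpoly.roots.Nodup := by
    rw [Multiset.nodup_iff_count_le_one]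
    intro x
    by_contra! hx
    rw [count_roots, one_lt_rootMultiplicity_iff_isRoot hp0] at hx
    obtain ⟨v, hv⟩ := (hev x ((mem_roots hp0).2 hx.1)).exists_hasEigenvector
    have h1 := Module.End.aeval_apply_of_hasEigenvector (p := derivative M.charpoly) hv
    rw [hx.2.eq_zero, zero_smul] at h1
    have h2 : aeval f (derivative M.charpoly) = Matrix.toLin' (aeval M (derivative M.charpoly)) := by
      have := aeval_algHom_apply (Matrix.toLinAlgEquiv' (R := ℂ) (n := Fin n)).toAlgHom M
        (derivative M.charpoly)
      exact this
    rw [h2, Matrix.toLin'_apply] at h1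
    exact hM (Matrix.exists_mulVec_eq_zero_iff.1 ⟨v, hv.2, h1⟩)
  have hcard : Fintype.card (M.charpoly.roots.toFinset) = Fintype.card (Fin n) := by
    rw [Fintype.card_coe, Multiset.toFinset_card_of_nodup hnodup,
      splits_iff_card_roots.1 (IsAlgClosed.splits _), Matrix.charpoly_natDegree_eq_dim]
  let e : Fin n ≃ M.charpoly.roots.toFinset := (Fintype.equivOfCardEq hcard).symm
  let μ : Fin n → ℂ := fun i => e i
  have hμ : Function.Injective μ := Subtype.val_injective.comp e.injective
  have hex : ∀ i, ∃ v, f.HasEigenvector (μ i) v := fun i =>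
    (hev (μ i) (Multiset.mem_toFinset.1 (e i).2)).exists_hasEigenvector
  choose v hv using hex
  have hli : LinearIndependent ℂ v := Module.End.eigenvectors_linearIndependent' f μ hμ v hv
  let B : Matrix (Fin n) (Fin n) ℂ := Matrix.of fun i j => v j i
  refine ⟨B, μ, ?_, hμ, ?_⟩
  · have : LinearIndependent ℂ B.col := hli
    exact (Matrix.isUnit_iff_isUnit_det _).1 (Matrix.linearIndependent_cols_iff_isUnit.1 this)
  · ext i j
    rw [Matrix.mul_diagonal]
    have h1 : M *ᵥ v j = μ j • v j := (hv j).apply_eq_smul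
    have := congrFun h1 i
    simpa [Matrix.mul_apply, Matrix.mulVec, dotProduct, B, mul_comm] using this

/-- Decompose `B = U A δ`. The diagonal factor `δ` commutes with every diagonal matrix and drops out
of the conjugation. -/
lemma exists_uconj_triTuple_of_conj {X : MatTuple d n} {B : Matrix (Fin n) (Fin n) ℂ}
    {l : Fin n → Fin d → ℂ} (hB : IsUnit B.det)
    (h : ∀ r, comp X r * B = B * Matrix.diagonal fun j => l j r) :
    ∃ U a, X = uconj U (triTuple l a) := by
  obtain ⟨U, a, δ, hδ, rfl⟩ := exists_unitary_unipotent_diagonal hB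
  refine ⟨U, a, matTuple_ext fun r => ?_⟩
  have hr := h r
  have h1 : comp X r * (U.1 * unipotent a) =
      U.1 * unipotent a * Matrix.diagonal fun j => l j r := by
    have hδδ : Matrix.diagonal δ * Matrix.diagonal (fun i => (δ i)⁻¹) = 1 := by
      simp [Matrix.diagonal_mul_diagonal, hδ]
    calc _ = comp X r * (U.1 * unipotent a * Matrix.diagonal δ) *
          Matrix.diagonal (fun i => (δ i)⁻¹) := by
          simp only [Matrix.mul_assoc, hδδ, Matrix.mul_one]
      _ = U.1 * unipotent a * (Matrix.diagonal δ * (Matrix.diagonal fun j => l j r) *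
          Matrix.diagonal (fun i => (δ i)⁻¹)) := by rw [hr]; simp only [Matrix.mul_assoc]
      _ = _ := by
        rw [Matrix.diagonal_mul_diagonal, Matrix.diagonal_mul_diagonal]
        congr 2
        ext i
        field_simp [hδ i]
  have h2 : U.1 * unipotent a * ((unipotent a)⁻¹ * U.1ᴴ) = 1 := by
    calc _ = U.1 * (unipotent a * (unipotent a)⁻¹) * U.1ᴴ := by simp only [Matrix.mul_assoc]
      _ = 1 := by
        rw [Matrix.mul_nonsing_inv _ (isUnit_det_unipotent a), Matrix.mul_one,
          unitary_mul_conjTranspose]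
  calc comp X r = comp X r * (U.1 * unipotent a) * ((unipotent a)⁻¹ * U.1ᴴ) := by
        rw [Matrix.mul_assoc, h2, Matrix.mul_one]
    _ = comp (uconj U (triTuple l a)) r := by
        rw [h1]; simp [Matrix.mul_assoc]

variable [NeZero d]

-- The other components commute with the first, which has distinct eigenvalues, so they are diagonal
-- in its eigenbasis.
open Polynomial in
lemma exists_uconj_triTuple {X : MatTuple d n} (hX : X ∈ commVar d n)
    (h : (aeval (comp X 0) (derivative (comp X 0).charpoly)).det ≠ 0) :
    ∃ U l a, l ∈ Generic d n ∧ X = uconj U (triTuple l a) := by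
  obtain ⟨B, μ, hB, hμ, hMB⟩ := exists_diagonalization _ h
  have hBB : B * B⁻¹ = 1 := Matrix.mul_nonsing_inv _ hB
  have hBB' : B⁻¹ * B = 1 := Matrix.nonsing_inv_mul _ hB
  have hdiag : ∀ r, (B⁻¹ * comp X r * B).IsDiag := by
    intro r
    refine isDiag_of_commute_diagonal hμ ?_
    have hD : Matrix.diagonal μ = B⁻¹ * comp X 0 * B := by
      rw [Matrix.mul_assoc, hMB, ← Matrix.mul_assoc, hBB', Matrix.one_mul]
    rw [hD]
    calc _ = B⁻¹ * comp X r * (B * B⁻¹) * comp X 0 * B := by simp only [Matrix.mul_assoc]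
      _ = B⁻¹ * (comp X r * comp X 0) * B := by rw [hBB]; simp only [Matrix.mul_assoc, Matrix.one_mul]
      _ = B⁻¹ * comp X 0 * (B * B⁻¹) * comp X r * B := by
        rw [hX r 0, hBB]; simp only [Matrix.mul_assoc, Matrix.one_mul]
      _ = _ := by simp only [Matrix.mul_assoc]
  have hconj : ∀ r, comp X r * B = B * Matrix.diagonal fun j => (B⁻¹ * comp X r * B) j j := by
    intro r
    have := (hdiag r).diagonal_diag
    change Matrix.diagonal (fun j => (B⁻¹ * comp X r * B) j j) = _ at this
    rw [this, ← Matrix.mul_assoc, ← Matrix.mul_assoc, hBB, Matrix.one_mul]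
  obtain ⟨U, a, hUa⟩ := exists_uconj_triTuple_of_conj
    (l := fun j r => (B⁻¹ * comp X r * B) j j) hB hconj
  refine ⟨U, _, a, ?_, hUa⟩
  intro i j hij
  apply hμ
  have : ∀ i, (B⁻¹ * comp X 0 * B) i i = μ i := by
    intro i
    rw [Matrix.mul_assoc, hMB, ← Matrix.mul_assoc, hBB', Matrix.one_mul]
    simp
  simpa [this] using hij

open Polynomial in
lemma aeval_blockTriangular {M : Matrix (Fin n) (Fin n) ℂ} (hM : M.BlockTriangular id)
    (p : ℂ[X]) : (aeval M p).BlockTriangular id ∧ ∀ i, aeval M p i i = p.eval (M i i) := by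
  induction p using Polynomial.induction_on' with
  | add p q hp hq =>
    refine ⟨by rw [map_add]; exact hp.1.add hq.1, fun i => ?_⟩
    rw [map_add, Matrix.add_apply, hp.2, hq.2, eval_add]
  | monomial k c =>
    induction k with
    | zero =>
      rw [monomial_zero_left, aeval_C]
      refine ⟨?_, fun i => by simp [Matrix.algebraMap_matrix_apply]⟩
      rw [Matrix.algebraMap_eq_diagonal]
      exact Matrix.blockTriangular_diagonal _
    | succ k ih =>
      rw [← monomial_mul_X, map_mul, aeval_X]
      refine ⟨ih.1.mul hM, fun i => ?_⟩
      rw [diag_mul_of_blockTriangular ih.1 hM, ih.2, eval_mul, eval_X]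

open Polynomial in
lemma aeval_conj {M N B : Matrix (Fin n) (Fin n) ℂ} (h : M * B = B * N) (p : ℂ[X]) :
    aeval M p * B = B * aeval N p := by
  induction p using Polynomial.induction_on' with
  | add p q hp hq => rw [map_add, map_add, Matrix.add_mul, Matrix.mul_add, hp, hq]
  | monomial k c =>
    induction k with
    | zero => simp [monomial_zero_left, Algebra.algebraMap_eq_smul_one]
    | succ k ih =>
      rw [← monomial_mul_X, map_mul, map_mul, aeval_X, aeval_X, Matrix.mul_assoc, h,
        ← Matrix.mul_assoc, ih, Matrix.mul_assoc]

omit [NeZero d] in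
lemma comp_uconj_triTuple_mul (l : Fin n → Fin d → ℂ) (a : UpperIdx n → ℂ)
    (U : Matrix.unitaryGroup (Fin n) ℂ) (r : Fin d) :
    comp (uconj U (triTuple l a)) r * (U.1 * unipotent a) =
      (U.1 * unipotent a) * Matrix.diagonal fun j => l j r := by
  have := comp_triTuple_mul l a r
  rw [comp_uconj]
  calc _ = U.1 * comp (triTuple l a) r * (U.1ᴴ * U.1) * unipotent a := by
        simp only [Matrix.mul_assoc]
    _ = U.1 * (comp (triTuple l a) r * unipotent a) := by
        rw [unitary_conjTranspose_mul]; simp only [Matrix.mul_assoc, Matrix.one_mul]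
    _ = _ := by rw [this, Matrix.mul_assoc]

omit [NeZero d] in
lemma isUnit_det_unitary_mul_unipotent (U : Matrix.unitaryGroup (Fin n) ℂ) (a : UpperIdx n → ℂ) :
    IsUnit (U.1 * unipotent a).det := by
  rw [Matrix.det_mul, det_unipotent, mul_one]
  exact Matrix.isUnit_det_of_left_inverse (unitary_conjTranspose_mul U)

omit [NeZero d] in
/-- The eigenvalues on the diagonal of a joint triangular form can be permuted. -/
lemma exists_uconj_triTuple_comp (l : Fin n → Fin d → ℂ) (a : UpperIdx n → ℂ)
    (U : Matrix.unitaryGroup (Fin n) ℂ) (σ : Equiv.Perm (Fin n)) :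
    ∃ V b, uconj U (triTuple l a) = uconj V (triTuple (l ∘ σ) b) := by
  let P : Matrix (Fin n) (Fin n) ℂ := (σ⁻¹ : Equiv.Perm (Fin n)).permMatrix ℂ
  have hP : IsUnit P.det := by
    simp only [P, Matrix.det_permutation]
    exact ((Equiv.Perm.sign σ⁻¹).isUnit.map (Int.castRingHom ℂ))
  have hDP : ∀ r, (Matrix.diagonal fun j => l j r) * P =
      P * Matrix.diagonal fun j => (l ∘ σ) j r := by
    intro r
    ext i j
    rw [Matrix.diagonal_mul, Matrix.mul_diagonal]
    by_cases hij : σ⁻¹ i = j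
    · subst hij; simp [mul_comm]
    · have hij' : ¬ (Equiv.symm σ) i = j := hij
      simp [P, PEquiv.toMatrix_apply, Equiv.Perm.permMatrix, hij']
  exact exists_uconj_triTuple_of_conj (l := l ∘ σ)
    (B := U.1 * unipotent a * P) (by rw [Matrix.det_mul]; exact (isUnit_det_unitary_mul_unipotent U a).mul hP)
    (fun r => by rw [← Matrix.mul_assoc, comp_uconj_triTuple_mul, Matrix.mul_assoc, hDP]; simp only [Matrix.mul_assoc])

/-- The first coordinates of an ordering are the eigenvalues of the first component, in some order.
By Lagrange interpolation every component of `X` is a polynomial in the first one, and the same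
polynomial relates the diagonals of any joint triangular form. So the first coordinates determine
the others, and the orderings are precisely the permutations of `l`. -/
lemma orderings_uconj_triTuple {l : Fin n → Fin d → ℂ} (hl : l ∈ Generic d n)
    (a : UpperIdx n → ℂ) (U : Matrix.unitaryGroup (Fin n) ℂ) :
    orderings (uconj U (triTuple l a)) = Set.range fun σ : Equiv.Perm (Fin n) => l ∘ σ := by
  set X := uconj U (triTuple l a) with hX
  have hXB : ∀ r, comp X r * (U.1 * unipotent a) =
      (U.1 * unipotent a) * Matrix.diagonal fun j => l j r := comp_uconj_triTuple_mul l a U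
  have hBu : IsUnit (U.1 * unipotent a).det := isUnit_det_unitary_mul_unipotent U a
  ext m
  constructor
  · rintro ⟨V, hV, hm⟩
    set Q := uconj V⁻¹ X with hQ
    have hXQ : X = uconj V Q := by rw [hQ, uconj_uconj_inv]
    have hQt : ∀ r, (comp Q r).BlockTriangular id := fun r i j hij => hV r i j hij
    have hdiag : ∀ r j, comp Q r j j = m j r := fun r j => (hm r j).symm
    have hroots := roots_charpoly_uconj_triTuple U l a
    rw [← hX, hXQ, comp_uconj, charpoly_uconj, roots_charpoly_of_blockTriangular (hQt 0)] at hroots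
    simp only [hdiag] at hroots
    obtain ⟨σ, hσ⟩ := exists_perm_of_map_eq hl hroots
    refine ⟨σ, ?_⟩
    ext j r
    let p := Lagrange.interpolate Finset.univ (fun j => l j 0) (fun j => l j r)
    have hp : ∀ j, p.eval (l j 0) = l j r := fun j =>
      Lagrange.eval_interpolate_at_node _ (hl.injOn) (Finset.mem_univ j)
    have hXr : comp X r = Polynomial.aeval (comp X 0) p := by
      have h1 := aeval_conj (hXB 0) p
      have h2 : Polynomial.aeval (Matrix.diagonal fun j => l j 0) p =
          Matrix.diagonal fun j => l j r := by
        have h3 := aeval_conj (B := (1 : Matrix (Fin n) (Fin n) ℂ))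
          (M := Matrix.diagonal fun j => l j 0) (N := Matrix.diagonal fun j => l j 0) (by simp) p
        have h4 := (Polynomial.aeval_algHom_apply
          (Matrix.diagonalAlgHom ℂ : (Fin n → ℂ) →ₐ[ℂ] Matrix (Fin n) (Fin n) ℂ)
          (fun j => l j 0) p)
        simp only [Matrix.diagonalAlgHom_apply] at h4
        rw [h4]
        congr 1
        ext j
        rw [← hp j]
        exact (Polynomial.aeval_algHom_apply (Pi.evalAlgHom ℂ (fun _ : Fin n => ℂ) j)
          (fun j => l j 0) p).symm.trans (by simp [Polynomial.aeval_def, Polynomial.eval₂_eq_eval_map])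
      rw [h2, ← hXB r] at h1
      have h5 := congrArg (· * (U.1 * unipotent a)⁻¹) h1
      simp only [Matrix.mul_assoc, Matrix.mul_nonsing_inv _ hBu, Matrix.mul_one] at h5
      exact h5.symm
    have hQr : comp Q r = Polynomial.aeval (comp Q 0) p := by
      have h1 : ∀ r, comp X r * V.1 = V.1 * comp Q r := fun r => by
        rw [hXQ, comp_uconj, Matrix.mul_assoc _ _ V.1, unitary_conjTranspose_mul, Matrix.mul_one]
      have h2 := aeval_conj (h1 0) p
      rw [← hXr, h1 r] at h2
      have h3 := congrArg (V.1ᴴ * ·) h2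
      simpa only [← Matrix.mul_assoc, unitary_conjTranspose_mul, Matrix.one_mul] using h3
    have h6 := (aeval_blockTriangular (hQt 0) p).2 j
    rw [← hQr, hdiag, hdiag] at h6
    have h7 : m j 0 = l (σ j) 0 := congrFun hσ j
    rw [h6, h7, hp]
    rfl
  · rintro ⟨σ, rfl⟩
    obtain ⟨V, b, hVb⟩ := exists_uconj_triTuple_comp l a U σ
    refine ⟨V, fun r i j hij => ?_, fun r j => ?_⟩
    · rw [hX, hVb, uconj_inv_uconj]
      exact comp_triTuple_blockTriangular _ b r hij
    · rw [hX, hVb, uconj_inv_uconj]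
      exact (comp_triTuple_diag _ b r j).symm

end Diagonalization

end CommTuple

namespace CommTuple

variable {d n : ℕ}

/-! ### Almost every commuting tuple is generic -/

section NullSet

open Polynomial in
/-- The polynomial `det p'(X^r)`, where `p` is the characteristic polynomial of `X^r`. -/
noncomputable def discPoly (d n : ℕ) (r : Fin d) : MvPolynomial (Fin d × Fin n × Fin n) ℂ :=
  let M : Matrix (Fin n) (Fin n) (MvPolynomial (Fin d × Fin n × Fin n) ℂ) :=
    Matrix.of fun i j => MvPolynomial.X (r, i, j)
  (aeval M (derivative M.charpoly)).det

open Polynomial in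
lemma eval_discPoly (r : Fin d) (X : MatTuple d n) :
    MvPolynomial.eval X.ofLp (discPoly d n r) =
      (aeval (comp X r) (derivative (comp X r).charpoly)).det := by
  set M : Matrix (Fin n) (Fin n) (MvPolynomial (Fin d × Fin n × Fin n) ℂ) :=
    Matrix.of fun i j => MvPolynomial.X (r, i, j) with hM
  set e := MvPolynomial.eval (R := ℂ) X.ofLp with he
  have hMX : M.map e = comp X r := by
    ext i j
    simp [M, e, comp]
  have h1 : e.mapMatrix (aeval M (derivative M.charpoly)) =
      aeval (e.mapMatrix M) ((derivative M.charpoly).map e) := by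
    refine Polynomial.map_aeval_eq_aeval_map ?_ _ _
    refine RingHom.ext fun p => ?_
    ext i j
    by_cases hij : i = j <;> simp [Matrix.algebraMap_matrix_apply, hij]
  change e (aeval M (derivative M.charpoly)).det = _
  rw [RingHom.map_det, h1, ← derivative_map, ← Matrix.charpoly_map]
  simp only [RingHom.mapMatrix_apply, hMX]

-- For `p = ∏ (X - v_j)`, the diagonal entries of `p'` at the diagonal matrix are `p'(v_i) = ∏_{j ≠
-- i} (v_i - v_j)`.
open Polynomial in
lemma det_aeval_derivative_diagonal_ne_zero {v : Fin n → ℂ} (hv : Function.Injective v) :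
    (aeval (Matrix.diagonal v) (derivative (Matrix.diagonal v).charpoly)).det ≠ 0 := by
  have hb := aeval_blockTriangular (Matrix.blockTriangular_diagonal (b := id) v)
    (derivative (Matrix.diagonal v).charpoly)
  rw [Matrix.det_of_isUpperTriangular hb.1]
  refine Finset.prod_ne_zero_iff.2 fun i _ => ?_
  rw [hb.2, Matrix.charpoly_of_isUpperTriangular _ (Matrix.blockTriangular_diagonal (b := id) v)]
  simp only [Matrix.diagonal_apply_eq]
  rw [derivative_prod_finset, eval_finsetSum]
  simp only [eval_mul, eval_prod]
  rw [Finset.sum_eq_single i]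
  · simp only [derivative_sub, derivative_X, derivative_C, sub_zero, eval_one, mul_one, eval_sub,
      eval_X, eval_C]
    refine Finset.prod_ne_zero_iff.2 fun j hj => ?_
    have : j ≠ i := Finset.ne_of_mem_erase hj
    exact sub_ne_zero.2 (hv.ne this.symm)
  · intro j _ hji
    rw [Finset.prod_eq_zero (Finset.mem_erase.2 ⟨hji.symm, Finset.mem_univ i⟩), zero_mul]
    simp
  · simp

/-- Parameters of a diagonal tuple and of a matrix with ones on the diagonal. -/
abbrev ConjIdx (d n : ℕ) := (Fin n × Fin d) ⊕ {p : Fin n × Fin n // p.1 ≠ p.2}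

lemma card_conjIdx : Fintype.card (ConjIdx d n) = n * (n - 1) + d * n := by
  have h1 : Fintype.card {p : Fin n × Fin n // p.1 ≠ p.2} = n * (n - 1) := by
    rw [Fintype.card_subtype]
    have := Finset.offDiag_card (Finset.univ : Finset (Fin n))
    simp only [Finset.card_univ, Fintype.card_fin] at this
    rw [Nat.mul_sub, mul_one, ← this]
    congr 1
    ext p
    simp
  simp [h1]
  ring

/-- The matrix with ones on the diagonal and the given off-diagonal entries. -/
def unitDiag {R : Type*} [One R] (x : ConjIdx d n → R) : Matrix (Fin n) (Fin n) R :=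
  Matrix.of fun i j => if h : i = j then 1 else x (Sum.inr ⟨(i, j), h⟩)

/-- The polynomial parametrization `(D, B) ↦ B D adj(B)`. -/
def conjParam {R : Type*} [CommRing R] (x : ConjIdx d n → R) (r : Fin d) :
    Matrix (Fin n) (Fin n) R :=
  unitDiag x * (Matrix.diagonal fun j => x (Sum.inl (j, r))) * (unitDiag x).adjugate

lemma map_conjParam {R S : Type*} [CommRing R] [CommRing S] (f : R →+* S) (x : ConjIdx d n → R)
    (r : Fin d) : (conjParam x r).map f = conjParam (f ∘ x) r := by
  have h : (unitDiag x).map f = unitDiag (f ∘ x) := by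
    ext i j
    simp only [unitDiag, Matrix.map_apply, Matrix.of_apply]
    split_ifs <;> simp
  have h2 := f.map_adjugate (unitDiag x)
  simp only [RingHom.mapMatrix_apply] at h2
  rw [conjParam, Matrix.map_mul, Matrix.map_mul, h2, h, Matrix.diagonal_map (map_zero f)]
  rfl

/-- The comorphism of `conjParam`. -/
noncomputable def conjHom (d n : ℕ) : MvPolynomial (Fin d × Fin n × Fin n) ℂ →ₐ[ℂ]
    MvPolynomial (ConjIdx d n) ℂ :=
  MvPolynomial.aeval fun p => conjParam (fun t => MvPolynomial.X t) p.1 p.2.1 p.2.2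

lemma eval_conjHom (x : ConjIdx d n → ℂ) (f : MvPolynomial (Fin d × Fin n × Fin n) ℂ) :
    MvPolynomial.eval x (conjHom d n f) =
      MvPolynomial.eval (ofComp fun r => conjParam x r : MatTuple d n).ofLp f := by
  have h1 : ∀ p : Fin d × Fin n × Fin n, MvPolynomial.eval x
      (conjParam (fun t => (MvPolynomial.X t : MvPolynomial (ConjIdx d n) ℂ)) p.1 p.2.1 p.2.2) =
      (ofComp fun r => conjParam x r : MatTuple d n).ofLp p := by
    intro p
    have := congrFun (congrFun (map_conjParam (MvPolynomial.eval x)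
      (fun t => (MvPolynomial.X t : MvPolynomial (ConjIdx d n) ℂ)) p.1) p.2.1) p.2.2
    rw [Matrix.map_apply] at this
    rw [this]
    have hx : (MvPolynomial.eval x : _ → ℂ) ∘ (fun t : ConjIdx d n => MvPolynomial.X t) = x := by
      ext t; simp
    rw [hx]
    rfl
  have h2 : (MvPolynomial.aeval x).comp (conjHom d n) =
      (MvPolynomial.aeval (ofComp fun r => conjParam x r : MatTuple d n).ofLp :
        MvPolynomial (Fin d × Fin n × Fin n) ℂ →ₐ[ℂ] ℂ) := by
    ext p
    rw [AlgHom.comp_apply, conjHom, MvPolynomial.aeval_X, MvPolynomial.aeval_X]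
    exact h1 p
  exact congrArg (fun g => g f) h2

/-- Scaling the columns of `B` so that its diagonal becomes `1` does not change `B D B⁻¹`. Since
`adj B = det B · B⁻¹`, dividing `D` by the determinant puts the tuple in the image of the polynomial
map `conjParam`, on which `f` vanishes. -/
lemma eval_eq_zero_of_diag_ne_zero {f : MvPolynomial (Fin d × Fin n × Fin n) ℂ}
    (hf : conjHom d n f = 0) {B : Matrix (Fin n) (Fin n) ℂ} (hB : IsUnit B.det)
    (hdiag : ∀ j, B j j ≠ 0) (l : Fin n → Fin d → ℂ) :
    MvPolynomial.eval (Ad B (diagTuple l)).ofLp f = 0 := by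
  let B₁ : Matrix (Fin n) (Fin n) ℂ := B * Matrix.diagonal fun j => (B j j)⁻¹
  have hBB : B = B₁ * Matrix.diagonal fun j => B j j := by
    simp [B₁, Matrix.mul_assoc, Matrix.diagonal_mul_diagonal, hdiag]
  have hdet : B₁.det ≠ 0 := by
    intro h
    rw [hBB, Matrix.det_mul, h, zero_mul] at hB
    simp at hB
  let x : ConjIdx d n → ℂ := Sum.elim (fun p => B₁.det⁻¹ * l p.1 p.2) fun p => B₁ p.1.1 p.1.2
  have hx : unitDiag x = B₁ := by
    ext i j
    by_cases hij : i = j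
    · subst hij; simp [unitDiag, B₁, hdiag]
    · simp [unitDiag, x, hij]
  have hX : Ad B (diagTuple l) = ofComp fun r => conjParam x r := by
    refine matTuple_ext fun r => ?_
    rw [comp_Ad, comp_ofComp, conjParam, hx, comp_diagTuple]
    have h1 : (Matrix.diagonal fun j => x (Sum.inl (j, r))) =
        B₁.det⁻¹ • Matrix.diagonal fun j => l j r := by
      ext i j
      by_cases hij : i = j
      · subst hij; simp [x]
      · simp [hij]
    have hB1 : IsUnit B₁.det := isUnit_iff_ne_zero.2 hdet
    have h2 : B₁⁻¹ = B₁.det⁻¹ • B₁.adjugate := by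
      rw [Matrix.inv_def, Ring.inverse_eq_inv']
    have h3 : B * (Matrix.diagonal fun j => l j r) = B₁ * (Matrix.diagonal fun j => l j r) * B₁⁻¹ * B := by
      have h4 : B₁⁻¹ * B = Matrix.diagonal fun j => B j j := by
        conv_lhs => rw [hBB]
        rw [← Matrix.mul_assoc, Matrix.nonsing_inv_mul _ hB1, Matrix.one_mul]
      rw [Matrix.mul_assoc _ _ B, h4]
      calc B * (Matrix.diagonal fun j => l j r)
          = B₁ * (Matrix.diagonal fun j => B j j) * (Matrix.diagonal fun j => l j r) := by
            rw [← hBB]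
        _ = _ := by simp [Matrix.mul_assoc, Matrix.diagonal_mul_diagonal, mul_comm]
    rw [h1, h3, Matrix.mul_assoc _ B, Matrix.mul_nonsing_inv _ hB, Matrix.mul_one, h2]
    simp [Matrix.mul_assoc]
  rw [hX, ← eval_conjHom, hf, map_zero]

/-- For small `t ≠ 0` the matrix `B + t` is invertible and has no zero on its diagonal. Let `t` tend
to `0`. -/
lemma eval_eq_zero_of_conj {f : MvPolynomial (Fin d × Fin n × Fin n) ℂ}
    (hf : conjHom d n f = 0) {B : Matrix (Fin n) (Fin n) ℂ} (hB : IsUnit B.det)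
    (l : Fin n → Fin d → ℂ) :
    MvPolynomial.eval (Ad B (diagTuple l)).ofLp f = 0 := by
  let c : ℂ → Matrix (Fin n) (Fin n) ℂ := fun t => B + t • 1
  have hc : Continuous c := by fun_prop
  have hc0 : c 0 = B := by simp [c]
  have hdet : ∀ᶠ t in 𝓝 (0 : ℂ), (c t).det ≠ 0 := by
    have h1 : Continuous fun t => (c t).det := hc.matrix_det
    exact h1.continuousAt.eventually_ne (by rw [hc0]; exact hB.ne_zero)
  have hdiag : ∀ᶠ t in 𝓝[≠] (0 : ℂ), ∀ j, c t j j ≠ 0 := by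
    rw [Filter.eventually_all]
    intro j
    have : ∀ t, c t j j = B j j + t := fun t => by simp [c]
    simp only [this]
    by_cases hj : B j j = 0
    · filter_upwards [self_mem_nhdsWithin] with t ht
      rw [hj, zero_add]; exact ht
    · refine Filter.Eventually.filter_mono nhdsWithin_le_nhds ?_
      have h1 : Continuous fun t : ℂ => B j j + t := by fun_prop
      exact h1.continuousAt.eventually_ne (by simpa using hj)
  have hcont : ContinuousAt (fun t => MvPolynomial.eval (Ad (c t) (diagTuple l)).ofLp f) 0 := by
    have h1 : ContinuousAt (fun t => (c t)⁻¹) 0 := by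
      have h2 : ∀ t, (c t)⁻¹ = (c t).det⁻¹ • (c t).adjugate := fun t => by
        rw [Matrix.inv_def, Ring.inverse_eq_inv']
      simp only [h2]
      have h3 : ContinuousAt (fun t => (c t).det⁻¹) 0 :=
        hc.matrix_det.continuousAt.inv₀ (by rw [hc0]; exact hB.ne_zero)
      exact h3.smul hc.matrix_adjugate.continuousAt
    have h3 : ContinuousAt (fun t => (Ad (c t) (diagTuple l)).ofLp) 0 := by
      rw [continuousAt_pi]
      rintro ⟨r, i, j⟩
      have h4 : ContinuousAt (fun t => c t * comp (diagTuple l) r * (c t)⁻¹) 0 :=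
        (hc.continuousAt.mul continuousAt_const).mul h1
      have h5 : Continuous fun M : Matrix (Fin n) (Fin n) ℂ => M i j := by fun_prop
      exact h5.continuousAt.comp h4
    exact ((MvPolynomial.continuous_eval f).continuousAt).comp h3
  have hzero : ∀ᶠ t in 𝓝[≠] (0 : ℂ),
      MvPolynomial.eval (Ad (c t) (diagTuple l)).ofLp f = 0 := by
    filter_upwards [hdiag, hdet.filter_mono nhdsWithin_le_nhds] with t h1 h2
    exact eval_eq_zero_of_diag_ne_zero hf (isUnit_iff_ne_zero.2 h2) h1 l
  have h1 := hcont.tendsto.mono_left (nhdsWithin_le_nhds (s := {(0 : ℂ)}ᶜ))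
  have h2 := tendsto_nhds_unique h1 (tendsto_const_nhds.congr' (hzero.mono fun t ht => ht.symm))
  simpa [hc0] using h2

/-- The commuting tuples whose first component has distinct eigenvalues. -/
def genericSet (d n : ℕ) [NeZero d] : Set (MatTuple d n) :=
  {X | ∃ U l a, l ∈ Generic d n ∧ X = uconj U (triTuple l a)}

lemma uconj_triTuple_eq_Ad (U : Matrix.unitaryGroup (Fin n) ℂ) (l : Fin n → Fin d → ℂ)
    (a : UpperIdx n → ℂ) : uconj U (triTuple l a) = Ad (U.1 * unipotent a) (diagTuple l) := by
  refine matTuple_ext fun r => ?_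
  have hinv : U.1⁻¹ = U.1ᴴ := Matrix.inv_eq_left_inv (unitary_conjTranspose_mul U)
  rw [comp_uconj, comp_Ad, comp_Ad, Matrix.mul_inv_rev, hinv]
  simp only [Matrix.mul_assoc]

lemma exists_mem_generic (d n : ℕ) [NeZero d] : ∃ l, l ∈ Generic d n :=
  ⟨fun j _ => (j : ℂ), fun i j h => by simpa [Fin.ext_iff] using h⟩

lemma diagTuple_mem_commVar (l : Fin n → Fin d → ℂ) : diagTuple l ∈ commVar d n := by
  intro r s
  simp [Matrix.diagonal_mul_diagonal, mul_comm]

variable [NeZero d]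

/-- If the variety of commuting tuples is irreducible, almost every commuting tuple is generic. -/
lemma volComm_compl_genericSet (hn : 1 ≤ n) (hV : IsIrreducibleSet (commVar d n)) :
    volComm d n (genericSet d n)ᶜ = 0 := by
  have hsub : ∀ X ∈ commVar d n, MvPolynomial.eval X.ofLp (discPoly d n 0) ≠ 0 →
      X ∈ genericSet d n := by
    intro X hX h
    rw [eval_discPoly] at h
    exact exists_uconj_triTuple hX h
  have hdisc : ∀ l ∈ Generic d n,
      MvPolynomial.eval (diagTuple l : MatTuple d n).ofLp (discPoly d n 0) ≠ 0 := by
    intro l hl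
    rw [eval_discPoly, comp_diagTuple]
    exact det_aeval_derivative_diagonal_ne_zero hl
  obtain ⟨l₀, hl₀⟩ := exists_mem_generic d n
  -- Where `discPoly` does not vanish the tuple is diagonalizable, so `f` vanishes there. The zero
  -- sets of `f` and `discPoly` thus cover `V`, and irreducibility leaves that of `f`, because
  -- `diagTuple l₀` is not a zero of `discPoly`.
  have hφ : ∀ f, conjHom d n f = 0 → ∀ X ∈ commVar d n, MvPolynomial.eval X.ofLp f = 0 := by
    intro f hf
    have h := hV.2 (Ideal.span {f}) (Ideal.span {discPoly d n 0}) (by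
      intro X hX
      by_cases h0 : MvPolynomial.eval X.ofLp (discPoly d n 0) = 0
      · right
        rw [MvPolynomial.zeroLocus_span]
        simpa using h0
      · left
        obtain ⟨U, l, a, -, rfl⟩ := hsub X hX h0
        rw [MvPolynomial.zeroLocus_span, uconj_triTuple_eq_Ad]
        have hBu : IsUnit (U.1 * unipotent a).det := by
          rw [Matrix.det_mul, det_unipotent, mul_one]
          exact Matrix.isUnit_det_of_left_inverse (unitary_conjTranspose_mul U)
        simpa using eval_eq_zero_of_conj hf hBu l)
    rcases h with h | h
    · intro X hX
      have := h X hX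
      rw [MvPolynomial.zeroLocus_span] at this
      simpa using this
    · exfalso
      have := h _ (diagTuple_mem_commVar l₀)
      rw [MvPolynomial.zeroLocus_span] at this
      exact hdisc l₀ hl₀ (by simpa using this)
  have hp : conjHom d n (discPoly d n 0) ≠ 0 := by
    intro h
    have h1 := eval_eq_zero_of_conj h (B := 1) (by simp) l₀
    have h2 : Ad 1 (diagTuple l₀) = (diagTuple l₀ : MatTuple d n) :=
      matTuple_ext fun r => by simp
    rw [h2] at h1
    exact hdisc l₀ hl₀ h1
  have htr : Algebra.trdeg ℂ (MvPolynomial (ConjIdx d n) ℂ) ≤ (n * (n - 1) + d * n : ℕ) := by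
    rw [MvPolynomial.trdeg_of_isDomain, Cardinal.lift_id, Cardinal.mk_fintype, card_conjIdx]
  -- With `N = n(n-1) + dn ≥ 1`, the exceptional set has dimension at most `2(N-1)`, strictly below
  -- the dimension `2N` of the measure.
  have hdim := MvPolynomial.dimH_inter_zeros_le (V := commVar d n) (conjHom d n) htr hφ hp
  have hpos : 1 ≤ n * (n - 1) + d * n :=
    Nat.le_add_left_of_le (Nat.mul_pos (Nat.pos_of_ne_zero (NeZero.ne d)) hn)
  rw [volComm, Measure.restrict_apply' ?_]
  · refine measure_mono_null (t := {X | X ∈ commVar d n ∧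
      MvPolynomial.eval X.ofLp (discPoly d n 0) = 0}) ?_ ?_
    · rintro X ⟨hX, hXV⟩
      refine ⟨hXV, ?_⟩
      by_contra h
      exact hX (hsub X hXV h)
    · rw [Measure.euclideanHausdorffMeasure_def, Measure.smul_apply]
      have h1 : dimH {X | X ∈ commVar d n ∧ MvPolynomial.eval X.ofLp (discPoly d n 0) = 0} <
          ((2 * (n * (n - 1)) + 2 * (d * n) : ℕ) : NNReal) := by
        refine hdim.trans_lt ?_
        exact_mod_cast (by omega : 2 * (n * (n - 1) + d * n - 1) <
          2 * (n * (n - 1)) + 2 * (d * n))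
      have h2 := hausdorffMeasure_of_dimH_lt h1
      simp only [NNReal.coe_natCast] at h2
      rw [h2, smul_zero]
  · refine IsClosed.measurableSet ?_
    have : commVar d n = ⋂ r, ⋂ s, {X | comp X r * comp X s = comp X s * comp X r} := by
      ext X; simp [commVar]
    rw [this]
    refine isClosed_iInter fun r => isClosed_iInter fun s => ?_
    have hc : ∀ r, Continuous fun X : MatTuple d n => comp X r := by
      intro r
      refine continuous_pi fun i => continuous_pi fun j => ?_
      exact (EuclideanSpace.proj (𝕜 := ℂ) (r, i, j)).continuous
    exact isClosed_eq ((hc r).mul (hc s)) ((hc s).mul (hc r))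

end NullSet

end CommTuple

/-! ### The area formula to first order near a point -/

section LocalArea

/-- `X` needs no metric: the hypothesis says that `g x ↦ f x` is a well-defined `C`-Lipschitz map of
`g '' B` onto `f '' B`. It serves to compare a map with its linearization, in both directions. -/
lemma MeasureTheory.euclideanHausdorffMeasure_image_le {X Y Z : Type*} [EMetricSpace Y]
    [MeasurableSpace Y] [BorelSpace Y] [EMetricSpace Z] [MeasurableSpace Z] [BorelSpace Z]
    {f : X → Y} {g : X → Z} {B : Set X} {C : NNReal} (k : ℕ)
    (h : ∀ x ∈ B, ∀ y ∈ B, edist (f x) (f y) ≤ C * edist (g x) (g y)) :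
    μHE[k] (f '' B) ≤ (C : ℝ≥0∞) ^ k * μHE[k] (g '' B) := by
  rcases B.eq_empty_or_nonempty with rfl | ⟨x₀, hx₀⟩
  · simp
  have : Nonempty X := ⟨x₀⟩
  have hr : ∀ x ∈ B, Function.invFunOn g B (g x) ∈ B ∧ g (Function.invFunOn g B (g x)) = g x :=
    fun x hx => ⟨Function.invFunOn_mem ⟨x, hx, rfl⟩, Function.invFunOn_eq ⟨x, hx, rfl⟩⟩
  have hf : ∀ x ∈ B, f (Function.invFunOn g B (g x)) = f x := by
    intro x hx
    have := h _ (hr x hx).1 x hx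
    rw [(hr x hx).2, edist_self, mul_zero] at this
    exact edist_le_zero.1 this
  have hL : LipschitzOnWith C (f ∘ Function.invFunOn g B) (g '' B) := by
    rintro _ ⟨x, hx, rfl⟩ _ ⟨y, hy, rfl⟩
    simp only [Function.comp_apply]
    rw [hf x hx, hf y hy]
    exact h x hx y hy
  have himg : (f ∘ Function.invFunOn g B) '' (g '' B) = f '' B := by
    rw [Set.image_image]
    exact Set.image_congr fun x hx => hf x hx
  have h1 := hL.hausdorffMeasure_image_le (d := k) (by positivity)
  rw [himg, ENNReal.rpow_natCast] at h1
  rw [Measure.euclideanHausdorffMeasure_def, Measure.euclideanHausdorffMeasure_def,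
    Measure.smul_apply, Measure.smul_apply, ENNReal.smul_def, ENNReal.smul_def, smul_eq_mul,
    smul_eq_mul, mul_left_comm]
  gcongr

lemma NNReal.exists_one_lt_pow_le {θ : NNReal} (hθ : 1 < θ) (k : ℕ) :
    ∃ θ' : NNReal, 1 < θ' ∧ θ' ^ k ≤ θ := by
  have h1 : Filter.Tendsto (fun x : NNReal => x ^ k) (𝓝[>] 1) (𝓝 (1 ^ k)) :=
    ((continuous_pow k).tendsto 1).mono_left nhdsWithin_le_nhds
  rw [one_pow] at h1
  have h2 := h1.eventually (eventually_le_nhds hθ)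
  have : (𝓝[>] (1 : NNReal)).NeBot := nhdsGT_neBot_of_exists_gt ⟨2, by norm_num⟩
  obtain ⟨x, hx, hx1⟩ := (h2.and self_mem_nhdsWithin).exists
  exact ⟨x, hx1, hx⟩

variable {E F : Type*} [NormedAddCommGroup E] [InnerProductSpace ℝ E] [FiniteDimensional ℝ E]
  [MeasurableSpace E] [BorelSpace E] [NormedAddCommGroup F] [InnerProductSpace ℝ F]
  [MeasurableSpace F] [BorelSpace F]

/-- Near a point where `f` is strictly differentiable with injective derivative, `f` multiplies
Lebesgue measure by the norm determinant of the derivative, up to a factor close to `1`. -/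
lemma HasStrictFDerivAt.exists_nhds_measure_image {f : E → F} {L : E →L[ℝ] F} {a : E}
    (hf : HasStrictFDerivAt f L a) (hL : Function.Injective L) {θ : NNReal} (hθ : 1 < θ) :
    ∃ s ∈ 𝓝 a, Set.InjOn f s ∧ ∀ B ⊆ s,
      μHE[Module.finrank ℝ E] (f '' B) ≤
        θ * (ENNReal.ofReal L.toLinearMap.normDet * volume B) ∧
      ENNReal.ofReal L.toLinearMap.normDet * volume B ≤
        θ * μHE[Module.finrank ℝ E] (f '' B) := by
  obtain ⟨θ', hθ', hpow⟩ := NNReal.exists_one_lt_pow_le hθ (Module.finrank ℝ E)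
  obtain ⟨K, hK, hanti⟩ := L.toLinearMap.exists_antilipschitzWith (LinearMap.ker_eq_bot.2 hL)
  have hK' : (0 : ℝ) < K := hK
  have hθr : (1 : ℝ) < θ' := by exact_mod_cast hθ'
  -- This choice makes `1 - δ = 1/θ'` exactly, and `1 + δ ≤ θ'` because `θ' + 1/θ' ≥ 2`. One
  -- constant then serves both estimates.
  set δ : ℝ := 1 - (θ' : ℝ)⁻¹ with hδ
  have hδ0 : 0 < δ := sub_pos.2 (inv_lt_one_of_one_lt₀ hθr)
  have hδ1 : 1 + δ ≤ θ' := by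
    have h1 : (θ' : ℝ) + (θ' : ℝ)⁻¹ - 2 = (θ' - 1) ^ 2 / θ' := by
      field_simp
      ring
    have h2 : 0 ≤ ((θ' : ℝ) - 1) ^ 2 / θ' := by positivity
    rw [hδ]; linarith
  obtain ⟨s, hs, happ⟩ := hf.approximates_deriv_on_nhds (c := Real.toNNReal (δ / K))
    (Or.inr (Real.toNNReal_pos.2 (by positivity)))
  -- Measuring the error against `‖L (x - y)‖` makes `f` and `L` Lipschitz relative to each other
  -- with constant `θ'`, so the measures of `f '' B` and `L '' B` differ by at most the factor `θ'`
  -- to the dimension.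
  have hest : ∀ x ∈ s, ∀ y ∈ s, ‖f x - f y - L (x - y)‖ ≤ δ * ‖L (x - y)‖ := by
    intro x hx y hy
    have h1 := happ x hx y hy
    have h2 : ‖x - y‖ ≤ K * ‖L (x - y)‖ := by
      have := hanti.le_mul_dist x y
      rw [dist_eq_norm, dist_eq_norm, ← map_sub] at this
      exact this
    refine h1.trans ?_
    rw [Real.coe_toNNReal _ (by positivity)]
    calc δ / K * ‖x - y‖ ≤ δ / K * (K * ‖L (x - y)‖) := by gcongr
      _ = _ := by field_simp
  have hup : ∀ x ∈ s, ∀ y ∈ s, edist (f x) (f y) ≤ θ' * edist (L x) (L y) := by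
    intro x hx y hy
    have h1 : ‖f x - f y‖ ≤ θ' * ‖L x - L y‖ := by
      rw [← map_sub]
      calc ‖f x - f y‖ = ‖(f x - f y - L (x - y)) + L (x - y)‖ := by congr 1; abel
        _ ≤ δ * ‖L (x - y)‖ + ‖L (x - y)‖ := (norm_add_le _ _).trans (by gcongr; exact hest x hx y hy)
        _ = (1 + δ) * ‖L (x - y)‖ := by ring
        _ ≤ _ := by gcongr
    rw [edist_dist, edist_dist, dist_eq_norm, dist_eq_norm, ← ENNReal.ofReal_coe_nnreal,
      ← ENNReal.ofReal_mul (by positivity)]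
    exact ENNReal.ofReal_le_ofReal h1
  have hlow : ∀ x ∈ s, ∀ y ∈ s, edist (L x) (L y) ≤ θ' * edist (f x) (f y) := by
    intro x hx y hy
    have h1 : ‖L x - L y‖ ≤ θ' * ‖f x - f y‖ := by
      rw [← map_sub]
      have h2 : ‖L (x - y)‖ ≤ ‖f x - f y‖ + δ * ‖L (x - y)‖ := by
        calc ‖L (x - y)‖ = ‖(f x - f y) - (f x - f y - L (x - y))‖ := by congr 1; abel
          _ ≤ _ := (norm_sub_le _ _).trans (by gcongr; exact hest x hx y hy)
      have h3 : (θ' : ℝ)⁻¹ * ‖L (x - y)‖ ≤ ‖f x - f y‖ := by rw [hδ] at h2; linarith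
      rwa [inv_mul_le_iff₀ (by positivity)] at h3
    rw [edist_dist, edist_dist, dist_eq_norm, dist_eq_norm, ← ENNReal.ofReal_coe_nnreal,
      ← ENNReal.ofReal_mul (by positivity)]
    exact ENNReal.ofReal_le_ofReal h1
  have hpow' : ((θ' : NNReal) : ℝ≥0∞) ^ Module.finrank ℝ E ≤ θ := by exact_mod_cast hpow
  refine ⟨s, hs, ?_, fun B hB => ?_⟩
  · intro x hx y hy hxy
    have h1 := hlow x hx y hy
    rw [hxy, edist_self, mul_zero] at h1
    exact hL (edist_le_zero.1 h1)
  · have himg := L.toLinearMap.euclideanHausdorffMeasure_image_eq_normDet_mul_volume B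
    rw [← himg]
    exact ⟨(euclideanHausdorffMeasure_image_le _ fun x hx y hy => hup x (hB hx) y (hB hy)).trans
        (mul_le_mul_left hpow' _),
      (euclideanHausdorffMeasure_image_le _ fun x hx y hy => hlow x (hB hx) y (hB hy)).trans
        (mul_le_mul_left hpow' _)⟩

end LocalArea

/-! ### The area formula for thin tubes -/

section FiberedArea

variable {P S F : Type*} [NormedAddCommGroup P] [InnerProductSpace ℝ P] [FiniteDimensional ℝ P]
  [MeasurableSpace P] [BorelSpace P] [NormedAddCommGroup S] [InnerProductSpace ℝ S]
  [FiniteDimensional ℝ S] [MeasurableSpace S] [BorelSpace S] [NormedAddCommGroup F]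
  [InnerProductSpace ℝ F] [MeasurableSpace F] [BorelSpace F]

/-- The product of `A` with the open `ε`-ball around the origin. -/
def prodBall (S : Type*) [NormedAddCommGroup S] (A : Set P) (ε : ℝ) : Set (WithLp 2 (P × S)) :=
  {x | x.fst ∈ A ∧ ‖x.snd‖ < ε}

omit [NormedAddCommGroup P] [InnerProductSpace ℝ P] [FiniteDimensional ℝ P] [MeasurableSpace P] [BorelSpace P]
  [InnerProductSpace ℝ S] [FiniteDimensional ℝ S] [MeasurableSpace S] [BorelSpace S] in
lemma prodBall_mono {A B : Set P} (h : A ⊆ B) {ε δ : ℝ} (hε : ε ≤ δ) :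
    prodBall S A ε ⊆ prodBall S B δ := fun _ hx => ⟨h hx.1, hx.2.trans_le hε⟩

lemma volume_prodBall {A : Set P} (ε : ℝ) :
    volume (prodBall S A ε) = volume A * volume {s : S | ‖s‖ < ε} := by
  have h := (WithLp.volume_preserving_ofLp P S).measure_preimage_emb
    (MeasurableEquiv.toLp 2 (P × S)).symm.measurableEmbedding (A ×ˢ {s : S | ‖s‖ < ε})
  rw [Measure.volume_eq_prod, Measure.prod_prod] at h
  exact h

omit [NormedAddCommGroup P] [InnerProductSpace ℝ P] [FiniteDimensional ℝ P] [BorelSpace P]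
  [InnerProductSpace ℝ S] [FiniteDimensional ℝ S] in
lemma measurableSet_prodBall {A : Set P} (hA : MeasurableSet A) (ε : ℝ) :
    MeasurableSet (prodBall S A ε) := by
  have h1 : MeasurableSet (A ×ˢ {s : S | ‖s‖ < ε}) :=
    hA.prod (measurableSet_lt measurable_norm measurable_const)
  exact (MeasurableEquiv.toLp 2 (P × S)).symm.measurable h1

omit [InnerProductSpace ℝ P] [FiniteDimensional ℝ P] [MeasurableSpace P] [BorelSpace P]
  [InnerProductSpace ℝ S] [FiniteDimensional ℝ S] [MeasurableSpace S] [BorelSpace S] in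
lemma exists_prodBall_subset_nhds {p : P} {s : Set (WithLp 2 (P × S))}
    (hs : s ∈ 𝓝 (WithLp.toLp 2 (p, (0 : S)))) :
    ∃ N : Set P, IsOpen N ∧ p ∈ N ∧ ∃ ε > 0, prodBall S N ε ⊆ s := by
  have hc : Continuous fun q : P × S => WithLp.toLp 2 q := WithLp.prod_continuous_toLp 2 P S
  have h1 := hc.continuousAt.preimage_mem_nhds hs
  rw [nhds_prod_eq, Filter.mem_prod_iff] at h1
  obtain ⟨t, ht, u, hu, htu⟩ := h1
  obtain ⟨N, hN, hNo, hpN⟩ := mem_nhds_iff.1 ht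
  obtain ⟨ε, hε, hεu⟩ := Metric.mem_nhds_iff.1 hu
  refine ⟨N, hNo, hpN, ε, hε, fun x hx => ?_⟩
  have : (x.fst, x.snd) ∈ t ×ˢ u := ⟨hN hx.1, hεu (by simpa using hx.2)⟩
  exact htu this

/-- The measure of the image of a thin tube over a compact set, to first order in the radius. -/
lemma exists_measure_image_prodBall_bounds {f : WithLp 2 (P × S) → F}
    {L : P → WithLp 2 (P × S) →L[ℝ] F} {K : Set P} (hK : IsCompact K)
    (hf : ∀ p ∈ K, HasStrictFDerivAt f (L p) (WithLp.toLp 2 (p, 0)))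
    (hL : ∀ p ∈ K, Function.Injective (L p))
    (hJ : ContinuousOn (fun p => (L p).toLinearMap.normDet) K)
    {E : Set P} (hE : E ⊆ K) {ε₀ : ℝ} (hε₀ : 0 < ε₀) (hinj : Set.InjOn f (prodBall S E ε₀))
    (hmeas : ∀ B ⊆ prodBall S E ε₀, MeasurableSet B → MeasurableSet (f '' B))
    {θ : NNReal} (hθ : 1 < θ) :
    ∃ ε₁ > 0, ∀ ε, 0 < ε → ε < ε₁ → ∀ A ⊆ E, MeasurableSet A →
      μHE[Module.finrank ℝ (WithLp 2 (P × S))] (f '' prodBall S A ε) ≤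
        θ * ((∫⁻ p in A, ENNReal.ofReal (L p).toLinearMap.normDet) *
          volume {s : S | ‖s‖ < ε}) ∧
      (∫⁻ p in A, ENNReal.ofReal (L p).toLinearMap.normDet) * volume {s : S | ‖s‖ < ε} ≤
        θ * μHE[Module.finrank ℝ (WithLp 2 (P × S))] (f '' prodBall S A ε) := by
  obtain ⟨θ', hθ', hpow⟩ := NNReal.exists_one_lt_pow_le hθ 2
  set μ := (μHE[Module.finrank ℝ (WithLp 2 (P × S))] : Measure F) with hμ
  set J : P → ℝ≥0∞ := fun p => ENNReal.ofReal (L p).toLinearMap.normDet with hJdef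
  have hpow' : (θ' : ℝ≥0∞) * θ' ≤ θ := by rw [← sq]; exact_mod_cast hpow
  -- Near a single point there are two errors of ratio `θ'`: one from replacing `f` by its
  -- derivative at that point, one from replacing the continuous Jacobian by its value there. This
  -- is why `θ' ^ 2 ≤ θ` was arranged.
  have hloc : ∀ p ∈ K, ∃ N : Set P, IsOpen N ∧ p ∈ N ∧ ∃ ε₁ > 0, ∀ ε < ε₁, ∀ A ⊆ K ∩ N,
      MeasurableSet A →
      μ (f '' prodBall S A ε) ≤ θ * ((∫⁻ p in A, J p) * volume {s : S | ‖s‖ < ε}) ∧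
      (∫⁻ p in A, J p) * volume {s : S | ‖s‖ < ε} ≤ θ * μ (f '' prodBall S A ε) := by
    intro p hp
    obtain ⟨s, hs, -, hB⟩ := (hf p hp).exists_nhds_measure_image (hL p hp) hθ'
    obtain ⟨N, hNo, hpN, ε₁, hε₁, hsub⟩ := exists_prodBall_subset_nhds hs
    have hJp : 0 < (L p).toLinearMap.normDet := by
      refine lt_of_le_of_ne (LinearMap.normDet_nonneg _) (Ne.symm ?_)
      exact ((L p).toLinearMap.normDet_ne_zero_tfae.out 4 0).1 (hL p hp)
    have hθr : (1 : ℝ) < θ' := by exact_mod_cast hθ'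
    have hJc := (hJ p hp).eventually (Ioo_mem_nhds
      (show (θ' : ℝ)⁻¹ * (L p).toLinearMap.normDet < (L p).toLinearMap.normDet from
        (mul_lt_iff_lt_one_left hJp).2 (inv_lt_one_of_one_lt₀ hθr))
      (show (L p).toLinearMap.normDet < θ' * (L p).toLinearMap.normDet from
        (lt_mul_iff_one_lt_left hJp).2 hθr))
    rw [eventually_nhdsWithin_iff] at hJc
    obtain ⟨M, hM, hMo, hpM⟩ := eventually_nhds_iff.1 hJc
    refine ⟨N ∩ M, hNo.inter hMo, ⟨hpN, hpM⟩, ε₁, hε₁, fun ε hε A hA hAm => ?_⟩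
    have hJ1 : ∀ q ∈ A, J q ≤ θ' * J p ∧ J p ≤ θ' * J q := by
      intro q hq
      have h1 := hM q (hA hq).2.2 (hA hq).1
      have h2 : (0 : ℝ) < θ' := by linarith
      constructor
      · rw [hJdef]
        simp only
        rw [← ENNReal.ofReal_coe_nnreal, ← ENNReal.ofReal_mul h2.le]
        exact ENNReal.ofReal_le_ofReal h1.2.le
      · rw [hJdef]
        simp only
        rw [← ENNReal.ofReal_coe_nnreal, ← ENNReal.ofReal_mul h2.le]
        refine ENNReal.ofReal_le_ofReal ?_
        have := h1.1.le
        rwa [inv_mul_le_iff₀ h2] at this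
    have hI1 : ∫⁻ p in A, J p ≤ θ' * (J p * volume A) := by
      calc ∫⁻ p in A, J p ≤ ∫⁻ _ in A, θ' * J p :=
            setLIntegral_mono' hAm fun q hq => (hJ1 q hq).1
        _ = _ := by rw [setLIntegral_const, mul_assoc]
    have hI2 : J p * volume A ≤ θ' * ∫⁻ p in A, J p := by
      rw [← lintegral_const_mul' _ _ ENNReal.coe_ne_top]
      calc J p * volume A = ∫⁻ _ in A, J p := by rw [setLIntegral_const]
        _ ≤ _ := setLIntegral_mono' hAm fun q hq => (hJ1 q hq).2
    have hB' := hB (prodBall S A ε) ((prodBall_mono (fun q hq => (hA hq).2.1) hε.le).trans hsub)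
    have hvol : J p * volume (prodBall S A ε) = J p * volume A * volume {s : S | ‖s‖ < ε} := by
      rw [volume_prodBall, mul_assoc]
    change _ ≤ (θ' : ℝ≥0∞) * (J p * _) ∧ J p * _ ≤ _ at hB'
    rw [hvol] at hB'
    constructor
    · calc μ (f '' prodBall S A ε) ≤ θ' * (J p * volume A * volume {s : S | ‖s‖ < ε}) := hB'.1
        _ ≤ θ' * (θ' * (∫⁻ p in A, J p) * volume {s : S | ‖s‖ < ε}) := by gcongr
        _ = (θ' * θ') * ((∫⁻ p in A, J p) * volume {s : S | ‖s‖ < ε}) := by ring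
        _ ≤ _ := by gcongr
    · calc (∫⁻ p in A, J p) * volume {s : S | ‖s‖ < ε}
          ≤ θ' * (J p * volume A) * volume {s : S | ‖s‖ < ε} := by gcongr
        _ = θ' * (J p * volume A * volume {s : S | ‖s‖ < ε}) := by ring
        _ ≤ θ' * (θ' * μ (f '' prodBall S A ε)) := mul_le_mul' le_rfl hB'.2
        _ = (θ' * θ') * μ (f '' prodBall S A ε) := by ring
        _ ≤ _ := by gcongr
  choose! N hNo hpN ε₁ hε₁ hN using hloc
  obtain ⟨t, htK, ht⟩ := hK.elim_nhds_subcover N fun p hp => (hNo p hp).mem_nhds (hpN p hp)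
  -- Induction over a finite cover by good neighbourhoods: cut `A` along the new neighbourhood.
  -- Injectivity on the tube over `E` makes the two images disjoint, so their measures add.
  suffices h : ∀ t : Finset P, (∀ p ∈ t, p ∈ K) → ∃ ε₂ > 0, ∀ ε, 0 < ε → ε < ε₂ → ∀ A ⊆ E,
      A ⊆ (⋃ p ∈ t, N p) → MeasurableSet A →
      μ (f '' prodBall S A ε) ≤ θ * ((∫⁻ p in A, J p) * volume {s : S | ‖s‖ < ε}) ∧
      (∫⁻ p in A, J p) * volume {s : S | ‖s‖ < ε} ≤ θ * μ (f '' prodBall S A ε) by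
    obtain ⟨ε₂, hε₂, h⟩ := h t htK
    exact ⟨ε₂, hε₂, fun ε h0 hε A hA hAm => h ε h0 hε A hA ((hA.trans hE).trans ht) hAm⟩
  clear ht htK t
  intro t
  classical
  induction t using Finset.induction_on with
  | empty =>
    intro _
    refine ⟨1, one_pos, fun ε _ _ A _ hA _ => ?_⟩
    have : A = ∅ := by simpa [Set.subset_empty_iff] using hA
    subst this
    simp [prodBall]
  | insert p t hpt ih =>
    intro hK'
    obtain ⟨ε₂, hε₂, h⟩ := ih fun q hq => hK' q (Finset.mem_insert_of_mem hq)
    have hp := hK' p (Finset.mem_insert_self p t)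
    refine ⟨min (min ε₂ (ε₁ p)) ε₀, lt_min (lt_min hε₂ (hε₁ p hp)) hε₀,
      fun ε h0 hε A hA hAt hAm => ?_⟩
    have hε2 : ε < ε₂ := hε.trans_le ((min_le_left _ _).trans (min_le_left _ _))
    have hε1 : ε < ε₁ p := hε.trans_le ((min_le_left _ _).trans (min_le_right _ _))
    have hε0 : ε < ε₀ := hε.trans_le (min_le_right _ _)
    have hm1 : MeasurableSet (A ∩ N p) := hAm.inter (hNo p hp).measurableSet
    have hm2 : MeasurableSet (A \ N p) := hAm.diff (hNo p hp).measurableSet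
    have h1 := hN p hp ε hε1 (A ∩ N p) (Set.inter_subset_inter_left _ (hA.trans hE)) hm1
    have h2 := h ε h0 hε2 (A \ N p) (Set.sdiff_subset.trans hA) (by
      rintro q ⟨hq, hqN⟩
      have := hAt hq
      rw [Finset.set_biUnion_insert] at this
      exact this.resolve_left hqN) hm2
    have hsplit : prodBall S A ε = prodBall S (A ∩ N p) ε ∪ prodBall S (A \ N p) ε := by
      ext x
      simp only [prodBall, Set.mem_ofPred_eq, Set.mem_union, Set.mem_inter_iff, Set.mem_sdiff]
      tauto
    have hsub1 : prodBall S (A ∩ N p) ε ⊆ prodBall S E ε₀ :=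
      prodBall_mono (Set.inter_subset_left.trans hA) hε0.le
    have hsub2 : prodBall S (A \ N p) ε ⊆ prodBall S E ε₀ :=
      prodBall_mono (Set.sdiff_subset.trans hA) hε0.le
    have hdisj : Disjoint (f '' prodBall S (A ∩ N p) ε) (f '' prodBall S (A \ N p) ε) := by
      rw [Set.disjoint_left]
      rintro _ ⟨x, hx, rfl⟩ ⟨y, hy, hxy⟩
      have := hinj (hsub1 hx) (hsub2 hy) hxy.symm
      subst this
      exact hy.1.2 hx.1.2
    have hμs : μ (f '' prodBall S A ε) =
        μ (f '' prodBall S (A ∩ N p) ε) + μ (f '' prodBall S (A \ N p) ε) := by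
      rw [hsplit, Set.image_union, measure_union hdisj
        (hmeas _ hsub2 (measurableSet_prodBall hm2 ε))]
    have hIs : ∫⁻ p in A, J p = (∫⁻ p in A ∩ N p, J p) + ∫⁻ p in A \ N p, J p := by
      rw [← lintegral_inter_add_sdiff J A (hNo p hp).measurableSet]
    rw [hμs, hIs, add_mul, mul_add, mul_add]
    exact ⟨add_le_add h1.1 h2.1, add_le_add h1.2 h2.2⟩

/-- Let the multiplicative error `θ` tend to `1` in the two-sided bounds. The Jacobian is bounded on
the compact `K`, so the limit is finite, which the passage to the limit in `θ` uses. -/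
lemma tendsto_measure_image_prodBall {f : WithLp 2 (P × S) → F}
    {L : P → WithLp 2 (P × S) →L[ℝ] F} {K : Set P} (hK : IsCompact K)
    (hf : ∀ p ∈ K, HasStrictFDerivAt f (L p) (WithLp.toLp 2 (p, 0)))
    (hL : ∀ p ∈ K, Function.Injective (L p))
    (hJ : ContinuousOn (fun p => (L p).toLinearMap.normDet) K)
    {A : Set P} {ε₀ : ℝ} (hε₀ : 0 < ε₀) (hinj : Set.InjOn f (prodBall S A ε₀))
    (hmeas : ∀ B ⊆ prodBall S A ε₀, MeasurableSet B → MeasurableSet (f '' B))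
     (hA : A ⊆ K) (hAm : MeasurableSet A) :
    (∫⁻ p in A, ENNReal.ofReal (L p).toLinearMap.normDet) ≠ ∞ ∧
    Filter.Tendsto (fun ε => μHE[Module.finrank ℝ (WithLp 2 (P × S))] (f '' prodBall S A ε) /
      volume {s : S | ‖s‖ < ε}) (𝓝[>] 0)
      (𝓝 (∫⁻ p in A, ENNReal.ofReal (L p).toLinearMap.normDet)) := by
  set I := ∫⁻ p in A, ENNReal.ofReal (L p).toLinearMap.normDet with hI
  have hItop : I ≠ ∞ := by
    obtain ⟨C, hC⟩ := hK.bddAbove_image hJ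
    have h1 : I ≤ ∫⁻ p in A, ENNReal.ofReal C :=
      setLIntegral_mono' hAm fun p hp =>
        ENNReal.ofReal_le_ofReal (hC (Set.mem_image_of_mem _ (hA hp)))
    rw [setLIntegral_const] at h1
    refine ne_top_of_le_ne_top (ENNReal.mul_ne_top ENNReal.ofReal_ne_top ?_) h1
    exact ((measure_mono hA).trans_lt hK.measure_lt_top).ne
  refine ⟨hItop, ?_⟩
  have hball : ∀ ε : ℝ, {s : S | ‖s‖ < ε} = Metric.ball 0 ε := fun ε => by ext; simp
  have hb0 : ∀ ε > 0, volume {s : S | ‖s‖ < ε} ≠ 0 := fun ε hε => by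
    rw [hball]; exact (Metric.measure_ball_pos volume _ hε).ne'
  have hbt : ∀ ε, volume {s : S | ‖s‖ < ε} ≠ ∞ := fun ε => by
    rw [hball]; exact measure_ball_lt_top.ne
  have hkey : ∀ θ : NNReal, 1 < θ → ∀ᶠ ε in 𝓝[>] (0 : ℝ),
      μHE[Module.finrank ℝ (WithLp 2 (P × S))] (f '' prodBall S A ε) /
        volume {s : S | ‖s‖ < ε} ≤ θ * I ∧
      I ≤ θ * (μHE[Module.finrank ℝ (WithLp 2 (P × S))] (f '' prodBall S A ε) /
        volume {s : S | ‖s‖ < ε}) := by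
    intro θ hθ
    obtain ⟨ε₁, hε₁, h⟩ := exists_measure_image_prodBall_bounds hK hf hL hJ hA hε₀ hinj hmeas hθ
    filter_upwards [Ioo_mem_nhdsGT hε₁] with ε hε
    have h1 := h ε hε.1 hε.2 A subset_rfl hAm
    refine ⟨ENNReal.div_le_of_le_mul (by rw [mul_assoc]; exact h1.1), ?_⟩
    rw [← mul_div_assoc, ENNReal.le_div_iff_mul_le (Or.inl (hb0 ε hε.1)) (Or.inl (hbt ε))]
    exact h1.2
  have hlim : Filter.Tendsto (fun θ : NNReal => (θ : ℝ≥0∞) * I) (𝓝[>] 1) (𝓝 I) := by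
    have h1 : Filter.Tendsto (fun θ : NNReal => (θ : ℝ≥0∞) * I) (𝓝 1) (𝓝 ((1 : NNReal) * I)) := by
      refine ENNReal.Tendsto.mul_const ?_ (Or.inr hItop)
      exact (ENNReal.continuous_coe.tendsto 1)
    rw [ENNReal.coe_one, one_mul] at h1
    exact h1.mono_left nhdsWithin_le_nhds
  have hlim' : Filter.Tendsto (fun θ : NNReal => I / (θ : ℝ≥0∞)) (𝓝[>] 1) (𝓝 I) := by
    have h1 : Filter.Tendsto (fun θ : NNReal => I / (θ : ℝ≥0∞)) (𝓝 1) (𝓝 (I / (1 : NNReal))) := by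
      refine ENNReal.Tendsto.const_div ?_ (Or.inr hItop)
      exact (ENNReal.continuous_coe.tendsto 1)
    rw [ENNReal.coe_one, div_one] at h1
    exact h1.mono_left nhdsWithin_le_nhds
  have hne : (𝓝[>] (1 : NNReal)).NeBot := nhdsGT_neBot_of_exists_gt ⟨2, by norm_num⟩
  rw [tendsto_order]
  constructor
  · intro a ha
    obtain ⟨θ, hθ, hθ1⟩ := ((hlim'.eventually (lt_mem_nhds ha)).and self_mem_nhdsWithin).exists
    filter_upwards [hkey θ hθ1] with ε hε
    refine hθ.trans_le (ENNReal.div_le_of_le_mul ?_)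
    rw [mul_comm]
    exact hε.2
  · intro a ha
    obtain ⟨θ, hθ, hθ1⟩ := ((hlim.eventually (gt_mem_nhds ha)).and self_mem_nhdsWithin).exists
    filter_upwards [hkey θ hθ1] with ε hε
    exact hε.1.trans_lt hθ

end FiberedArea

namespace CommTuple

variable {d n : ℕ}

/-! ### Derivative of the triangular parametrization and the tangent space -/

section TriangularDerivative

/-- The eigenvalues encoded in a point of `DiagUni d n`. -/
noncomputable abbrev lamOf (x : DiagUni d n) : Fin n → Fin d → ℂ := fun j r => x (Sum.inl (j, r))

/-- The unipotent coordinates encoded in a point of `DiagUni d n`. -/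
noncomputable abbrev uppOf (x : DiagUni d n) : UpperIdx n → ℂ := fun p => x (Sum.inr p)

/-- The strictly upper triangular matrix with given entries. -/
noncomputable def strictUpper (a : UpperIdx n → ℂ) : Matrix (Fin n) (Fin n) ℂ :=
  Matrix.of fun i j => if h : i < j then a ⟨(i, j), h⟩ else 0

lemma strictUpper_of_le (a : UpperIdx n → ℂ) {i j : Fin n} (h : j ≤ i) :
    strictUpper a i j = 0 := by simp [strictUpper, h.not_gt]

lemma strictUpper_injective : Function.Injective (strictUpper (n := n)) := by
  intro a b h
  ext ⟨⟨i, j⟩, hp⟩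
  have := congrFun (congrFun h i) j
  simpa [strictUpper, show i < j from hp] using this

lemma unipotent_add_smul (a b : UpperIdx n → ℂ) (t : ℂ) (i j : Fin n) :
    unipotent (a + t • b) i j = unipotent a i j + t * strictUpper b i j := by
  by_cases h : i < j <;> simp [unipotent, strictUpper, h]

lemma triParam_eq (x : DiagUni d n) : triParam d n x = triTuple (lamOf x) (uppOf x) := rfl

lemma contDiff_det {𝕜 E : Type*} [NontriviallyNormedField 𝕜] [NormedAddCommGroup E]
    [NormedSpace 𝕜 E] {m : WithTop ℕ∞} {M : E → Matrix (Fin n) (Fin n) 𝕜}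
    (hM : ∀ i j, ContDiff 𝕜 m fun x => M x i j) : ContDiff 𝕜 m fun x => (M x).det := by
  simp only [Matrix.det_apply]
  refine ContDiff.sum fun σ _ => ContDiff.const_smul _ ?_
  exact contDiff_prod fun i _ => hM _ _

lemma contDiff_adjugate {𝕜 E : Type*} [NontriviallyNormedField 𝕜] [NormedAddCommGroup E]
    [NormedSpace 𝕜 E] {m : WithTop ℕ∞} {M : E → Matrix (Fin n) (Fin n) 𝕜}
    (hM : ∀ i j, ContDiff 𝕜 m fun x => M x i j) (i j : Fin n) :
    ContDiff 𝕜 m fun x => (M x).adjugate i j := by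
  simp only [Matrix.adjugate_apply]
  refine contDiff_det fun k l => ?_
  simp only [Matrix.updateRow_apply]
  split_ifs
  · exact contDiff_const
  · exact hM k l

lemma inv_unipotent (a : UpperIdx n → ℂ) : (unipotent a)⁻¹ = (unipotent a).adjugate := by
  simp [Matrix.inv_def]

lemma contDiff_coord (k : (Fin n × Fin d) ⊕ UpperIdx n) {m : WithTop ℕ∞} :
    ContDiff ℂ m fun x : DiagUni d n => x k :=
  (contDiff_euclidean (𝕜 := ℂ) (f := fun x : DiagUni d n => x)).1 contDiff_id k

lemma contDiff_unipotent (i j : Fin n) {m : WithTop ℕ∞} :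
    ContDiff ℂ m fun x : DiagUni d n => unipotent (uppOf x) i j := by
  by_cases h : i < j
  · simpa [unipotent, h] using contDiff_coord (d := d) (Sum.inr (⟨(i, j), h⟩ : UpperIdx n))
  · simp only [unipotent, h, Matrix.of_apply, dite_false]
    exact contDiff_const

lemma contDiff_triParam {m : WithTop ℕ∞} : ContDiff ℂ m (triParam d n) := by
  refine contDiff_euclidean.2 ?_
  rintro ⟨r, i, j⟩
  have : (fun x : DiagUni d n => triParam d n x (r, i, j)) = fun x =>
      ∑ k, unipotent (uppOf x) i k * lamOf x k r * (unipotent (uppOf x)).adjugate k j := by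
    funext x
    rw [← comp_apply, triParam_eq, comp_Ad, comp_diagTuple, inv_unipotent, Matrix.mul_apply]
    simp [Matrix.mul_diagonal]
  rw [this]
  exact ContDiff.sum fun k _ => ((contDiff_unipotent i k).mul (contDiff_coord _)).mul
    (contDiff_adjugate (fun a b => contDiff_unipotent a b) k j)

/-- The complex derivative of the parametrization of the upper triangular commuting tuples. -/
noncomputable abbrev dTri (x : DiagUni d n) : DiagUni d n →L[ℂ] MatTuple d n :=
  fderiv ℂ (triParam d n) x

lemma hasStrictFDerivAt_triParam (x : DiagUni d n) :
    HasStrictFDerivAt (triParam d n) (dTri x) x :=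
  (contDiff_triParam (m := 1)).contDiffAt.hasStrictFDerivAt one_ne_zero

/-- Differentiate the identity `Q^r A = A D^r` along a line. This avoids differentiating the inverse
of `A`. -/
lemma comp_dTri_mul (x q : DiagUni d n) (r : Fin d) :
    comp (dTri x q) r * unipotent (uppOf x) + comp (triParam d n x) r * strictUpper (uppOf q) =
      strictUpper (uppOf q) * Matrix.diagonal (fun j => lamOf x j r) +
        unipotent (uppOf x) * Matrix.diagonal (fun j => lamOf q j r) := by
  ext i j
  have hline : HasDerivAt (fun t : ℂ => x + t • q) q 0 := by
    simpa using ((hasDerivAt_id (0 : ℂ)).smul_const q).const_add x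
  have h1 : HasDerivAt (fun t : ℂ => triParam d n (x + t • q)) (dTri x q) 0 := by
    have := (hasStrictFDerivAt_triParam x).hasFDerivAt
    have h0 : x = x + (0 : ℂ) • q := by simp
    rw [h0] at this
    have h := this.comp_hasDerivAt (0 : ℂ) hline
    rw [← h0] at h
    exact h
  have h2 : ∀ k, HasDerivAt (fun t : ℂ => comp (triParam d n (x + t • q)) r i k)
      (comp (dTri x q) r i k) 0 := fun k => by
    exact (EuclideanSpace.proj (r, i, k) : MatTuple d n →L[ℂ] ℂ).hasFDerivAt.comp_hasDerivAt (0 : ℂ) h1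
  have h3 : ∀ k l, HasDerivAt (fun t : ℂ => unipotent (uppOf (x + t • q)) k l)
      (strictUpper (uppOf q) k l) 0 := fun k l => by
    have : (fun t : ℂ => unipotent (uppOf (x + t • q)) k l) =
        fun t => unipotent (uppOf x) k l + t * strictUpper (uppOf q) k l :=
      funext fun t => unipotent_add_smul _ _ _ _ _
    rw [this]
    simpa using ((hasDerivAt_id (0 : ℂ)).mul_const (strictUpper (uppOf q) k l)).const_add
      (unipotent (uppOf x) k l)
  have h4 : HasDerivAt (fun t : ℂ => lamOf (x + t • q) j r) (lamOf q j r) 0 := by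
    simpa using ((hasDerivAt_id (0 : ℂ)).mul_const (lamOf q j r)).const_add (lamOf x j r)
  have hL := HasDerivAt.fun_sum (u := Finset.univ) fun k _ => (h2 k).mul (h3 k j)
  have hR := (h3 i j).mul h4
  have heq : (fun t : ℂ => ∑ k, comp (triParam d n (x + t • q)) r i k *
      unipotent (uppOf (x + t • q)) k j) =
      fun t => unipotent (uppOf (x + t • q)) i j * lamOf (x + t • q) j r := by
    funext t
    have := congrFun (congrFun (comp_triTuple_mul (lamOf (x + t • q)) (uppOf (x + t • q)) r) i) j
    rw [Matrix.mul_diagonal, Matrix.mul_apply] at this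
    exact this
  simp only [Pi.mul_def] at hL hR
  rw [heq] at hL
  have := hL.unique hR
  simp only [zero_smul, add_zero, Finset.sum_add_distrib] at this
  rw [Matrix.add_apply, Matrix.add_apply, Matrix.mul_diagonal, Matrix.mul_diagonal,
    Matrix.mul_apply, Matrix.mul_apply]
  exact this

lemma unipotent_inv_mul (a : UpperIdx n → ℂ) : (unipotent a)⁻¹ * unipotent a = 1 :=
  Matrix.nonsing_inv_mul _ (isUnit_det_unipotent a)

lemma unipotent_mul_inv (a : UpperIdx n → ℂ) : unipotent a * (unipotent a)⁻¹ = 1 :=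
  Matrix.mul_nonsing_inv _ (isUnit_det_unipotent a)

lemma unipotent_inv_mul_triTuple (l : Fin n → Fin d → ℂ) (a : UpperIdx n → ℂ) (r : Fin d) :
    (unipotent a)⁻¹ * comp (triTuple l a) r = Matrix.diagonal (fun j => l j r) * (unipotent a)⁻¹ := by
  simp only [comp_Ad, comp_diagTuple]
  rw [← Matrix.mul_assoc, ← Matrix.mul_assoc, unipotent_inv_mul, Matrix.one_mul]

/-- The derivative of the parametrization, read in the eigenbasis. -/
lemma dTri_gauge (x q : DiagUni d n) (r : Fin d) :
    (unipotent (uppOf x))⁻¹ * comp (dTri x q) r * unipotent (uppOf x) =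
      (unipotent (uppOf x))⁻¹ * strictUpper (uppOf q) * Matrix.diagonal (fun j => lamOf x j r) -
        Matrix.diagonal (fun j => lamOf x j r) *
          ((unipotent (uppOf x))⁻¹ * strictUpper (uppOf q)) +
        Matrix.diagonal (fun j => lamOf q j r) := by
  have h := congrArg ((unipotent (uppOf x))⁻¹ * ·) (comp_dTri_mul x q r)
  simp only [mul_add, ← Matrix.mul_assoc, triParam_eq, unipotent_inv_mul,
    unipotent_inv_mul_triTuple, Matrix.one_mul] at h
  rw [eq_sub_of_add_eq h, ← Matrix.mul_assoc]
  abel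

lemma blockTriangular_strictUpper (a : UpperIdx n → ℂ) : (strictUpper a).BlockTriangular id :=
  fun _ _ h => strictUpper_of_le a (le_of_lt h)

lemma dTri_blockTriangular (x q : DiagUni d n) (r : Fin d) :
    (comp (dTri x q) r).BlockTriangular id := by
  have hA := unipotent_blockTriangular (uppOf x)
  have hA' := blockTriangular_inv hA (isUnit_det_unipotent _)
  have hN := blockTriangular_strictUpper (uppOf q)
  have hD := Matrix.blockTriangular_diagonal (b := (id : Fin n → Fin n))
    (fun j => lamOf x j r)
  have hD' := Matrix.blockTriangular_diagonal (b := (id : Fin n → Fin n))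
    (fun j => lamOf q j r)
  have h : comp (dTri x q) r = unipotent (uppOf x) *
      ((unipotent (uppOf x))⁻¹ * comp (dTri x q) r * unipotent (uppOf x)) *
        (unipotent (uppOf x))⁻¹ := by
    rw [← Matrix.mul_assoc, ← Matrix.mul_assoc, unipotent_mul_inv, Matrix.one_mul,
      Matrix.mul_assoc, unipotent_mul_inv, Matrix.mul_one]
  rw [h, dTri_gauge]
  exact (hA.mul ((((hA'.mul hN).mul hD).sub (hD.mul (hA'.mul hN))).add hD')).mul hA'

variable [NeZero d]

/-- In the eigenbasis the derivative is `[Y, D^r] + dD^r` with `Y = A⁻¹ dA`. If it vanishes, the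
diagonal gives `dD = 0`; then `Y` commutes with `D^0` and is diagonal. Since `A Y = dA` has zero
diagonal and `A` is unipotent, `Y = 0`. -/
lemma dTri_injective {x : DiagUni d n} (hx : lamOf x ∈ Generic d n) :
    Function.Injective (dTri x) := by
  rw [injective_iff_map_eq_zero]
  intro q hq
  have h : ∀ r, (unipotent (uppOf x))⁻¹ * strictUpper (uppOf q) *
      Matrix.diagonal (fun j => lamOf x j r) - Matrix.diagonal (fun j => lamOf x j r) *
        ((unipotent (uppOf x))⁻¹ * strictUpper (uppOf q)) +
        Matrix.diagonal (fun j => lamOf q j r) = 0 := fun r => by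
    rw [← dTri_gauge, hq, show comp (0 : MatTuple d n) r = 0 from rfl, Matrix.mul_zero,
      Matrix.zero_mul]
  have hlam : ∀ j r, lamOf q j r = 0 := fun j r => by
    have := congrFun (congrFun (h r) j) j
    simpa [Matrix.mul_diagonal, Matrix.diagonal_mul, mul_comm] using this
  have hY : ((unipotent (uppOf x))⁻¹ * strictUpper (uppOf q)).IsDiag := by
    refine isDiag_of_commute_diagonal hx (sub_eq_zero.1 ?_)
    have := h 0
    simpa [hlam] using this
  have hN : strictUpper (uppOf q) =
      unipotent (uppOf x) * ((unipotent (uppOf x))⁻¹ * strictUpper (uppOf q)) := by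
    rw [← Matrix.mul_assoc, unipotent_mul_inv, Matrix.one_mul]
  have hY0 : (unipotent (uppOf x))⁻¹ * strictUpper (uppOf q) = 0 := by
    ext i j
    by_cases hij : i = j
    · subst hij
      have := diag_mul_of_blockTriangular (unipotent_blockTriangular (uppOf x))
        (blockTriangular_of_isDiag hY) i
      rw [← hN, strictUpper_of_le _ le_rfl, unipotent_apply_self, one_mul] at this
      simpa using this.symm
    · exact hY hij
  rw [hY0, Matrix.mul_zero] at hN
  have hupp : uppOf q = 0 := strictUpper_injective (by rw [hN]; ext; simp [strictUpper])
  ext k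
  rcases k with ⟨j, r⟩ | p
  · exact hlam j r
  · exact congrFun hupp p

/-- For `Z = A⁻¹ X A`, the linearized commutation relations with the first component say `Z^r_ij
(λ_j^0 - λ_i^0) = Z^0_ij (λ_j^r - λ_i^r)`. Dividing, the off-diagonal part of every `Z^r` is `[Y,
D^r]` for one strictly triangular `Y`, and the diagonal of `Z` is the variation of the eigenvalues.
-/
lemma exists_dTri_eq {x : DiagUni d n} (hx : lamOf x ∈ Generic d n) {X : MatTuple d n}
    (hX : ∀ r, (comp X r).BlockTriangular id)
    (hlin : ∀ r s, comp (triParam d n x) r * comp X s + comp X r * comp (triParam d n x) s =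
      comp (triParam d n x) s * comp X r + comp X s * comp (triParam d n x) r) :
    ∃ q, dTri x q = X := by
  set A := unipotent (uppOf x) with hA
  set D : Fin d → Matrix (Fin n) (Fin n) ℂ := fun r => Matrix.diagonal fun j => lamOf x j r
  have hAb : A.BlockTriangular id := unipotent_blockTriangular _
  have hAb' : A⁻¹.BlockTriangular id := blockTriangular_inv hAb (isUnit_det_unipotent _)
  have hAA : A⁻¹ * A = 1 := unipotent_inv_mul _
  have hAA' : A * A⁻¹ = 1 := unipotent_mul_inv _
  have hT1 : ∀ r, A⁻¹ * comp (triParam d n x) r = D r * A⁻¹ :=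
    fun r => unipotent_inv_mul_triTuple _ _ r
  have hT2 : ∀ r, comp (triParam d n x) r * A = A * D r := fun r => comp_triTuple_mul _ _ r
  set Z : Fin d → Matrix (Fin n) (Fin n) ℂ := fun r => A⁻¹ * comp X r * A with hZ
  have hZb : ∀ r, (Z r).BlockTriangular id := fun r => (hAb'.mul (hX r)).mul hAb
  have hconj : ∀ r s, A⁻¹ * (comp (triParam d n x) r * comp X s) * A = D r * Z s := by
    intro r s
    rw [← Matrix.mul_assoc, hT1]
    simp only [hZ, Matrix.mul_assoc]
  have hconj' : ∀ r s, A⁻¹ * (comp X r * comp (triParam d n x) s) * A = Z r * D s := by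
    intro r s
    rw [Matrix.mul_assoc, Matrix.mul_assoc, hT2]
    simp only [hZ, Matrix.mul_assoc]
  have hZlin : ∀ r s, D r * Z s + Z r * D s = D s * Z r + Z s * D r := by
    intro r s
    have := congrArg (fun M => A⁻¹ * M * A) (hlin r s)
    simpa only [mul_add, add_mul, hconj, hconj'] using this
  have hent : ∀ r i j, Z r i j * (lamOf x j 0 - lamOf x i 0) =
      Z 0 i j * (lamOf x j r - lamOf x i r) := by
    intro r i j
    have := congrFun (congrFun (hZlin r 0) i) j
    simp only [D, Matrix.add_apply, Matrix.mul_diagonal, Matrix.diagonal_mul] at this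
    linear_combination this
  set Y : Matrix (Fin n) (Fin n) ℂ := Matrix.of fun i j =>
    if i < j then Z 0 i j / (lamOf x j 0 - lamOf x i 0) else 0 with hYdef
  let q : DiagUni d n := WithLp.toLp 2 (Sum.elim (fun k => Z k.2 k.1 k.1)
    fun p => (A * Y) p.1.1 p.1.2)
  have hN : strictUpper (uppOf q) = A * Y := by
    ext i j
    by_cases h : i < j
    · simp only [strictUpper, Matrix.of_apply, h, dite_true]
      rfl
    · rw [strictUpper_of_le _ (not_lt.1 h), Matrix.mul_apply, eq_comm]
      refine Finset.sum_eq_zero fun k _ => ?_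
      rcases lt_or_ge k i with hk | hk
      · rw [hAb hk, zero_mul]
      · have : ¬ k < j := fun h' => h (hk.trans_lt h')
        simp [hYdef, this]
  have hZY : ∀ r, Y * D r - D r * Y + Matrix.diagonal (fun j => lamOf q j r) = Z r := by
    intro r
    ext i j
    simp only [D, Matrix.add_apply, Matrix.sub_apply, Matrix.mul_diagonal, Matrix.diagonal_mul]
    rcases lt_trichotomy i j with h | h | h
    · have hne : lamOf x j 0 - lamOf x i 0 ≠ 0 := fun h0 =>
        h.ne' (hx (sub_eq_zero.1 h0))
      rw [Matrix.diagonal_apply_ne _ h.ne, hYdef]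
      simp only [Matrix.of_apply, h, if_true]
      have := hent r i j
      field_simp
      linear_combination -this
    · subst h
      simp only [hYdef, Matrix.of_apply, lt_self_iff_false, if_false, zero_mul, mul_zero, sub_zero,
        zero_add, Matrix.diagonal_apply_eq]
      rfl
    · rw [hZb r h, Matrix.diagonal_apply_ne _ h.ne']
      simp [hYdef, h.not_gt]
  refine ⟨q, matTuple_ext fun r => ?_⟩
  have hg := dTri_gauge x q r
  rw [hN, ← Matrix.mul_assoc, ← hA, hAA, Matrix.one_mul] at hg
  have hg' : A⁻¹ * comp (dTri x q) r * A = Z r := hg.trans (hZY r)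
  have hcancel : ∀ M : Matrix (Fin n) (Fin n) ℂ, M = A * (A⁻¹ * M * A) * A⁻¹ := fun M => by
    rw [← Matrix.mul_assoc, ← Matrix.mul_assoc, hAA', Matrix.one_mul, Matrix.mul_assoc, hAA',
      Matrix.mul_one]
  rw [hcancel (comp (dTri x q) r), hg', hZ]
  exact (hcancel _).symm

omit [NeZero d] in
lemma comp_ad (Q : MatTuple d n) (S : skewOff n) (r : Fin d) :
    comp (ad Q S) r = comp Q r * skewMat S - skewMat S * comp Q r := by
  simp [ad]

/-- Transversality of conjugation directions to the triangular tuples. With `B = A⁻¹ S A`, the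
commutator `[D^0, B]` is triangular, and the eigenvalues are distinct, so `B` and hence `S` are
triangular; a skew-Hermitian triangular matrix with zero diagonal is zero. -/
lemma dTri_eq_ad {x q : DiagUni d n} (hx : lamOf x ∈ Generic d n) {S : skewOff n}
    (h : dTri x q = ad (triParam d n x) S) : q = 0 ∧ S = 0 := by
  set A := unipotent (uppOf x) with hA
  set D : Fin d → Matrix (Fin n) (Fin n) ℂ := fun r => Matrix.diagonal fun j => lamOf x j r
  have hAb : A.BlockTriangular id := unipotent_blockTriangular _
  have hAb' : A⁻¹.BlockTriangular id := blockTriangular_inv hAb (isUnit_det_unipotent _)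
  have hAA' : A * A⁻¹ = 1 := unipotent_mul_inv _
  have hT1 : A⁻¹ * comp (triParam d n x) 0 = D 0 * A⁻¹ := unipotent_inv_mul_triTuple _ _ 0
  have hT2 : comp (triParam d n x) 0 * A = A * D 0 := comp_triTuple_mul _ _ 0
  set B := A⁻¹ * skewMat S * A with hB
  have h1 : A⁻¹ * comp (dTri x q) 0 * A = D 0 * B - B * D 0 := by
    rw [h, comp_ad, mul_sub, sub_mul, ← Matrix.mul_assoc, hT1]
    congr 1
    · simp only [hB, Matrix.mul_assoc]
    · rw [Matrix.mul_assoc, Matrix.mul_assoc, hT2]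
      simp only [hB, Matrix.mul_assoc]
  have h2 : (D 0 * B - B * D 0).BlockTriangular id := by
    rw [← h1]
    exact (hAb'.mul (dTri_blockTriangular x q 0)).mul hAb
  have hBb : B.BlockTriangular id := by
    intro i j hij
    have := h2 hij
    simp only [D, Matrix.sub_apply, Matrix.mul_diagonal, Matrix.diagonal_mul] at this
    have h3 : (lamOf x i 0 - lamOf x j 0) * B i j = 0 := by linear_combination this
    rcases mul_eq_zero.1 h3 with h4 | h4
    · exact absurd (hx (sub_eq_zero.1 h4)) (ne_of_gt hij)
    · exact h4
  have hS : skewMat S = A * B * A⁻¹ := by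
    rw [hB, ← Matrix.mul_assoc, ← Matrix.mul_assoc, hAA', Matrix.one_mul, Matrix.mul_assoc, hAA',
      Matrix.mul_one]
  have hSb : (skewMat S).BlockTriangular id := by
    rw [hS]; exact (hAb.mul hBb).mul hAb'
  have hS0 : S = 0 := by
    ext ⟨i, j⟩
    change S.1 (i, j) = 0
    rcases lt_trichotomy i j with h | h | h
    · have h5 : S.1 (j, i) = 0 := hSb (i := j) (j := i) h
      rw [S.2.1 i j, h5]; simp
    · subst h; exact S.2.2 i
    · exact hSb h
  refine ⟨dTri_injective hx ?_, hS0⟩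
  rw [h, hS0, map_zero, map_zero]

/-- The derivative of the parametrization of the upper triangular tuples as a real map. -/
noncomputable abbrev dTriReal (x : DiagUni d n) : DiagUni d n →L[ℝ] MatTuple d n :=
  (dTri x).restrictScalars ℝ

omit [NeZero d] in
lemma continuous_comp (r : Fin d) : Continuous fun X : MatTuple d n => comp X r := by
  refine continuous_matrix fun i j => ?_
  exact (EuclideanSpace.proj (r, i, j) : MatTuple d n →L[ℂ] ℂ).continuous

omit [NeZero d] in
lemma comp_add (X Y : MatTuple d n) (r : Fin d) : comp (X + Y) r = comp X r + comp Y r := rfl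

omit [NeZero d] in
lemma comp_smul (c : ℝ) (X : MatTuple d n) (r : Fin d) : comp (c • X) r = c • comp X r := rfl

-- A tangent vector is a limit of `c_k v_k` with `v_k → 0` and `Q + v_k` in the set. Scale the
-- equations for `Q + v_k` by `c_k`: the quadratic terms are products of a convergent and a null
-- sequence, and disappear.
omit [NeZero d] in
lemma upperTri_linearized {Q y : MatTuple d n} (hQ : Q ∈ upperTri d n)
    (hy : y ∈ tangentConeAt ℝ (upperTri d n) Q) :
    (∀ r, (comp y r).BlockTriangular id) ∧
    ∀ r s, comp Q r * comp y s + comp y r * comp Q s =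
      comp Q s * comp y r + comp y s * comp Q r := by
  obtain ⟨ι, l, hl, c, v, hv, hmem, hlim⟩ := exists_fun_of_mem_tangentConeAt hy
  have hcomp : ∀ r, Filter.Tendsto (fun k => comp (c k • v k) r) l (𝓝 (comp y r)) :=
    fun r => ((continuous_comp r).tendsto y).comp hlim
  have hcomp0 : ∀ r, Filter.Tendsto (fun k => comp (v k) r) l (𝓝 0) :=
    fun r => ((continuous_comp r).tendsto 0).comp hv
  constructor
  · intro r i j hij
    have h1 : Filter.Tendsto (fun k => comp (c k • v k) r i j) l (𝓝 (comp y r i j)) :=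
      ((hcomp r).apply_nhds i).apply_nhds j
    refine tendsto_nhds_unique_of_eventuallyEq h1 tendsto_const_nhds ?_
    filter_upwards [hmem] with k hk
    have h2 := hk.2 r i j hij
    have h3 := hQ.2 r i j hij
    rw [PiLp.add_apply, h3, zero_add] at h2
    change (c k • v k) (r, i, j) = 0
    rw [PiLp.smul_apply, h2, smul_zero]
  · intro r s
    have h1 : Filter.Tendsto (fun k => comp Q r * comp (c k • v k) s +
        comp (c k • v k) r * comp Q s + comp (c k • v k) r * comp (v k) s) l
        (𝓝 (comp Q r * comp y s + comp y r * comp Q s + comp y r * 0)) :=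
      (((hcomp s).const_mul _).add ((hcomp r).mul_const _)).add ((hcomp r).mul (hcomp0 s))
    have h2 : Filter.Tendsto (fun k => comp Q s * comp (c k • v k) r +
        comp (c k • v k) s * comp Q r + comp (c k • v k) s * comp (v k) r) l
        (𝓝 (comp Q s * comp y r + comp y s * comp Q r + comp y s * 0)) :=
      (((hcomp r).const_mul _).add ((hcomp s).mul_const _)).add ((hcomp s).mul (hcomp0 r))
    simp only [mul_zero, add_zero] at h1 h2
    refine tendsto_nhds_unique_of_eventuallyEq h1 h2 ?_
    filter_upwards [hmem] with k hk
    have h3 := hk.1 r s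
    have h4 := hQ.1 r s
    simp only [comp_add, add_mul, mul_add, h4] at h3
    simp only [comp_smul, smul_mul_assoc, mul_smul_comm, ← smul_add]
    congr 1
    have h5 := add_left_cancel (a := comp Q s * comp Q r)
      (b := comp Q r * comp (v k) s + comp (v k) r * comp Q s + comp (v k) r * comp (v k) s)
      (c := comp Q s * comp (v k) r + comp (v k) s * comp Q r + comp (v k) s * comp (v k) r)
    refine h5 ?_
    rw [← sub_eq_zero] at h3 ⊢
    rw [← h3]
    abel

/-- The tangent space to the upper triangular commuting tuples at a generic point. -/
lemma tangentUpper_triParam {x : DiagUni d n} (hx : lamOf x ∈ Generic d n) :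
    tangentUpper (triParam d n x) = LinearMap.range (dTriReal x).toLinearMap := by
  -- Tangent vectors solve the linearized equations, all of whose triangular solutions are in the
  -- range of the derivative. Conversely the derivative of a map into a set takes values in its
  -- tangent cone.
  refine le_antisymm (Submodule.span_le.2 fun y hy => ?_) ?_
  · obtain ⟨h1, h2⟩ := upperTri_linearized (triTuple_mem_upperTri _ _) hy
    exact exists_dTri_eq hx h1 h2
  · rintro _ ⟨q, rfl⟩
    refine Submodule.subset_span ?_
    have h1 : HasFDerivWithinAt (triParam d n) (dTriReal x) Set.univ x :=
      ((hasStrictFDerivAt_triParam x).hasFDerivAt.restrictScalars ℝ).hasFDerivWithinAt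
    have h2 := h1.mapsTo_tangent_cone
      (show q ∈ tangentConeAt ℝ Set.univ x by rw [tangentConeAt_univ]; trivial)
    refine tangentConeAt_mono ?_ h2
    rintro _ ⟨z, -, rfl⟩
    exact triTuple_mem_upperTri _ _

end TriangularDerivative

end CommTuple

/-! ### Norm determinants and their splitting -/

section NormDet

lemma EuclideanSpace.real_inner_eq_re_inner {ι : Type*} [Fintype ι] (x y : EuclideanSpace ℂ ι) :
    inner ℝ x y = (inner ℂ x y).re := by
  rw [PiLp.inner_apply, PiLp.inner_apply, Complex.re_sum]
  rfl

lemma LinearMap.adjoint_restrictScalars_real {ι κ : Type*} [Fintype ι] [Fintype κ]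
    (f : EuclideanSpace ℂ ι →ₗ[ℂ] EuclideanSpace ℂ κ) :
    LinearMap.adjoint (f.restrictScalars ℝ) = (LinearMap.adjoint f).restrictScalars ℝ := by
  symm
  rw [LinearMap.eq_adjoint_iff]
  intro x y
  rw [EuclideanSpace.real_inner_eq_re_inner, EuclideanSpace.real_inner_eq_re_inner]
  exact congrArg Complex.re (LinearMap.adjoint_inner_left f y x)

/-- The real determinant of `f^* f` is the squared modulus of its complex determinant, and it is
also the square of the norm determinant. Hence `|det Γ|` enters without a square root. -/
lemma LinearMap.normDet_restrictScalars_real {ι κ : Type*} [Fintype ι] [Fintype κ]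
    (f : EuclideanSpace ℂ ι →ₗ[ℂ] EuclideanSpace ℂ κ) :
    (f.restrictScalars ℝ).normDet = ‖LinearMap.det (LinearMap.adjoint f ∘ₗ f)‖ := by
  have h1 := LinearMap.normDet_sq (f.restrictScalars ℝ)
  have h2 : LinearMap.adjoint (f.restrictScalars ℝ) ∘ₗ f.restrictScalars ℝ =
      (LinearMap.adjoint f ∘ₗ f).restrictScalars ℝ := by
    rw [LinearMap.adjoint_restrictScalars_real]; rfl
  rw [h2, LinearMap.det_restrictScalars, Algebra.norm_complex_eq] at h1
  change (f.restrictScalars ℝ).normDet ^ 2 = Complex.normSq _ at h1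
  rw [Complex.normSq_eq_norm_sq] at h1
  exact (sq_eq_sq₀ (LinearMap.normDet_nonneg _) (norm_nonneg _)).1 h1

variable {U V W : Type*} [NormedAddCommGroup U] [InnerProductSpace ℝ U] [FiniteDimensional ℝ U]
  [NormedAddCommGroup V] [InnerProductSpace ℝ V] [FiniteDimensional ℝ V]
  [NormedAddCommGroup W] [InnerProductSpace ℝ W]

lemma WithLp.prod_ext {U V : Type*} {x y : WithLp 2 (U × V)} (h₁ : x.fst = y.fst)
    (h₂ : x.snd = y.snd) : x = y :=
  WithLp.ofLp_injective 2 (Prod.ext h₁ h₂)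

/-- The linear map `(u, v) ↦ f u + g v` on the Euclidean product. -/
noncomputable def LinearMap.coprodL2 (f : U →ₗ[ℝ] W) (g : V →ₗ[ℝ] W) : WithLp 2 (U × V) →ₗ[ℝ] W :=
  f.coprod g ∘ₗ (WithLp.linearEquiv 2 ℝ (U × V)).toLinearMap

omit [FiniteDimensional ℝ U] [FiniteDimensional ℝ V] in
@[simp] lemma LinearMap.coprodL2_apply (f : U →ₗ[ℝ] W) (g : V →ₗ[ℝ] W) (x : WithLp 2 (U × V)) :
    f.coprodL2 g x = f x.fst + g x.snd := rfl

/-- The Gram matrix is block diagonal. -/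
lemma LinearMap.normDet_coprodL2_of_orthogonal (f : U →ₗ[ℝ] W) (g : V →ₗ[ℝ] W)
    (h : ∀ u v, inner ℝ (f u) (g v) = 0) :
    (f.coprodL2 g).normDet = f.normDet * g.normDet := by
  let bU := stdOrthonormalBasis ℝ U
  let bV := stdOrthonormalBasis ℝ V
  have hs : (f.coprodL2 g).normDet ^ 2 = (f.normDet * g.normDet) ^ 2 := by
    have h1 := LinearMap.normDet_sq_eq_det_gram (f.coprodL2 g) (bU.prod bV)
    have h2 := LinearMap.normDet_sq_eq_det_gram f bU
    have h3 := LinearMap.normDet_sq_eq_det_gram g bV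
    have h4 : (Matrix.gram ℝ fun x => f.coprodL2 g ((bU.prod bV) x)) =
        Matrix.fromBlocks (Matrix.gram ℝ fun x => f (bU x)) 0 0
          (Matrix.gram ℝ fun x => g (bV x)) := by
      ext i j
      rcases i with i | i <;> rcases j with j | j
      · simp [Matrix.gram]
      · simp [Matrix.gram, h]
      · simp [Matrix.gram, real_inner_comm, h]
      · simp [Matrix.gram]
    rw [h4, Matrix.det_fromBlocks_zero₂₁, ← h2, ← h3] at h1
    rw [mul_pow]
    exact h1
  exact (sq_eq_sq₀ (LinearMap.normDet_nonneg _)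
    (mul_nonneg (LinearMap.normDet_nonneg _) (LinearMap.normDet_nonneg _))).1 hs

/-- The shear `(u, v) ↦ (u + k v, v)`. -/
noncomputable def LinearMap.shear (k : V →ₗ[ℝ] U) : WithLp 2 (U × V) →ₗ[ℝ] WithLp 2 (U × V) where
  toFun x := WithLp.toLp 2 (x.fst + k x.snd, x.snd)
  map_add' x y := by
    refine WithLp.prod_ext ?_ ?_ <;> simp
    abel
  map_smul' c x := by
    refine WithLp.prod_ext ?_ ?_ <;> simp

/-- The inverse shear is conjugate to the shear by the isometry `(u, v) ↦ (u, -v)`, so the norm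
determinant has square `1`. -/
lemma LinearMap.normDet_shear (k : V →ₗ[ℝ] U) : (LinearMap.shear k).normDet = 1 := by
  let e : WithLp 2 (U × V) →ₗᵢ[ℝ] WithLp 2 (U × V) :=
    { toFun := fun x => WithLp.toLp 2 (x.fst, -x.snd)
      map_add' := fun x y => by
        refine WithLp.prod_ext ?_ ?_ <;> simp
        abel
      map_smul' := fun c x => by
        refine WithLp.prod_ext ?_ ?_ <;> simp
      norm_map' := fun x => by
        simp [WithLp.prod_norm_eq_of_L2] }
  have h1 : LinearMap.shear (-k) ∘ₗ LinearMap.shear k = LinearMap.id := by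
    ext x
    refine WithLp.prod_ext ?_ ?_ <;> simp [LinearMap.shear]
  have h2 : LinearMap.shear (-k) = e.toLinearMap ∘ₗ LinearMap.shear k ∘ₗ e.toLinearMap := by
    ext x
    refine WithLp.prod_ext ?_ ?_ <;> simp [LinearMap.shear, e]
  have h3 := congrArg LinearMap.normDet h1
  rw [LinearMap.normDet_comp_of_finrank_eq _ _ rfl, h2,
    LinearMap.normDet_comp_of_finrank_eq _ _ rfl, LinearMap.normDet_comp_of_finrank_eq _ _ rfl,
    LinearIsometry.normDet_eq_one, LinearMap.normDet_id, one_mul, mul_one] at h3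
  have h4 := LinearMap.normDet_nonneg (LinearMap.shear k)
  nlinarith

/-- The norm determinant of `(u, v) ↦ f u + g v` splits along the orthogonal complement of the
range of `f`. -/
lemma LinearMap.normDet_coprodL2 [FiniteDimensional ℝ W] (f : U →ₗ[ℝ] W) (g : V →ₗ[ℝ] W)
    (hf : Function.Injective f) :
    (f.coprodL2 g).normDet =
      f.normDet * (((LinearMap.range f)ᗮ.starProjection : W →ₗ[ℝ] W) ∘ₗ g).normDet := by
  obtain ⟨f', hf'⟩ := f.exists_leftInverse_of_injective (LinearMap.ker_eq_bot.2 hf)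
  -- `k` is chosen so that `f (k v)` is the component of `g v` in the range of `f`; the shear by `k`
  -- transfers it to the first factor.
  let k : V →ₗ[ℝ] U := f' ∘ₗ ((LinearMap.range f).starProjection : W →ₗ[ℝ] W) ∘ₗ g
  have hk : ∀ v, f (k v) = (LinearMap.range f).starProjection (g v) := by
    intro v
    obtain ⟨u, hu⟩ := (LinearMap.range f).starProjection_apply_mem (g v)
    have h1 : f' (f u) = u := congrArg (fun φ => φ u) hf'
    simp only [k, LinearMap.comp_apply, ContinuousLinearMap.coe_coe, ← hu, h1]
  have h1 : f.coprodL2 g =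
      f.coprodL2 (((LinearMap.range f)ᗮ.starProjection : W →ₗ[ℝ] W) ∘ₗ g) ∘ₗ LinearMap.shear k := by
    ext x
    have := (LinearMap.range f).starProjection_add_starProjection_orthogonal (g x.snd)
    change f x.fst + g x.snd =
      f (x.fst + k x.snd) + (LinearMap.range f)ᗮ.starProjection (g x.snd)
    rw [map_add, hk, add_assoc, this]
  rw [h1, LinearMap.normDet_comp_of_finrank_eq _ _ rfl, LinearMap.normDet_shear, mul_one]
  refine LinearMap.normDet_coprodL2_of_orthogonal _ _ fun u v => ?_
  exact Submodule.inner_right_of_mem_orthogonal (LinearMap.mem_range_self f u)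
    ((LinearMap.range f)ᗮ.starProjection_apply_mem (g v))

/-- The linear map `(u, v) ↦ f u + g v` on the Euclidean product, as a continuous linear map. -/
noncomputable def LinearMap.coprodCLM (f : U →ₗ[ℝ] W) (g : V →ₗ[ℝ] W) : WithLp 2 (U × V) →L[ℝ] W :=
  LinearMap.toContinuousLinearMap (f.coprodL2 g)

lemma LinearMap.coe_coprodCLM (f : U →ₗ[ℝ] W) (g : V →ₗ[ℝ] W) :
    (f.coprodCLM g).toLinearMap = f.coprodL2 g := rfl

/-- The norm determinant of a continuous linear map. -/
noncomputable def ContinuousLinearMap.normDet (L : U →L[ℝ] W) : ℝ := L.toLinearMap.normDet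

lemma ContinuousLinearMap.continuous_normDet {X : Type*} [TopologicalSpace X] {L : X → U →L[ℝ] W}
    (hL : ∀ v, Continuous fun x => L x v) : Continuous fun x => (L x).normDet := by
  let b := stdOrthonormalBasis ℝ U
  have h : ∀ x, (L x).normDet = Real.sqrt (Matrix.gram ℝ fun i => L x (b i)).det := fun x => by
    have h1 := LinearMap.normDet_sq_eq_det_gram (L x).toLinearMap b
    have h2 : (Matrix.gram ℝ fun i => L x (b i)).det = (L x).toLinearMap.normDet ^ 2 := h1.symm
    rw [h2, Real.sqrt_sq (LinearMap.normDet_nonneg _)]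
    rfl
  simp only [h]
  refine Real.continuous_sqrt.comp (Continuous.matrix_det (continuous_matrix fun i j => ?_))
  exact (hL _).inner (hL _)

/-- The factor `√|det Λ|` arises here. The projection `P` is self-adjoint and idempotent, so `(P
g)^* (P g) = g^* P g`, and the determinant of this operator is the square of the norm determinant of
`P g`. -/
lemma LinearMap.normDet_coprodCLM_neg [FiniteDimensional ℝ W] (f : U →ₗ[ℝ] W) (g : V →ₗ[ℝ] W)
    (hf : Function.Injective f) {T : Submodule ℝ W} (hT : T = LinearMap.range f) :
    (f.coprodCLM (-g)).normDet =
      f.normDet * Real.sqrt |LinearMap.det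
        (LinearMap.adjoint g ∘ₗ (Tᗮ.starProjection : W →ₗ[ℝ] W) ∘ₗ g)| := by
  subst hT
  rw [ContinuousLinearMap.normDet, LinearMap.coe_coprodCLM, LinearMap.normDet_coprodL2 _ _ hf,
    LinearMap.comp_neg, LinearMap.normDet_neg]
  congr 1
  set P : W →ₗ[ℝ] W := (LinearMap.range f)ᗮ.starProjection with hP
  have hadj : LinearMap.adjoint P = P := by
    symm
    rw [LinearMap.eq_adjoint_iff]
    exact fun x y => Submodule.inner_starProjection_left_eq_right _ _ _
  have hPP : P ∘ₗ P = P := by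
    ext1 x
    exact Submodule.starProjection_eq_self_iff.2 (Submodule.starProjection_apply_mem _ _)
  have h1 := LinearMap.normDet_sq (P ∘ₗ g)
  have h2 : LinearMap.adjoint (P ∘ₗ g) ∘ₗ (P ∘ₗ g) = LinearMap.adjoint g ∘ₗ P ∘ₗ g := by
    rw [LinearMap.adjoint_comp, hadj, LinearMap.comp_assoc, ← LinearMap.comp_assoc g P P, hPP]
  rw [h2] at h1
  have h3 : LinearMap.det (LinearMap.adjoint g ∘ₗ P ∘ₗ g) = (P ∘ₗ g).normDet ^ 2 := h1.symm
  rw [h3, abs_sq, Real.sqrt_sq (LinearMap.normDet_nonneg _)]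

end NormDet

namespace CommTuple

variable {d n : ℕ}

/-! ### Exponentials of skew-Hermitian matrices -/

section SkewExponential

lemma skewMat_conjTranspose (S : skewOff n) : (skewMat S)ᴴ = -skewMat S := by
  ext i j
  have := S.2.1 j i
  simp [skewMat, this]

lemma skewMat_add (S T : skewOff n) : skewMat (S + T) = skewMat S + skewMat T := by
  ext; simp [skewMat]

lemma skewMat_smul (c : ℝ) (S : skewOff n) : skewMat (c • S) = c • skewMat S := by
  ext; simp [skewMat]

lemma skewMat_neg (S : skewOff n) : skewMat (-S) = -skewMat S := by
  ext; simp [skewMat]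

/-- `skewMat` as a real linear map. -/
noncomputable def skewMatLin (n : ℕ) : skewOff n →ₗ[ℝ] Matrix (Fin n) (Fin n) ℂ where
  toFun := skewMat
  map_add' := skewMat_add
  map_smul' := skewMat_smul

lemma continuous_skewMat : Continuous (skewMat (n := n)) :=
  continuous_matrix fun i j =>
    (EuclideanSpace.proj (i, j) : EuclideanSpace ℂ (Fin n × Fin n) →L[ℂ] ℂ).continuous.comp
      continuous_subtype_val

lemma exp_skewMat_mem (S : skewOff n) :
    NormedSpace.exp (skewMat S) ∈ Matrix.unitaryGroup (Fin n) ℂ := by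
  rw [Matrix.mem_unitaryGroup_iff', Matrix.star_eq_conjTranspose, ← Matrix.exp_conjTranspose,
    skewMat_conjTranspose, Matrix.exp_neg]
  exact Matrix.nonsing_inv_mul _ ((Matrix.isUnit_iff_isUnit_det _).1 (Matrix.isUnit_exp _))

/-- The unitary matrix `e^S`. -/
noncomputable def expU (S : skewOff n) : Matrix.unitaryGroup (Fin n) ℂ :=
  ⟨NormedSpace.exp (skewMat S), exp_skewMat_mem S⟩

@[simp] lemma coe_expU (S : skewOff n) : (expU S).1 = NormedSpace.exp (skewMat S) := rfl

lemma expU_conjTranspose (S : skewOff n) : (expU S).1ᴴ = NormedSpace.exp (skewMat (-S)) := by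
  rw [coe_expU, ← Matrix.exp_conjTranspose, skewMat_conjTranspose, skewMat_neg]

open scoped Matrix.Norms.Operator in
lemma continuous_exp_matrix :
    Continuous fun M : Matrix (Fin n) (Fin n) ℂ => NormedSpace.exp M :=
  NormedSpace.exp_continuous

lemma continuous_expU : Continuous (expU (n := n)) :=
  Continuous.subtype_mk (continuous_exp_matrix.comp continuous_skewMat) _

lemma expU_zero : expU (0 : skewOff n) = 1 := by
  refine Subtype.ext ?_
  have : skewMat (0 : skewOff n) = 0 := map_zero (skewMatLin n)
  rw [coe_expU, this, NormedSpace.exp_zero]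
  rfl

end SkewExponential

/-! ### The tube around the triangular tuples and its Jacobian -/

section TubeParametrization

/-- The parametrization `(x, S) ↦ e^S Θ(x) e^{-S}` of the commuting tuples near the upper
triangular ones. -/
noncomputable def tubeParam (d n : ℕ) (y : WithLp 2 (DiagUni d n × skewOff n)) : MatTuple d n :=
  uconj (expU y.snd) (triParam d n y.fst)

/-- The derivative of `tubeParam` at `(x, 0)`. -/
noncomputable def tubeDeriv (x : DiagUni d n) :=
  LinearMap.coprodCLM (U := DiagUni d n) (V := skewOff n) (W := MatTuple d n)
    (dTriReal x).toLinearMap (-(ad (triParam d n x)))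

lemma tubeDeriv_apply (x : DiagUni d n) (y : WithLp 2 (DiagUni d n × skewOff n)) :
    tubeDeriv x y = dTri x y.fst - ad (triParam d n x) y.snd :=
  (sub_eq_add_neg _ _).symm

section

open scoped Matrix.Norms.Operator

lemma hasStrictFDerivAt_exp_skewMat :
    HasStrictFDerivAt (fun S : skewOff n => NormedSpace.exp (skewMat S))
      (LinearMap.toContinuousLinearMap (skewMatLin n)) 0 := by
  have h1 : HasStrictFDerivAt (fun S : skewOff n => skewMat S)
      (LinearMap.toContinuousLinearMap (skewMatLin n)) 0 :=
    (LinearMap.toContinuousLinearMap (skewMatLin n)).hasStrictFDerivAt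
  have h0 : skewMat (0 : skewOff n) = 0 := map_zero (skewMatLin n)
  have h2 : HasStrictFDerivAt (NormedSpace.exp : Matrix (Fin n) (Fin n) ℂ → _)
      (1 : Matrix (Fin n) (Fin n) ℂ →L[ℝ] _) (skewMat (0 : skewOff n)) := by
    rw [h0]
    exact hasStrictFDerivAt_exp_zero
  exact h2.comp 0 h1

/-- `comp` as a real linear map. -/
noncomputable def compLin (r : Fin d) : MatTuple d n →ₗ[ℝ] Matrix (Fin n) (Fin n) ℂ where
  toFun X := comp X r
  map_add' _ _ := rfl
  map_smul' _ _ := rfl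

lemma hasStrictFDerivAt_exp_comp {E : Type*} [NormedAddCommGroup E] [NormedSpace ℝ E]
    (φ : E →L[ℝ] skewOff n) (y : E) (hy : φ y = 0) :
    HasStrictFDerivAt (fun z => NormedSpace.exp (skewMat (φ z)))
      ((LinearMap.toContinuousLinearMap (skewMatLin n)).comp φ) y := by
  have h := hasStrictFDerivAt_exp_skewMat (n := n)
  rw [← hy] at h
  exact h.comp y φ.hasStrictFDerivAt

lemma hasStrictFDerivAt_triParam_comp {E : Type*} [NormedAddCommGroup E] [NormedSpace ℝ E]
    (φ : E →L[ℝ] DiagUni d n) (y : E) (r : Fin d) :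
    HasStrictFDerivAt (fun z => comp (triParam d n (φ z)) r)
      ((LinearMap.toContinuousLinearMap (compLin r)).comp ((dTriReal (φ y)).comp φ)) y :=
  (LinearMap.toContinuousLinearMap (compLin (d := d) (n := n) r)).hasStrictFDerivAt.comp y
    (((hasStrictFDerivAt_triParam (φ y)).restrictScalars ℝ).comp y φ.hasStrictFDerivAt)

/-- `ofComp` as a real linear map. -/
noncomputable def ofCompLin : (Fin d → Matrix (Fin n) (Fin n) ℂ) →ₗ[ℝ] MatTuple d n where
  toFun M := ofComp M
  map_add' _ _ := rfl
  map_smul' _ _ := rfl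

/-- Only the points with `S = 0` are needed, where the exponential has the identity as derivative.
The variation of `e^S Q e^{-S}` there is `S Q - Q S = -ad_Q S`. -/
lemma hasStrictFDerivAt_tubeParam (x : DiagUni d n) :
    HasStrictFDerivAt (tubeParam d n) (tubeDeriv x) (WithLp.toLp 2 (x, 0)) := by
  let y₀ : WithLp 2 (DiagUni d n × skewOff n) := WithLp.toLp 2 (x, 0)
  let pS : WithLp 2 (DiagUni d n × skewOff n) →L[ℝ] skewOff n :=
    WithLp.sndL 2 ℝ (DiagUni d n) (skewOff n)
  let pX : WithLp 2 (DiagUni d n × skewOff n) →L[ℝ] DiagUni d n :=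
    WithLp.fstL 2 ℝ (DiagUni d n) (skewOff n)
  have hE := hasStrictFDerivAt_exp_comp pS y₀ rfl
  have hE' := hasStrictFDerivAt_exp_comp (-pS) y₀ neg_zero
  have hT := hasStrictFDerivAt_triParam_comp pX y₀
  have hP := hasStrictFDerivAt_pi.2 fun r : Fin d => (hE.mul' (hT r)).mul' hE'
  have hF := (LinearMap.toContinuousLinearMap (ofCompLin (d := d) (n := n))).hasStrictFDerivAt.comp
    y₀ hP
  have hfun : (tubeParam d n) = fun y => LinearMap.toContinuousLinearMap
      (ofCompLin (d := d) (n := n)) fun r => NormedSpace.exp (skewMat y.snd) *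
        comp (triParam d n y.fst) r * NormedSpace.exp (skewMat (-y.snd)) := by
    funext y
    refine matTuple_ext fun r => ?_
    rw [tubeParam, comp_uconj, expU_conjTranspose]
    exact (comp_ofComp (fun r => NormedSpace.exp (skewMat y.snd) * comp (triParam d n y.fst) r *
      NormedSpace.exp (skewMat (-y.snd))) r).symm
  rw [hfun]
  refine hF.congr_fderiv ?_
  ext1 y
  rw [tubeDeriv_apply]
  refine matTuple_ext fun r => ?_
  have e0 : NormedSpace.exp (skewMat y₀.snd) = 1 := congrArg Subtype.val (expU_zero (n := n))
  have e0' : NormedSpace.exp (skewMat (-y₀.snd)) = 1 := by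
    rw [show -y₀.snd = 0 from neg_zero]
    exact congrArg Subtype.val (expU_zero (n := n))
  change NormedSpace.exp (skewMat y₀.snd) * comp (triParam d n x) r * skewMat (-y.snd) +
    (NormedSpace.exp (skewMat y₀.snd) * comp (dTri x y.fst) r +
      skewMat y.snd * comp (triParam d n x) r) * NormedSpace.exp (skewMat (-y₀.snd)) =
    comp (dTri x y.fst) r - comp (ad (triParam d n x) y.snd) r
  rw [e0, e0', comp_ad, skewMat_neg]
  simp only [one_mul, mul_one, mul_neg]
  abel

end

lemma continuous_triParam : Continuous (triParam d n) :=
  (contDiff_triParam (m := 1)).continuous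

/-- The Jacobian of `tubeParam` at `(x, 0)`. -/
noncomputable def tubeJac (x : DiagUni d n) : ℝ :=
  ContinuousLinearMap.normDet (U := WithLp 2 (DiagUni d n × skewOff n)) (W := MatTuple d n)
    (tubeDeriv x)

lemma continuous_dTri_apply (q : DiagUni d n) : Continuous fun x : DiagUni d n => dTri x q :=
  ((contDiff_triParam (m := 1)).continuous_fderiv one_ne_zero).clm_apply continuous_const

lemma continuous_ad_triParam_apply (S : skewOff n) :
    Continuous fun x : DiagUni d n => ad (triParam d n x) S := by
  refine (PiLp.continuous_toLp 2 _).comp (continuous_pi fun k => ?_)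
  have h1 := (continuous_comp (d := d) (n := n) k.1).comp continuous_triParam
  exact ((((h1.mul continuous_const).sub (continuous_const.mul h1))).matrix_elem k.2.1 k.2.2)

lemma continuous_tubeDeriv_apply (y : WithLp 2 (DiagUni d n × skewOff n)) :
    Continuous fun x : DiagUni d n => tubeDeriv x y := by
  have h : Continuous fun x : DiagUni d n => dTri x y.fst + -(ad (triParam d n x)) y.snd :=
    (continuous_dTri_apply y.fst).add (continuous_ad_triParam_apply y.snd).neg
  exact h

lemma continuous_tubeJac : Continuous (tubeJac (d := d) (n := n)) := by
  have h := ContinuousLinearMap.continuous_normDet (U := WithLp 2 (DiagUni d n × skewOff n))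
    (W := MatTuple d n) (L := fun x => tubeDeriv x)
  exact h continuous_tubeDeriv_apply

variable [NeZero d]

lemma tubeDeriv_injective {x : DiagUni d n} (hx : lamOf x ∈ Generic d n) :
    Function.Injective (tubeDeriv x) := by
  rw [injective_iff_map_eq_zero]
  intro y hy
  rw [tubeDeriv_apply, sub_eq_zero] at hy
  obtain ⟨h1, h2⟩ := dTri_eq_ad hx hy
  exact WithLp.prod_ext h1 h2

/-- At generic points the tangent space defining `Λ` is the range of `dG`, so the norm determinant
splits along it. -/
lemma tubeJac_eq {x : DiagUni d n} (hx : lamOf x ∈ Generic d n) :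
    tubeJac x =
      Real.sqrt |LinearMap.det (Lam (triParam d n x))| *
        ‖LinearMap.det (Gam (lamOf x) (uppOf x))‖ := by
  have h1 := LinearMap.normDet_coprodCLM_neg (U := DiagUni d n) (V := skewOff n)
    (W := MatTuple d n) (dTriReal x).toLinearMap (ad (triParam d n x)) (dTri_injective hx)
    (tangentUpper_triParam hx)
  have h2 := LinearMap.normDet_restrictScalars_real (dTri x).toLinearMap
  have hpt : WithLp.toLp 2 (Sum.elim (fun p => lamOf x p.1 p.2) (uppOf x)) = x := by
    ext k; rcases k with k | k <;> rfl
  rw [Gam, hpt]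
  refine h1.trans ?_
  rw [mul_comm]
  congr 1

end TubeParametrization

/-! ### Dimension counts -/

section Dimension

lemma two_mul_card_upperIdx : 2 * Fintype.card (UpperIdx n) = n * (n - 1) := by
  have h1 : (Finset.univ.filter fun p : Fin n × Fin n => p.1 ≠ p.2).card = n * (n - 1) := by
    have := Finset.offDiag_card (Finset.univ : Finset (Fin n))
    simp only [Finset.card_univ, Fintype.card_fin] at this
    rw [Nat.mul_sub_one, ← this]
    congr 1
    ext p
    simp
  have h2 : Fintype.card (UpperIdx n) =
      (Finset.univ.filter fun p : Fin n × Fin n => p.1 < p.2).card := Fintype.card_subtype _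
  have h3 : (Finset.univ.filter fun p : Fin n × Fin n => p.2 < p.1).card =
      (Finset.univ.filter fun p : Fin n × Fin n => p.1 < p.2).card :=
    Finset.card_bij' (fun p _ => p.swap) (fun p _ => p.swap) (by simp) (by simp) (by simp)
      (by simp)
  have h4 : (Finset.univ.filter fun p : Fin n × Fin n => p.1 ≠ p.2) =
      (Finset.univ.filter fun p : Fin n × Fin n => p.1 < p.2) ∪
        (Finset.univ.filter fun p : Fin n × Fin n => p.2 < p.1) := by
    ext p
    simp [lt_or_lt_iff_ne]
  rw [← h1, h4, Finset.card_union_of_disjoint, h3, h2, two_mul]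
  rw [Finset.disjoint_filter]
  exact fun p _ h => h.not_gt

/-- A skew-Hermitian matrix with zero diagonal is determined by its entries above the diagonal. -/
noncomputable def skewEquiv (n : ℕ) : skewOff n ≃ₗ[ℝ] (UpperIdx n → ℂ) where
  toFun S p := S.1 p.1
  map_add' _ _ := rfl
  map_smul' _ _ := rfl
  invFun a := ⟨WithLp.toLp 2 fun p => strictUpper a p.1 p.2 - star (strictUpper a p.2 p.1), by
    refine ⟨fun i j => ?_, fun i => ?_⟩
    · simp
    · simp [strictUpper_of_le]⟩
  left_inv S := by
    ext ⟨i, j⟩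
    change strictUpper (fun p => S.1 p.1) i j - star (strictUpper (fun p => S.1 p.1) j i) =
      S.1 (i, j)
    rcases lt_trichotomy i j with h | h | h
    · simp [strictUpper, h, h.not_gt]
    · subst h; simp [strictUpper, S.2.2 i]
    · rw [S.2.1 i j]; simp [strictUpper, h, h.not_gt]
  right_inv a := by
    ext ⟨⟨i, j⟩, h⟩
    change strictUpper a i j - star (strictUpper a j i) = _
    rw [strictUpper_of_le a (le_of_lt h)]
    simp [strictUpper, show i < j from h]

lemma finrank_skewOff : Module.finrank ℝ (skewOff n) = n * (n - 1) := by
  rw [(skewEquiv n).finrank_eq, Module.finrank_pi_fintype]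
  simp [← two_mul_card_upperIdx, mul_comm]

/-- The tube has exactly the real dimension of the Hausdorff measure `dX`, as the area formula
requires. -/
lemma finrank_tube : Module.finrank ℝ (WithLp 2 (DiagUni d n × skewOff n)) =
    2 * (n * (n - 1)) + 2 * (d * n) := by
  have h1 : Module.finrank ℝ (DiagUni d n) = 2 * (n * d + Fintype.card (UpperIdx n)) := by
    rw [← Module.finrank_mul_finrank ℝ ℂ (DiagUni d n), Complex.finrank_real_complex,
      finrank_euclideanSpace]
    simp
  have h2 := two_mul_card_upperIdx (n := n)
  rw [(WithLp.linearEquiv 2 ℝ (DiagUni d n × skewOff n)).finrank_eq, Module.finrank_prod, h1,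
    finrank_skewOff, mul_add, h2]
  ring

end Dimension

end CommTuple

namespace CommTuple

variable {d n : ℕ}

/-! ### Topology and measurability on the unitary group -/

section UnitaryTopology

instance : PolishSpace (Matrix (Fin n) (Fin n) ℂ) :=
  inferInstanceAs (PolishSpace (Fin n → Fin n → ℂ))

instance : PolishSpace (Matrix.unitaryGroup (Fin n) ℂ) :=
  (isClosed_unitary (R := Matrix (Fin n) (Fin n) ℂ)).polishSpace

instance : (haarU n).IsHaarMeasure := by unfold haarU; infer_instance

instance : IsProbabilityMeasure (haarU n) :=
  ⟨Measure.haarMeasure_self (K₀ := (⊤ : TopologicalSpace.PositiveCompacts _))⟩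

lemma measurable_mk : Measurable (QuotientGroup.mk : Matrix.unitaryGroup (Fin n) ℂ → FlagSpace n) :=
  QuotientGroup.measurable_coe

instance : IsProbabilityMeasure (nu n) :=
  Measure.isProbabilityMeasure_map measurable_mk.aemeasurable

lemma measurableSet_flag {N : Set (FlagSpace n)} :
    MeasurableSet N ↔
      MeasurableSet ((QuotientGroup.mk : Matrix.unitaryGroup (Fin n) ℂ → FlagSpace n) ⁻¹' N) :=
  measurableSet_quotient

lemma continuous_entry (i j : Fin n) :
    Continuous fun U : Matrix.unitaryGroup (Fin n) ℂ => U.1 i j :=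
  continuous_subtype_val.matrix_elem i j

lemma measurable_unitary_iff {α : Type*} [MeasurableSpace α]
    {f : α → Matrix.unitaryGroup (Fin n) ℂ} :
    Measurable f ↔ ∀ i j, Measurable fun x => (f x).1 i j := by
  let e : Matrix.unitaryGroup (Fin n) ℂ → Fin n → Fin n → ℂ := fun U => U.1
  have he : Topology.IsClosedEmbedding e :=
    (isClosed_unitary (R := Matrix (Fin n) (Fin n) ℂ)).isClosedEmbedding_subtypeVal
  rw [← he.measurableEmbedding.measurable_comp_iff]
  simp only [measurable_pi_iff]
  rfl

end UnitaryTopology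

/-! ### A measurable section of the quotient by the torus -/

section Section

/-- The phase that makes the first nonzero entry of a vector positive. -/
noncomputable def colPhase (v : Fin n → ℂ) : ℂ :=
  open Classical in
  ∑ i, if v i ≠ 0 ∧ ∀ k < i, v k = 0 then star (v i) / (‖v i‖ : ℂ) else 0

lemma exists_colPhase {v : Fin n → ℂ} (hv : v ≠ 0) :
    ∃ i, v i ≠ 0 ∧ (∀ k < i, v k = 0) ∧ colPhase v = star (v i) / (‖v i‖ : ℂ) := by
  classical
  obtain ⟨j, hj⟩ := Function.ne_iff.1 hv
  let s : Finset (Fin n) := Finset.univ.filter fun i => v i ≠ 0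
  have hs : s.Nonempty := ⟨j, by simpa [s] using hj⟩
  have hm := s.min'_mem hs
  have h1 : v (s.min' hs) ≠ 0 := by simpa [s] using hm
  have h2 : ∀ k < s.min' hs, v k = 0 := by
    intro k hk
    by_contra h
    exact absurd (s.min'_le k (by simpa [s] using h)) (not_le.2 hk)
  refine ⟨s.min' hs, h1, h2, ?_⟩
  rw [colPhase, Finset.sum_eq_single (s.min' hs), if_pos ⟨h1, h2⟩]
  · intro k _ hk
    refine if_neg ?_
    rintro ⟨h3, h4⟩
    rcases lt_or_gt_of_ne hk with h | h
    · exact h3 (h2 k h)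
    · exact h1 (h4 _ h)
  · simp

lemma norm_colPhase {v : Fin n → ℂ} (hv : v ≠ 0) : ‖colPhase v‖ = 1 := by
  obtain ⟨i, hi, -, h⟩ := exists_colPhase hv
  rw [h]
  simp [hi]

lemma colPhase_mul {c : ℂ} (hc : ‖c‖ = 1) (v : Fin n → ℂ) :
    colPhase (fun i => v i * c) = colPhase v * star c := by
  have hc0 : c ≠ 0 := by rintro rfl; simp at hc
  rw [colPhase, colPhase, Finset.sum_mul]
  refine Finset.sum_congr rfl fun i _ => ?_
  simp only [mul_eq_zero, hc0, or_false, ne_eq, star_mul', norm_mul, hc,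
    mul_one, ite_mul, zero_mul, div_mul_eq_mul_div]

lemma measurable_colPhase : Measurable (colPhase (n := n)) := by
  refine Finset.measurable_fun_sum _ fun i _ => Measurable.ite ?_ ?_ measurable_const
  · have h1 : ∀ k : Fin n, MeasurableSet {v : Fin n → ℂ | v k = 0} := fun k =>
      measurableSet_eq_fun (measurable_pi_apply k) measurable_const
    have : {v : Fin n → ℂ | v i ≠ 0 ∧ ∀ k < i, v k = 0} =
        {v | v i = 0}ᶜ ∩ ⋂ k, ⋂ (_ : k < i), {v | v k = 0} := by
      ext v; simp
    change MeasurableSet {v : Fin n → ℂ | v i ≠ 0 ∧ ∀ k < i, v k = 0}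
    rw [this]
    exact (h1 i).compl.inter (MeasurableSet.iInter fun k => MeasurableSet.iInter fun _ => h1 k)
  · have h1 : Measurable fun v : Fin n → ℂ => v i := measurable_pi_apply i
    have h2 : Measurable fun v : Fin n → ℂ => (‖v i‖ : ℂ) :=
      Complex.measurable_ofReal.comp h1.norm
    exact (continuous_star.measurable.comp h1).div h2

/-- A diagonal unitary matrix. -/
noncomputable def diagUnitary (v : Fin n → ℂ) (hv : ∀ i, ‖v i‖ = 1) :
    Matrix.unitaryGroup (Fin n) ℂ :=
  ⟨Matrix.diagonal v, by
    rw [Matrix.mem_unitaryGroup_iff, Matrix.star_eq_conjTranspose, Matrix.diagonal_conjTranspose,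
      Matrix.diagonal_mul_diagonal, ← Matrix.diagonal_one]
    congr 1
    funext i
    rw [Pi.star_apply, Complex.star_def, Complex.mul_conj, Complex.normSq_eq_norm_sq, hv i]
    simp⟩

lemma diagUnitary_mem (v : Fin n → ℂ) (hv : ∀ i, ‖v i‖ = 1) : diagUnitary v hv ∈ diagTorus n :=
  Matrix.isDiag_diagonal v

lemma exists_of_mem_diagTorus {t : Matrix.unitaryGroup (Fin n) ℂ} (ht : t ∈ diagTorus n) :
    (∀ i, ‖t.1 i i‖ = 1) ∧ t.1 = Matrix.diagonal fun i => t.1 i i := by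
  have hd : t.1.IsDiag := ht
  refine ⟨fun i => ?_, hd.diagonal_diag.symm⟩
  have h := congrFun (congrFun (unitary_mul_conjTranspose t) i) i
  rw [← hd.diagonal_diag, Matrix.diagonal_conjTranspose, Matrix.diagonal_mul_diagonal,
    Matrix.diagonal_apply_eq, Matrix.one_apply_eq, Pi.star_apply, Complex.star_def,
    Complex.mul_conj, Complex.normSq_eq_norm_sq] at h
  have h2 : ‖t.1 i i‖ ^ 2 = 1 := by exact_mod_cast h
  exact (pow_eq_one_iff_of_nonneg (norm_nonneg _) two_ne_zero).1 h2

lemma unitary_col_ne_zero (U : Matrix.unitaryGroup (Fin n) ℂ) (j : Fin n) :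
    (fun i => U.1 i j) ≠ 0 := by
  intro h
  have := congrFun (congrFun (unitary_conjTranspose_mul U) j) j
  rw [Matrix.mul_apply, Matrix.one_apply_eq] at this
  have h2 : ∀ i, U.1 i j = 0 := fun i => congrFun h i
  simp [h2] at this

/-- Multiply each column by the phase that makes its first nonzero entry positive. -/
noncomputable def normalizeCols (U : Matrix.unitaryGroup (Fin n) ℂ) :
    Matrix.unitaryGroup (Fin n) ℂ :=
  U * diagUnitary (fun j => colPhase fun i => U.1 i j)
    fun j => norm_colPhase (unitary_col_ne_zero U j)

lemma normalizeCols_apply (U : Matrix.unitaryGroup (Fin n) ℂ) (i j : Fin n) :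
    (normalizeCols U).1 i j = U.1 i j * colPhase fun i => U.1 i j := by
  change (U.1 * Matrix.diagonal fun j => colPhase fun i => U.1 i j : Matrix _ _ ℂ) i j = _
  rw [Matrix.mul_diagonal]

lemma normalizeCols_mul (U t : Matrix.unitaryGroup (Fin n) ℂ) (ht : t ∈ diagTorus n) :
    normalizeCols (U * t) = normalizeCols U := by
  obtain ⟨h1, h2⟩ := exists_of_mem_diagTorus ht
  have h3 : ∀ i j, (U * t).1 i j = U.1 i j * t.1 j j := fun i j => by
    change (U.1 * t.1) i j = _
    rw [h2, Matrix.mul_diagonal, ← h2]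
  refine Subtype.ext (Matrix.ext fun i j => ?_)
  rw [normalizeCols_apply, normalizeCols_apply]
  simp only [h3]
  rw [colPhase_mul (h1 j)]
  have h4 : t.1 j j * star (t.1 j j) = 1 := by
    rw [Complex.star_def, Complex.mul_conj, Complex.normSq_eq_norm_sq, h1 j]; simp
  linear_combination (U.1 i j * colPhase fun i => U.1 i j) * h4

lemma measurable_normalizeCols : Measurable (normalizeCols (n := n)) := by
  rw [measurable_unitary_iff]
  intro i j
  simp only [normalizeCols_apply]
  have h1 : ∀ i j, Measurable fun U : Matrix.unitaryGroup (Fin n) ℂ => U.1 i j :=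
    fun i j => (continuous_entry i j).measurable
  exact (h1 i j).mul (measurable_colPhase.comp (measurable_pi_lambda _ fun k => h1 k j))

lemma mk_normalizeCols (U : Matrix.unitaryGroup (Fin n) ℂ) :
    (QuotientGroup.mk (normalizeCols U) : FlagSpace n) = QuotientGroup.mk U :=
  QuotientGroup.mk_mul_of_mem U (diagUnitary_mem _ _)

/-- Normalizing the columns gives a measurable map on `U(n)` that is constant on classes and stays
within each class, so it descends to the quotient. -/
lemma exists_isSection (n : ℕ) :
    ∃ s : FlagSpace n → Matrix.unitaryGroup (Fin n) ℂ, IsSection s := by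
  let s : FlagSpace n → Matrix.unitaryGroup (Fin n) ℂ := fun u => normalizeCols (Quotient.out u)
  have hs : ∀ U : Matrix.unitaryGroup (Fin n) ℂ, s (QuotientGroup.mk U) = normalizeCols U := by
    intro U
    have h : (QuotientGroup.mk U : FlagSpace n) =
        QuotientGroup.mk (Quotient.out (QuotientGroup.mk U : FlagSpace n)) :=
      (QuotientGroup.out_eq' _).symm
    have h2 := QuotientGroup.eq.1 h
    have := normalizeCols_mul U _ h2
    rw [mul_inv_cancel_left] at this
    exact this
  refine ⟨s, ?_, fun u => ?_⟩
  · rw [QuotientGroup.measurable_from_quotient]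
    have : s ∘ QuotientGroup.mk = normalizeCols := funext hs
    rw [this]
    exact measurable_normalizeCols
  · change QuotientGroup.mk (normalizeCols _) = u
    rw [mk_normalizeCols]
    exact QuotientGroup.out_eq' u

lemma IsSection.measurableEmbedding {s : FlagSpace n → Matrix.unitaryGroup (Fin n) ℂ}
    (hs : IsSection s) : MeasurableEmbedding s := by
  refine MeasurableEmbedding.of_measurable_inverse (g := QuotientGroup.mk) hs.1 ?_ measurable_mk
    hs.2
  have : Set.range s = {U | s (QuotientGroup.mk U) = U} := by
    ext U
    constructor
    · rintro ⟨u, rfl⟩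
      exact congrArg s (hs.2 u)
    · exact fun h => ⟨_, h⟩
  rw [this]
  exact measurableSet_eq_fun (hs.1.comp measurable_mk) measurable_id

/-- A section identifies the quotient with a Borel subset of `U(n)`. Standardness is what makes
injective measurable images of sets of parameters measurable. -/
instance : StandardBorelSpace (FlagSpace n) := by
  obtain ⟨s, hs⟩ := exists_isSection n
  have h := hs.measurableEmbedding
  have : StandardBorelSpace (Set.range s) := h.measurableSet_range.standardBorel
  obtain ⟨τ, hτ, hτ'⟩ := this.polish
  refine ⟨τ.induced h.equivRange, @BorelSpace.mk _ (τ.induced h.equivRange) _ ?_,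
    h.equivRange.toEquiv.polishSpace_induced⟩
  rw [borel_comap, ← hτ.measurable_eq]
  exact h.equivRange.measurableEmbedding.comap_eq.symm

end Section

/-! ### Uniqueness of the invariant measure -/

section Invariance

lemma haarU_preimage_mul_left (g : Matrix.unitaryGroup (Fin n) ℂ)
    (N : Set (Matrix.unitaryGroup (Fin n) ℂ)) : haarU n ((g * ·) ⁻¹' N) = haarU n N :=
  measure_preimage_mul _ _ _

lemma mk_mul (g U : Matrix.unitaryGroup (Fin n) ℂ) :
    (QuotientGroup.mk (g * U) : FlagSpace n) = g • (QuotientGroup.mk U : FlagSpace n) := rfl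

lemma measurable_smul_flag :
    Measurable fun p : Matrix.unitaryGroup (Fin n) ℂ × FlagSpace n => p.1 • p.2 := by
  obtain ⟨s, hs⟩ := exists_isSection n
  have h : (fun p : Matrix.unitaryGroup (Fin n) ℂ × FlagSpace n => p.1 • p.2) =
      fun p => QuotientGroup.mk (p.1 * s p.2) := by
    funext p
    rw [mk_mul, hs.2]
  rw [h]
  exact measurable_mk.comp (measurable_fst.mul (hs.1.comp measurable_snd))

lemma nu_preimage_smul (g : Matrix.unitaryGroup (Fin n) ℂ) {N : Set (FlagSpace n)}
    (hN : MeasurableSet N) : nu n ((g • ·) ⁻¹' N) = nu n N := by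
  have h1 : Measurable fun u : FlagSpace n => g • u :=
    measurable_smul_flag.comp measurable_prodMk_left
  have h2 : QuotientGroup.mk ⁻¹' ((g • ·) ⁻¹' N) =
      (g * ·) ⁻¹' ((QuotientGroup.mk : _ → FlagSpace n) ⁻¹' N) := by
    ext U
    simp only [Set.mem_preimage, mk_mul]
  rw [nu, Measure.map_apply measurable_mk (h1 hN), Measure.map_apply measurable_mk hN, h2,
    haarU_preimage_mul_left]

/-- A finite invariant measure on the flag space is a multiple of `nu`. -/
lemma eq_smul_nu_of_invariant (m : Measure (FlagSpace n)) [IsFiniteMeasure m]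
    (hm : ∀ (g : Matrix.unitaryGroup (Fin n) ℂ) (N : Set (FlagSpace n)), MeasurableSet N →
      m ((g • ·) ⁻¹' N) = m N) {N : Set (FlagSpace n)} (hN : MeasurableSet N) :
    m N = m Set.univ * nu n N := by
  -- Compute the product measure of `{(g, u) | g⁻¹ u ∈ N}` in both orders. Invariance of `m` yields
  -- `m N`. Transitivity of the action and invariance of Haar measure yield the total mass of `m`
  -- times a number independent of `m`, which the case `m = ν` identifies.
  suffices h : ∀ (m : Measure (FlagSpace n)) [IsFiniteMeasure m],
      (∀ (g : Matrix.unitaryGroup (Fin n) ℂ) (N : Set (FlagSpace n)), MeasurableSet N →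
        m ((g • ·) ⁻¹' N) = m N) →
      m N = m Set.univ * haarU n {g | g⁻¹ • (QuotientGroup.mk 1 : FlagSpace n) ∈ N} by
    have h1 := h (nu n) fun g N hN => nu_preimage_smul g hN
    rw [measure_univ, one_mul] at h1
    rw [h m hm, ← h1]
  intro m _ hm
  have hmeas : MeasurableSet {p : Matrix.unitaryGroup (Fin n) ℂ × FlagSpace n | p.1⁻¹ • p.2 ∈ N} :=
    (measurable_smul_flag.comp (measurable_fst.inv.prodMk measurable_snd)) hN
  have h1 : ((haarU n).prod m) {p | p.1⁻¹ • p.2 ∈ N} = m N := by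
    rw [Measure.prod_apply hmeas]
    have : ∀ g : Matrix.unitaryGroup (Fin n) ℂ,
        m (Prod.mk g ⁻¹' {p | p.1⁻¹ • p.2 ∈ N}) = m N := fun g => hm g⁻¹ N hN
    rw [lintegral_congr this, lintegral_const, measure_univ, mul_one]
  have h2 : ((haarU n).prod m) {p | p.1⁻¹ • p.2 ∈ N} =
      m Set.univ * haarU n {g | g⁻¹ • (QuotientGroup.mk 1 : FlagSpace n) ∈ N} := by
    rw [Measure.prod_apply_symm hmeas]
    have : ∀ u : FlagSpace n, haarU n ((fun g => (g, u)) ⁻¹'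
        {p : Matrix.unitaryGroup (Fin n) ℂ × FlagSpace n | p.1⁻¹ • p.2 ∈ N}) =
        haarU n {g | g⁻¹ • (QuotientGroup.mk 1 : FlagSpace n) ∈ N} := by
      intro u
      obtain ⟨U, rfl⟩ := QuotientGroup.mk_surjective u
      rw [← haarU_preimage_mul_left U]
      congr 1
      ext g
      have h3 : (U * g)⁻¹ • (QuotientGroup.mk U : FlagSpace n) =
          g⁻¹ • (QuotientGroup.mk 1 : FlagSpace n) := by
        rw [← mk_mul, ← mk_mul, mul_inv_rev, inv_mul_cancel_right, mul_one]
      simp only [Set.mem_preimage, Set.mem_ofPred_eq, h3]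
    rw [lintegral_congr this, lintegral_const, mul_comm]
  rw [← h1, h2]

end Invariance

/-! ### The exponential as a local chart of the quotient -/

section LocalStructure

/-- The upper triangular matrix with given entries. -/
noncomputable def upperLin (n : ℕ) :
    ({p : Fin n × Fin n // p.1 ≤ p.2} → ℂ) →ₗ[ℝ] Matrix (Fin n) (Fin n) ℂ where
  toFun b := Matrix.of fun i j => if h : i ≤ j then b ⟨(i, j), h⟩ else 0
  map_add' a b := by
    ext i j
    by_cases h : i ≤ j <;> simp [h]
  map_smul' c b := by
    ext i j
    by_cases h : i ≤ j <;> simp [h]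

lemma upperLin_blockTriangular (b : {p : Fin n × Fin n // p.1 ≤ p.2} → ℂ) :
    (upperLin n b).BlockTriangular id := fun i j h => by
  simp [upperLin, not_le.2 (show j < i from h)]

lemma eq_upperLin {M : Matrix (Fin n) (Fin n) ℂ} (hM : M.BlockTriangular id) :
    M = upperLin n fun p => M p.1.1 p.1.2 := by
  ext i j
  by_cases h : i ≤ j
  · simp [upperLin, h]
  · simp [upperLin, h, hM (not_le.1 h)]

open scoped Matrix.Norms.Operator

/-- The map `(S, b) ↦ e^S (1 + R)` with `R` upper triangular. -/
noncomputable def expUpper (n : ℕ)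
    (x : skewOff n × ({p : Fin n × Fin n // p.1 ≤ p.2} → ℂ)) : Matrix (Fin n) (Fin n) ℂ :=
  NormedSpace.exp (skewMat x.1) * (1 + upperLin n x.2)

/-- The derivative of `expUpper` at the origin. -/
noncomputable def expUpperDeriv (n : ℕ) :
    skewOff n × ({p : Fin n × Fin n // p.1 ≤ p.2} → ℂ) →L[ℝ] Matrix (Fin n) (Fin n) ℂ :=
  LinearMap.toContinuousLinearMap ((skewMatLin n).coprod (upperLin n))

lemma hasStrictFDerivAt_expUpper : HasStrictFDerivAt (expUpper n) (expUpperDeriv n) 0 := by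
  have h1 := hasStrictFDerivAt_exp_comp
    (ContinuousLinearMap.fst ℝ (skewOff n) ({p : Fin n × Fin n // p.1 ≤ p.2} → ℂ)) 0 rfl
  have h2 : HasStrictFDerivAt (fun x : skewOff n × ({p : Fin n × Fin n // p.1 ≤ p.2} → ℂ) =>
      1 + upperLin n x.2) ((LinearMap.toContinuousLinearMap (upperLin n)).comp
        (ContinuousLinearMap.snd ℝ (skewOff n) ({p : Fin n × Fin n // p.1 ≤ p.2} → ℂ))) 0 :=
    ((LinearMap.toContinuousLinearMap (upperLin n)).comp (ContinuousLinearMap.snd ℝ (skewOff n)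
      ({p : Fin n × Fin n // p.1 ≤ p.2} → ℂ))).hasStrictFDerivAt.const_add
        (1 : Matrix (Fin n) (Fin n) ℂ)
  refine (h1.mul' h2).congr_fderiv ?_
  refine ContinuousLinearMap.ext fun x => ?_
  have e0 : NormedSpace.exp (skewMat (0 : skewOff n)) = 1 := congrArg Subtype.val expU_zero
  change NormedSpace.exp (skewMat (0 : skewOff n)) * upperLin n x.2 +
    skewMat x.1 * (1 + upperLin n 0) = skewMat x.1 + upperLin n x.2
  rw [e0, map_zero, add_zero, one_mul, mul_one, add_comm]

lemma expUpperDeriv_apply (x : skewOff n × ({p : Fin n × Fin n // p.1 ≤ p.2} → ℂ)) :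
    expUpperDeriv n x = skewMat x.1 + upperLin n x.2 := rfl

lemma eq_zero_of_skewMat_blockTriangular {S : skewOff n} (h : (skewMat S).BlockTriangular id) :
    S = 0 := by
  ext ⟨i, j⟩
  change S.1 (i, j) = 0
  rcases lt_trichotomy i j with hij | hij | hij
  · have h5 : S.1 (j, i) = 0 := h (i := j) (j := i) hij
    rw [S.2.1 i j, h5]; simp
  · subst hij; exact S.2.2 i
  · exact h hij

/-- The zero-diagonal skew-Hermitian matrices and the complex upper triangular ones are
complementary real subspaces: the entries below the diagonal determine the skew summand, and a
triangular skew summand vanishes. -/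
lemma expUpperDeriv_injective : Function.Injective (expUpperDeriv n) := by
  rw [injective_iff_map_eq_zero]
  rintro ⟨S, b⟩ h
  rw [expUpperDeriv_apply] at h
  have hS : S = 0 := by
    refine eq_zero_of_skewMat_blockTriangular ?_
    rw [eq_neg_of_add_eq_zero_left h]
    exact (upperLin_blockTriangular b).neg
  subst hS
  have h0 : skewMat (0 : skewOff n) = 0 := map_zero (skewMatLin n)
  rw [h0, zero_add] at h
  refine Prod.ext rfl (funext fun p => ?_)
  have := congrFun (congrFun h p.1.1) p.1.2
  simpa [upperLin, p.2] using this

lemma expUpperDeriv_surjective : Function.Surjective (expUpperDeriv n) := by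
  intro M
  let S : skewOff n := (skewEquiv n).symm fun p => -star (M p.1.2 p.1.1)
  have hS : ∀ p : UpperIdx n, S.1 p.1 = -star (M p.1.2 p.1.1) := fun p =>
    congrFun ((skewEquiv n).apply_symm_apply _) p
  have hb : (M - skewMat S).BlockTriangular id := by
    intro i j hij
    have h1 := S.2.1 i j
    rw [hS ⟨(j, i), hij⟩] at h1
    have h2 : skewMat S i j = M i j := by
      change S.1 (i, j) = _
      rw [h1]
      simp
    rw [Matrix.sub_apply, h2, sub_self]
  refine ⟨(S, fun p => (M - skewMat S) p.1.1 p.1.2), ?_⟩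
  rw [expUpperDeriv_apply, ← eq_upperLin hb]
  simp

/-- Small exponentials of zero-diagonal skew-Hermitian matrices lie in distinct classes. -/
lemma exists_expU_injOn (n : ℕ) : ∃ ε > 0, ∀ S S' : skewOff n, ‖S‖ < ε → ‖S'‖ < ε →
    (expU S')⁻¹ * expU S ∈ diagTorus n → S = S' := by
  obtain ⟨K, s, hs, hK⟩ := hasStrictFDerivAt_expUpper.exists_antilipschitzOn
    (expUpperDeriv_injective (n := n))
  have hinj : ∀ x ∈ s, ∀ y ∈ s, expUpper n x = expUpper n y → x = y := by
    intro x hx y hy hxy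
    have := hK x hx y hy
    rw [hxy, edist_self, mul_zero] at this
    exact edist_le_zero.1 this
  let t : skewOff n × skewOff n → Matrix.unitaryGroup (Fin n) ℂ :=
    fun q => (expU q.2)⁻¹ * expU q.1
  have ht : Continuous t := (continuous_expU.comp continuous_snd).inv.mul
    (continuous_expU.comp continuous_fst)
  have ht0 : t 0 = 1 := by
    change (expU (0 : skewOff n))⁻¹ * expU (0 : skewOff n) = 1
    simp
  -- If `t = (e^{S'})⁻¹ e^S` is diagonal, then `e^S = e^{S'} (1 + (t - 1))`, so `expUpper` agrees at
  -- `g (S, S')` and `f (S, S')`. Both points are near the origin when `S` and `S'` are small, and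
  -- `expUpper` is injective there.
  let f : skewOff n × skewOff n → skewOff n × ({p : Fin n × Fin n // p.1 ≤ p.2} → ℂ) :=
    fun q => (q.2, fun p => (t q).1 p.1.1 p.1.2 - (1 : Matrix (Fin n) (Fin n) ℂ) p.1.1 p.1.2)
  have hf : Continuous f := by
    refine continuous_snd.prodMk (continuous_pi fun p => ?_)
    exact ((continuous_entry p.1.1 p.1.2).comp ht).sub continuous_const
  have hf0 : f 0 = 0 := by
    refine Prod.ext rfl (funext fun p => ?_)
    simp [f, ht0]
  let g : skewOff n × skewOff n → skewOff n × ({p : Fin n × Fin n // p.1 ≤ p.2} → ℂ) :=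
    fun q => (q.1, 0)
  have hg : Continuous g := continuous_fst.prodMk continuous_const
  have hmem : f ⁻¹' s ∩ g ⁻¹' s ∈ 𝓝 (0 : skewOff n × skewOff n) := by
    refine Filter.inter_mem (hf.continuousAt.preimage_mem_nhds ?_)
      (hg.continuousAt.preimage_mem_nhds ?_)
    · rw [hf0]; exact hs
    · exact hs
  obtain ⟨ε, hε, hsub⟩ := Metric.mem_nhds_iff.1 hmem
  refine ⟨ε, hε, fun S S' hS hS' hT => ?_⟩
  have hq : (S, S') ∈ Metric.ball (0 : skewOff n × skewOff n) ε := by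
    rw [mem_ball_zero_iff, Prod.norm_def]
    exact max_lt hS hS'
  have h1 := hsub hq
  have hb : ((t (S, S')).1 - 1).BlockTriangular id :=
    (blockTriangular_of_isDiag hT).sub Matrix.blockTriangular_one
  have h2 : expUpper n (g (S, S')) = expUpper n (f (S, S')) := by
    have h3 : upperLin n (f (S, S')).2 = (t (S, S')).1 - 1 := (eq_upperLin hb).symm
    rw [expUpper, expUpper, h3]
    change (expU S).1 * (1 + upperLin n 0) = (expU S').1 * (1 + ((t (S, S')).1 - 1))
    rw [map_zero, add_zero, mul_one, add_sub_cancel]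
    change (expU S).1 = (expU S' * ((expU S')⁻¹ * expU S)).1
    rw [mul_inv_cancel_left]
  exact congrArg Prod.fst (hinj _ h1.2 _ h1.1 h2)

lemma mem_expBall {ε : ℝ} {u : FlagSpace n} :
    u ∈ expBall n ε ↔ ∃ S : skewOff n, ‖S‖ < ε ∧ u = QuotientGroup.mk (expU S) := by
  constructor
  · rintro ⟨S, U, hS, hU, rfl⟩
    exact ⟨S, hS, congrArg _ (Subtype.ext hU)⟩
  · rintro ⟨S, hS, rfl⟩
    exact ⟨S, expU S, hS, rfl, rfl⟩

/-- The classes of small exponentials form a neighborhood of the base point. -/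
lemma preimage_expBall_mem_nhds {ε : ℝ} (hε : 0 < ε) :
    (QuotientGroup.mk : Matrix.unitaryGroup (Fin n) ℂ → FlagSpace n) ⁻¹' expBall n ε ∈ 𝓝 1 := by
  -- Surjectivity of the derivative makes every `U` near `1` of the form `e^S (1 + R)` with small
  -- `S` and triangular `R`. Then `(e^S)⁻¹ U` is triangular and unitary, hence in the torus.
  have h1 := (hasStrictFDerivAt_expUpper (n := n)).map_nhds_eq_of_surj
    (LinearMap.range_eq_top.2 expUpperDeriv_surjective)
  have h0 : expUpper n 0 = 1 := by
    have e0 : NormedSpace.exp (skewMat (0 : skewOff n)) = 1 := congrArg Subtype.val expU_zero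
    change NormedSpace.exp (skewMat (0 : skewOff n)) * (1 + upperLin n 0) = 1
    rw [e0, map_zero, add_zero, one_mul]
  rw [h0] at h1
  have h2 : {x : skewOff n × ({p : Fin n × Fin n // p.1 ≤ p.2} → ℂ) | ‖x.1‖ < ε} ∈
      𝓝 (0 : skewOff n × ({p : Fin n × Fin n // p.1 ≤ p.2} → ℂ)) :=
    (isOpen_lt (continuous_fst.norm) continuous_const).mem_nhds (by simpa using hε)
  have h3 := Filter.image_mem_map (m := expUpper n) h2
  rw [h1] at h3
  have h4 : Filter.Tendsto (fun U : Matrix.unitaryGroup (Fin n) ℂ => U.1) (𝓝 1) (𝓝 1) :=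
    continuous_subtype_val.tendsto' _ _ rfl
  filter_upwards [h4 h3] with U hU
  obtain ⟨⟨S, b⟩, hS, hx⟩ := hU
  have hSx : (expU S).1 * (1 + upperLin n b) = U.1 := hx
  refine mem_expBall.2 ⟨S, hS, ?_⟩
  have ht : ((expU S)⁻¹ * U).1 = 1 + upperLin n b := by
    change (expU S).1ᴴ * U.1 = _
    rw [← hSx, ← Matrix.mul_assoc, unitary_conjTranspose_mul, Matrix.one_mul]
  have hT : (expU S)⁻¹ * U ∈ diagTorus n := by
    refine isDiag_of_blockTriangular_unitary _ ?_
    rw [ht]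
    exact Matrix.blockTriangular_one.add (upperLin_blockTriangular b)
  exact (QuotientGroup.eq.2 hT).symm

lemma isClosed_diagTorus (n : ℕ) : IsClosed (diagTorus n : Set (Matrix.unitaryGroup (Fin n) ℂ)) := by
  have : (diagTorus n : Set (Matrix.unitaryGroup (Fin n) ℂ)) =
      ⋂ i, ⋂ j, ⋂ (_ : i ≠ j), {U | U.1 i j = 0} := by
    ext U
    simp only [Set.mem_iInter, Set.mem_ofPred_eq]
    exact ⟨fun h i j hij => h hij, fun h i j hij => h i j hij⟩
  rw [this]
  exact isClosed_iInter fun i => isClosed_iInter fun j => isClosed_iInter fun _ =>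
    isClosed_eq (continuous_entry i j) continuous_const

/-- The preimage in `U(n)` is a countable union of compact sets: images of closed balls times the
compact torus. -/
lemma measurableSet_expBall (n : ℕ) (ε : ℝ) : MeasurableSet (expBall n ε) := by
  rw [measurableSet_flag]
  have h : (QuotientGroup.mk : Matrix.unitaryGroup (Fin n) ℂ → FlagSpace n) ⁻¹' expBall n ε =
      ⋃ k : ℕ, (fun p : skewOff n × Matrix.unitaryGroup (Fin n) ℂ => expU p.1 * p.2) ''
        (Metric.closedBall 0 (ε - 1 / (k + 1)) ×ˢ (diagTorus n : Set _)) := by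
    ext U
    rw [Set.mem_preimage, mem_expBall, Set.mem_iUnion]
    constructor
    · rintro ⟨S, hS, hU⟩
      obtain ⟨k, hk⟩ := exists_nat_one_div_lt (sub_pos.2 hS)
      refine ⟨k, (S, (expU S)⁻¹ * U), ⟨?_, QuotientGroup.eq.1 hU.symm⟩, by simp⟩
      rw [mem_closedBall_zero_iff]
      linarith
    · rintro ⟨k, ⟨S, t⟩, ⟨hS, ht⟩, rfl⟩
      rw [mem_closedBall_zero_iff] at hS
      refine ⟨S, ?_, QuotientGroup.mk_mul_of_mem _ ht⟩
      have : (0 : ℝ) < 1 / (k + 1) := Nat.one_div_pos_of_nat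
      linarith
  rw [h]
  refine MeasurableSet.iUnion fun k => IsCompact.measurableSet ?_
  refine ((isCompact_closedBall _ _).prod (isClosed_diagTorus n).isCompact).image ?_
  exact (continuous_expU.comp continuous_fst).mul continuous_snd

end LocalStructure

end CommTuple

lemma ContinuousLinearMap.normDet_eq_of_intertwine {U W : Type*} [NormedAddCommGroup U]
    [InnerProductSpace ℝ U] [FiniteDimensional ℝ U] [NormedAddCommGroup W] [InnerProductSpace ℝ W]
    (f f' : U →L[ℝ] W) (T : U →ₗᵢ[ℝ] U) (u : W →ₗᵢ[ℝ] W) (h : ∀ y, f' (T y) = u (f y)) :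
    ContinuousLinearMap.normDet f' = ContinuousLinearMap.normDet f := by
  have h0 : f'.toLinearMap ∘ₗ T.toLinearMap = u.toLinearMap ∘ₗ f.toLinearMap := LinearMap.ext h
  have h1 := LinearMap.normDet_comp_of_finrank_eq T.toLinearMap f'.toLinearMap rfl
  have h2 := LinearMap.normDet_comp f.toLinearMap u.toLinearMap
  have h4 : (u.toLinearMap.domRestrict f.toLinearMap.range).normDet = 1 :=
    (u.comp f.toLinearMap.range.subtypeₗᵢ).normDet_eq_one
  rw [h0, h2, h4, T.normDet_eq_one, one_mul, mul_one] at h1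
  exact h1.symm

namespace CommTuple

variable {d n : ℕ}

/-! ### Conjugation by unitaries as an isometry -/

section UnitaryAction

lemma sum_norm_sq_eq_trace (M : Matrix (Fin n) (Fin n) ℂ) :
    ((∑ i, ∑ j, ‖M i j‖ ^ 2 : ℝ) : ℂ) = (Mᴴ * M).trace := by
  rw [Matrix.trace, Finset.sum_comm]
  push_cast
  refine Finset.sum_congr rfl fun j _ => ?_
  rw [Matrix.diag_apply, Matrix.mul_apply]
  refine Finset.sum_congr rfl fun i _ => ?_
  rw [Matrix.conjTranspose_apply, Complex.star_def, Complex.conj_mul']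

lemma norm_sq_eq_sum_comp (X : MatTuple d n) :
    ‖X‖ ^ 2 = ∑ r, ∑ i, ∑ j, ‖comp X r i j‖ ^ 2 := by
  rw [EuclideanSpace.norm_sq_eq, Fintype.sum_prod_type]
  refine Finset.sum_congr rfl fun r _ => ?_
  rw [Fintype.sum_prod_type]
  rfl

/-- Conjugation by a unitary as a complex linear map. -/
noncomputable def uconjLin (U : Matrix.unitaryGroup (Fin n) ℂ) : MatTuple d n →ₗ[ℂ] MatTuple d n where
  toFun := uconj U
  map_add' X Y := matTuple_ext fun r => by
    have h : comp (uconj U X + uconj U Y) r = comp (uconj U X) r + comp (uconj U Y) r := rfl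
    have h' : comp (X + Y) r = comp X r + comp Y r := rfl
    rw [h, comp_uconj, comp_uconj, comp_uconj, h', Matrix.mul_add, Matrix.add_mul]
  map_smul' c X := matTuple_ext fun r => by
    have h : comp (c • uconj U X) r = c • comp (uconj U X) r := rfl
    have h' : comp (c • X) r = c • comp X r := rfl
    rw [RingHom.id_apply, h, comp_uconj, comp_uconj, h', Matrix.mul_smul, Matrix.smul_mul]

lemma norm_uconj (U : Matrix.unitaryGroup (Fin n) ℂ) (X : MatTuple d n) : ‖uconj U X‖ = ‖X‖ := by
  rw [← sq_eq_sq₀ (norm_nonneg _) (norm_nonneg _), norm_sq_eq_sum_comp, norm_sq_eq_sum_comp]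
  refine Finset.sum_congr rfl fun r _ => Complex.ofReal_injective ?_
  rw [sum_norm_sq_eq_trace, sum_norm_sq_eq_trace, comp_uconj, Matrix.conjTranspose_mul,
    Matrix.conjTranspose_mul, Matrix.conjTranspose_conjTranspose]
  have h := unitary_conjTranspose_mul U
  calc (U.1 * ((comp X r)ᴴ * U.1ᴴ) * (U.1 * comp X r * U.1ᴴ)).trace
      = (U.1 * ((comp X r)ᴴ * (U.1ᴴ * U.1) * comp X r * U.1ᴴ)).trace := by
        simp only [Matrix.mul_assoc]
    _ = ((comp X r)ᴴ * comp X r).trace := by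
        rw [h, Matrix.mul_one, Matrix.trace_mul_comm, Matrix.mul_assoc, h, Matrix.mul_one]

/-- Conjugation by a unitary as a complex linear isometry. -/
noncomputable def uconjIso (U : Matrix.unitaryGroup (Fin n) ℂ) : MatTuple d n →ₗᵢ[ℂ] MatTuple d n :=
  ⟨uconjLin U, norm_uconj U⟩

/-- Conjugation by a unitary as a real linear isometry. -/
noncomputable def uconjRealIso (U : Matrix.unitaryGroup (Fin n) ℂ) :
    MatTuple d n →ₗᵢ[ℝ] MatTuple d n :=
  ⟨(uconjLin U).restrictScalars ℝ, norm_uconj U⟩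

lemma isometry_uconj (U : Matrix.unitaryGroup (Fin n) ℂ) :
    Isometry (uconj U : MatTuple d n → MatTuple d n) := (uconjIso U).isometry

lemma uconj_injective (U : Matrix.unitaryGroup (Fin n) ℂ) :
    Function.Injective (uconj U : MatTuple d n → MatTuple d n) := (isometry_uconj U).injective

lemma continuous_uconj_of {α : Type*} [TopologicalSpace α]
    {f : α → Matrix.unitaryGroup (Fin n) ℂ} {g : α → MatTuple d n} (hf : Continuous f)
    (hg : Continuous g) : Continuous fun x => uconj (f x) (g x) := by
  refine (PiLp.continuous_toLp 2 _).comp (continuous_pi fun k => ?_)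
  have h1 : Continuous fun x => (f x).1 := continuous_subtype_val.comp hf
  have h2 : Continuous fun x => comp (g x) k.1 := (continuous_comp k.1).comp hg
  exact ((h1.mul h2).mul h1.matrix_conjTranspose).matrix_elem k.2.1 k.2.2

lemma measurable_uconj_of {α : Type*} [MeasurableSpace α]
    {f : α → Matrix.unitaryGroup (Fin n) ℂ} {g : α → MatTuple d n} (hf : Measurable f)
    (hg : Measurable g) : Measurable fun x => uconj (f x) (g x) := by
  have h : Continuous fun p : Matrix.unitaryGroup (Fin n) ℂ × MatTuple d n => uconj p.1 p.2 :=
    continuous_uconj_of continuous_fst continuous_snd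
  have h2 : Measurable fun x => (f x, g x) := hf.prodMk hg
  have h3 := h.measurable.comp h2
  simp only [Function.comp_def] at h3
  exact h3

end UnitaryAction

/-! ### The torus acting on the triangular parameters -/

section TorusAction

/-- The action of the diagonal torus on the coordinates `(λ, A)` by conjugation of `A`. -/
noncomputable def torusAct (t : Matrix.unitaryGroup (Fin n) ℂ) : DiagUni d n →ₗ[ℂ] DiagUni d n where
  toFun x := WithLp.toLp 2 (Sum.elim (fun p => x (Sum.inl p))
    fun p => t.1 p.1.1 p.1.1 * star (t.1 p.1.2 p.1.2) * x (Sum.inr p))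
  map_add' x y := by
    ext k
    rcases k with k | k <;> simp [mul_add]
  map_smul' c x := by
    ext k
    rcases k with k | k <;> simp [mul_left_comm]

lemma lamOf_torusAct (t : Matrix.unitaryGroup (Fin n) ℂ) (x : DiagUni d n) :
    lamOf (torusAct t x) = lamOf x := rfl

lemma uppOf_torusAct (t : Matrix.unitaryGroup (Fin n) ℂ) (x : DiagUni d n) (p : UpperIdx n) :
    uppOf (torusAct t x) p = t.1 p.1.1 p.1.1 * star (t.1 p.1.2 p.1.2) * uppOf x p := rfl

lemma norm_torusAct {t : Matrix.unitaryGroup (Fin n) ℂ} (ht : t ∈ diagTorus n) (x : DiagUni d n) :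
    ‖torusAct t x‖ = ‖x‖ := by
  have h := (exists_of_mem_diagTorus ht).1
  rw [EuclideanSpace.norm_eq, EuclideanSpace.norm_eq]
  congr 1
  refine Finset.sum_congr rfl fun k _ => ?_
  rcases k with k | k
  · rfl
  · change ‖t.1 k.1.1 k.1.1 * star (t.1 k.1.2 k.1.2) * x (Sum.inr k)‖ ^ 2 = _
    rw [norm_mul, norm_mul, norm_star, h, h, one_mul, one_mul]

/-- The torus action as a real linear isometry. -/
noncomputable def torusIso {t : Matrix.unitaryGroup (Fin n) ℂ} (ht : t ∈ diagTorus n) :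
    DiagUni d n ≃ₗᵢ[ℝ] DiagUni d n :=
  LinearIsometry.toLinearIsometryEquiv
    (E₁ := DiagUni d n) (F := DiagUni d n) (R₁ := ℝ)
    ⟨(torusAct t).restrictScalars ℝ, norm_torusAct ht⟩ rfl

lemma measurePreserving_torusAct {t : Matrix.unitaryGroup (Fin n) ℂ} (ht : t ∈ diagTorus n) :
    MeasurePreserving (torusAct t : DiagUni d n → DiagUni d n) :=
  (torusIso (d := d) ht).measurePreserving

lemma unipotent_torusAct {t : Matrix.unitaryGroup (Fin n) ℂ} (ht : t ∈ diagTorus n)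
    (x : DiagUni d n) :
    unipotent (uppOf (torusAct t x)) = t.1 * unipotent (uppOf x) * t.1ᴴ := by
  obtain ⟨h1, h2⟩ := exists_of_mem_diagTorus ht
  rw [h2, Matrix.diagonal_conjTranspose]
  ext i j
  rw [Matrix.mul_diagonal, Matrix.diagonal_mul]
  rcases lt_trichotomy i j with h | h | h
  · simp only [unipotent, Matrix.of_apply, h, dite_true, uppOf_torusAct, Pi.star_apply]
    ring
  · subst h
    rw [unipotent_apply_self, unipotent_apply_self, Pi.star_apply, mul_one, Complex.star_def,
      Complex.mul_conj, Complex.normSq_eq_norm_sq, h1]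
    simp
  · simp [unipotent, h.not_gt, h.ne']

/-- As `t` commutes with `D`, conjugating `A D A⁻¹` by `t` amounts to replacing `A` by `t A t^*`. -/
lemma triParam_torusAct {t : Matrix.unitaryGroup (Fin n) ℂ} (ht : t ∈ diagTorus n)
    (x : DiagUni d n) :
    triParam d n (torusAct t x) = uconj t (triParam d n x) := by
  have h1 := unitary_conjTranspose_mul t
  refine matTuple_ext fun r => ?_
  have hD : t.1ᴴ * Matrix.diagonal (fun j => lamOf x j r) =
      Matrix.diagonal (fun j => lamOf x j r) * t.1ᴴ := by
    rw [(exists_of_mem_diagTorus ht).2, Matrix.diagonal_conjTranspose,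
      Matrix.diagonal_mul_diagonal, Matrix.diagonal_mul_diagonal]
    simp only [mul_comm]
  have hinv : (t.1 * unipotent (uppOf x) * t.1ᴴ)⁻¹ = t.1 * (unipotent (uppOf x))⁻¹ * t.1ᴴ := by
    refine Matrix.inv_eq_left_inv ?_
    calc t.1 * (unipotent (uppOf x))⁻¹ * t.1ᴴ * (t.1 * unipotent (uppOf x) * t.1ᴴ)
        = t.1 * ((unipotent (uppOf x))⁻¹ * (t.1ᴴ * t.1) * unipotent (uppOf x)) * t.1ᴴ := by
          simp only [Matrix.mul_assoc]
      _ = 1 := by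
          rw [h1, Matrix.mul_one, unipotent_inv_mul, Matrix.mul_one, unitary_mul_conjTranspose]
  rw [comp_uconj, triParam_eq, triParam_eq, comp_Ad, comp_Ad, comp_diagTuple, comp_diagTuple,
    unipotent_torusAct ht, lamOf_torusAct, hinv]
  calc t.1 * unipotent (uppOf x) * t.1ᴴ * Matrix.diagonal (fun j => lamOf x j r) *
        (t.1 * (unipotent (uppOf x))⁻¹ * t.1ᴴ)
      = t.1 * unipotent (uppOf x) * (t.1ᴴ * Matrix.diagonal (fun j => lamOf x j r)) *
        (t.1 * (unipotent (uppOf x))⁻¹ * t.1ᴴ) := by simp only [Matrix.mul_assoc]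
    _ = t.1 * unipotent (uppOf x) * Matrix.diagonal (fun j => lamOf x j r) * (t.1ᴴ * t.1) *
        ((unipotent (uppOf x))⁻¹ * t.1ᴴ) := by rw [hD]; simp only [Matrix.mul_assoc]
    _ = _ := by rw [h1]; simp only [Matrix.mul_assoc, Matrix.one_mul]

/-- Conjugation of zero-diagonal skew-Hermitian matrices by a diagonal matrix. -/
noncomputable def skewAct (t : Matrix.unitaryGroup (Fin n) ℂ) : skewOff n →ₗ[ℝ] skewOff n where
  toFun S := ⟨WithLp.toLp 2 fun p => t.1 p.1 p.1 * S.1 p * star (t.1 p.2 p.2), by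
    refine ⟨fun i j => ?_, fun i => ?_⟩
    · change t.1 i i * S.1 (i, j) * star (t.1 j j) = -star (t.1 j j * S.1 (j, i) * star (t.1 i i))
      rw [S.2.1 i j, star_mul', star_mul', star_star]
      ring
    · change t.1 i i * S.1 (i, i) * star (t.1 i i) = 0
      rw [S.2.2 i]; simp⟩
  map_add' S T := by
    refine Subtype.ext ?_
    ext p
    change t.1 p.1 p.1 * (S.1 p + T.1 p) * star (t.1 p.2 p.2) =
      t.1 p.1 p.1 * S.1 p * star (t.1 p.2 p.2) + t.1 p.1 p.1 * T.1 p * star (t.1 p.2 p.2)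
    ring
  map_smul' c S := by
    refine Subtype.ext ?_
    ext p
    change t.1 p.1 p.1 * ((c : ℂ) * S.1 p) * star (t.1 p.2 p.2) =
      (c : ℂ) * (t.1 p.1 p.1 * S.1 p * star (t.1 p.2 p.2))
    ring

lemma norm_skewAct {t : Matrix.unitaryGroup (Fin n) ℂ} (ht : t ∈ diagTorus n) (S : skewOff n) :
    ‖skewAct t S‖ = ‖S‖ := by
  have h := (exists_of_mem_diagTorus ht).1
  change ‖(skewAct t S).1‖ = ‖S.1‖
  rw [EuclideanSpace.norm_eq, EuclideanSpace.norm_eq]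
  congr 1
  refine Finset.sum_congr rfl fun k _ => ?_
  change ‖t.1 k.1 k.1 * S.1 k * star (t.1 k.2 k.2)‖ ^ 2 = _
  rw [norm_mul, norm_mul, norm_star, h, h, one_mul, mul_one]

lemma skewMat_skewAct {t : Matrix.unitaryGroup (Fin n) ℂ} (ht : t ∈ diagTorus n) (S : skewOff n) :
    skewMat (skewAct t S) = t.1 * skewMat S * t.1ᴴ := by
  rw [(exists_of_mem_diagTorus ht).2, Matrix.diagonal_conjTranspose]
  ext i j
  rw [Matrix.mul_diagonal, Matrix.diagonal_mul]
  simp [skewMat, skewAct]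

lemma ad_uconj_skewAct {t : Matrix.unitaryGroup (Fin n) ℂ} (ht : t ∈ diagTorus n)
    (Q : MatTuple d n) (S : skewOff n) :
    ad (uconj t Q) (skewAct t S) = uconj t (ad Q S) := by
  have h1 := unitary_conjTranspose_mul t
  have h2 : ∀ M N : Matrix (Fin n) (Fin n) ℂ,
      t.1 * M * t.1ᴴ * (t.1 * N * t.1ᴴ) = t.1 * (M * N) * t.1ᴴ := fun M N =>
    calc t.1 * M * t.1ᴴ * (t.1 * N * t.1ᴴ) = t.1 * M * (t.1ᴴ * t.1) * N * t.1ᴴ := by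
          simp only [Matrix.mul_assoc]
      _ = _ := by rw [h1, Matrix.mul_one]; simp only [Matrix.mul_assoc]
  refine matTuple_ext fun r => ?_
  rw [comp_ad, comp_uconj, comp_uconj, comp_ad, skewMat_skewAct ht, h2, h2, Matrix.mul_sub,
    Matrix.sub_mul]

lemma dTri_torusAct {t : Matrix.unitaryGroup (Fin n) ℂ} (ht : t ∈ diagTorus n)
    (x q : DiagUni d n) : dTri (torusAct t x) (torusAct t q) = uconj t (dTri x q) := by
  have hT := (LinearMap.toContinuousLinearMap (torusAct (d := d) t)).hasStrictFDerivAt (x := x)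
  have hU := (uconjIso (d := d) t).toContinuousLinearMap.hasStrictFDerivAt (x := triParam d n x)
  have h1 := (hasStrictFDerivAt_triParam (torusAct t x)).comp x hT
  have h2 := hU.comp x (hasStrictFDerivAt_triParam x)
  have h3 : (fun y => triParam d n (torusAct t y)) =
      fun y => (uconjIso (d := d) t).toContinuousLinearMap (triParam d n y) :=
    funext fun y => triParam_torusAct ht y
  simp only at h1
  rw [h3] at h1
  exact congrArg (fun L => L q) (h1.hasFDerivAt.unique h2.hasFDerivAt)

/-- The torus action on the domain of `tubeParam`, as a linear isometry. -/
noncomputable def tubeAct {t : Matrix.unitaryGroup (Fin n) ℂ} (ht : t ∈ diagTorus n) :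
    WithLp 2 (DiagUni d n × skewOff n) →ₗᵢ[ℝ] WithLp 2 (DiagUni d n × skewOff n) where
  toFun y := WithLp.toLp 2 (torusAct t y.fst, skewAct t y.snd)
  map_add' y z := WithLp.prod_ext (map_add (torusAct t) _ _) (map_add (skewAct t) _ _)
  map_smul' c y := WithLp.prod_ext (((torusAct t).restrictScalars ℝ).map_smul c y.fst)
    (map_smul (skewAct t) _ _)
  norm_map' y := by
    have h := WithLp.prod_norm_eq_of_L2 (α := DiagUni d n) (β := skewOff n)
    change ‖WithLp.toLp 2 (torusAct t y.fst, skewAct t y.snd)‖ = _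
    rw [h, h]
    change √(‖torusAct t y.fst‖ ^ 2 + ‖skewAct t y.snd‖ ^ 2) = _
    rw [norm_torusAct ht, norm_skewAct ht]

lemma tubeDeriv_torusAct {t : Matrix.unitaryGroup (Fin n) ℂ} (ht : t ∈ diagTorus n)
    (x : DiagUni d n) (y : WithLp 2 (DiagUni d n × skewOff n)) :
    tubeDeriv (torusAct t x) (tubeAct ht y) = uconj t (tubeDeriv x y) := by
  rw [tubeDeriv_apply, tubeDeriv_apply]
  have h : uconj t (dTri x y.fst - ad (triParam d n x) y.snd) =
      uconj t (dTri x y.fst) - uconj t (ad (triParam d n x) y.snd) := map_sub (uconjLin t) _ _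
  rw [h, ← dTri_torusAct ht, ← ad_uconj_skewAct ht, ← triParam_torusAct ht]
  rfl

/-- The derivatives at `x` and at its translate are intertwined by isometries of source and target.
So the freedom in choosing representatives modulo the torus does not affect the Jacobian. -/
lemma tubeJac_torusAct {t : Matrix.unitaryGroup (Fin n) ℂ} (ht : t ∈ diagTorus n)
    (x : DiagUni d n) : tubeJac (torusAct t x) = tubeJac x := by
  have h := ContinuousLinearMap.normDet_eq_of_intertwine
    (U := WithLp 2 (DiagUni d n × skewOff n)) (W := MatTuple d n) (tubeDeriv x)
    (tubeDeriv (torusAct t x)) (tubeAct ht) (uconjRealIso t)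
  exact h fun y => tubeDeriv_torusAct ht x y

end TorusAction

end CommTuple

namespace CommTuple

variable {d n : ℕ} [NeZero d]

/-! ### Sorted eigenvalues and a compact exhaustion -/

section Sorting

/-- The eigenvalue tuples whose first coordinates are strictly increasing along `σ`, for a fixed
Borel linear order on `ℂ`. -/
def sortedBy (d : ℕ) [NeZero d] {n : ℕ} (σ : Equiv.Perm (Fin n)) : Set (Fin n → Fin d → ℂ) :=
  {l | StrictMono fun i => embeddingReal ℂ (l (σ i) 0)}

lemma sortedBy_subset_generic (σ : Equiv.Perm (Fin n)) : sortedBy d σ ⊆ Generic d n := by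
  intro l hl i j hij
  have h : StrictMono fun i => embeddingReal ℂ (l (σ i) 0) := hl
  have := h.injective (a₁ := σ.symm i) (a₂ := σ.symm j) (by simpa using congrArg _ hij)
  exact σ.symm.injective this

lemma exists_mem_sortedBy {l : Fin n → Fin d → ℂ} (hl : l ∈ Generic d n) :
    ∃ σ, l ∈ sortedBy d σ := by
  let f : Fin n → ℝ := fun i => embeddingReal ℂ (l i 0)
  have hf : Function.Injective f := fun i j h =>
    hl ((measurableEmbedding_embeddingReal ℂ).injective h)
  exact ⟨Tuple.sort f,
    (Tuple.monotone_sort f).strictMono_of_injective (hf.comp (Tuple.sort f).injective)⟩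

lemma eq_of_mem_sortedBy {σ τ : Equiv.Perm (Fin n)} {l : Fin n → Fin d → ℂ}
    (hσ : l ∈ sortedBy d σ) (hτ : l ∈ sortedBy d τ) : σ = τ := by
  let f : Fin n → ℝ := fun i => embeddingReal ℂ (l i 0)
  have hr : Set.range (f ∘ σ) = Set.range (f ∘ τ) := by
    rw [σ.surjective.range_comp, τ.surjective.range_comp]
  have h1 : f ∘ σ = f ∘ τ := (StrictMono.range_inj hσ hτ).1 hr
  ext i
  have h2 := sortedBy_subset_generic σ hσ
    ((measurableEmbedding_embeddingReal ℂ).injective (congrFun h1 i))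
  rw [h2]

/-- A finite set of reals has only one strictly increasing enumeration. -/
lemma eq_of_sortedBy_of_map_eq {σ : Equiv.Perm (Fin n)} {l l' : Fin n → Fin d → ℂ}
    (hl : l ∈ sortedBy d σ) (hl' : l' ∈ sortedBy d σ)
    (h : (Finset.univ.val.map fun j => l j 0) = Finset.univ.val.map fun j => l' j 0) (j : Fin n) :
    l j 0 = l' j 0 := by
  obtain ⟨τ, hτ⟩ := exists_perm_of_map_eq (sortedBy_subset_generic σ hl') h
  let f : Fin n → ℝ := fun i => embeddingReal ℂ (l i 0)
  let f' : Fin n → ℝ := fun i => embeddingReal ℂ (l' i 0)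
  have hf : f = f' ∘ τ := funext fun i => congrArg _ (congrFun hτ i)
  have hr : Set.range (f ∘ σ) = Set.range (f' ∘ σ) := by
    rw [σ.surjective.range_comp, σ.surjective.range_comp, hf, τ.surjective.range_comp]
  have h1 : f ∘ σ = f' ∘ σ := (StrictMono.range_inj hl hl').1 hr
  have h2 := congrFun h1 (σ.symm j)
  simp only [Function.comp_apply, Equiv.apply_symm_apply] at h2
  exact (measurableEmbedding_embeddingReal ℂ).injective h2

lemma measurableSet_sortedBy (σ : Equiv.Perm (Fin n)) : MeasurableSet (sortedBy d σ) := by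
  have h : sortedBy d σ = ⋂ i, ⋂ j, ⋂ (_ : i < j),
      {l | embeddingReal ℂ (l (σ i) 0) < embeddingReal ℂ (l (σ j) 0)} := by
    ext l
    simp only [Set.mem_iInter]
    exact ⟨fun h i j hij => h hij, fun h i j hij => h i j hij⟩
  rw [h]
  have hm : ∀ i, Measurable fun l : Fin n → Fin d → ℂ => embeddingReal ℂ (l (σ i) 0) := fun i =>
    (measurableEmbedding_embeddingReal ℂ).measurable.comp
      ((measurable_pi_apply 0).comp (measurable_pi_apply _))
  exact MeasurableSet.iInter fun i => MeasurableSet.iInter fun j => MeasurableSet.iInter fun _ =>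
    measurableSet_lt (hm i) (hm j)

/-- The parameters `(λ, A)` with `λ` sorted along `σ`. -/
def sortSet (d : ℕ) [NeZero d] {n : ℕ} (σ : Equiv.Perm (Fin n)) : Set (DiagUni d n) :=
  {x | lamOf x ∈ sortedBy d σ}

omit [NeZero d] in
lemma continuous_lamOf : Continuous (lamOf : DiagUni d n → _) :=
  continuous_pi fun j => continuous_pi fun r =>
    (contDiff_coord (m := 0) (Sum.inl (j, r))).continuous

lemma measurableSet_sortSet (σ : Equiv.Perm (Fin n)) : MeasurableSet (sortSet d σ) :=
  (measurableSet_sortedBy σ).preimage continuous_lamOf.measurable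

lemma isClosed_le_separation (c : ℝ) :
    IsClosed {x : DiagUni d n | ∀ i j, i ≠ j → c ≤ ‖lamOf x i 0 - lamOf x j 0‖} := by
  simp only [Set.ofPred_forall]
  refine isClosed_iInter fun i => isClosed_iInter fun j => isClosed_iInter fun _ =>
    isClosed_le continuous_const ?_
  exact ((((continuous_apply 0).comp (continuous_apply i)).comp continuous_lamOf).sub
    (((continuous_apply 0).comp (continuous_apply j)).comp continuous_lamOf)).norm

/-- A compact exhaustion of the parameters with generic eigenvalues. -/
def genericCompact (d n : ℕ) [NeZero d] (k : ℕ) : Set (DiagUni d n) :=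
  Metric.closedBall 0 k ∩
    {x | ∀ i j, i ≠ j → (1 / (k + 1 : ℝ)) ≤ ‖lamOf x i 0 - lamOf x j 0‖}

lemma isCompact_genericCompact (k : ℕ) : IsCompact (genericCompact d n k) :=
  (isCompact_closedBall 0 (k : ℝ)).inter_right (isClosed_le_separation _)

lemma lamOf_mem_generic {k : ℕ} {x : DiagUni d n} (hx : x ∈ genericCompact d n k) :
    lamOf x ∈ Generic d n := by
  intro i j hij
  by_contra hne
  have h1 := hx.2 i j hne
  have h2 : lamOf x i 0 = lamOf x j 0 := hij
  rw [h2, sub_self, norm_zero] at h1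
  have : (0 : ℝ) < 1 / (k + 1 : ℝ) := by positivity
  linarith

lemma genericCompact_mono : Monotone (genericCompact d n) := by
  intro k m hkm x hx
  have hkm' : (k : ℝ) ≤ m := Nat.cast_le.2 hkm
  refine ⟨Metric.closedBall_subset_closedBall hkm' hx.1, fun i j hij => le_trans ?_ (hx.2 i j hij)⟩
  gcongr

lemma exists_mem_genericCompact {x : DiagUni d n} (hx : lamOf x ∈ Generic d n) :
    ∃ k, x ∈ genericCompact d n k := by
  have hpos : ∃ c > 0, ∀ i j, i ≠ j → c ≤ ‖lamOf x i 0 - lamOf x j 0‖ := by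
    have h : ∀ p : Fin n × Fin n, ∃ c : ℝ, 0 < c ∧
        (p.1 ≠ p.2 → c ≤ ‖lamOf x p.1 0 - lamOf x p.2 0‖) := by
      intro p
      by_cases hp : p.1 = p.2
      · exact ⟨1, one_pos, fun h => absurd hp h⟩
      · exact ⟨_, norm_pos_iff.2 (sub_ne_zero.2 fun h => hp (hx h)), fun _ => le_rfl⟩
    choose c hc hc' using h
    obtain ⟨b, hb', hb⟩ := ((Filter.eventually_all.2 fun p => Ioo_mem_nhdsGT (hc p)).and
      (self_mem_nhdsWithin (a := (0 : ℝ)) (s := Set.Ioi 0))).exists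
    exact ⟨b, hb, fun i j hij => (hb' (i, j)).2.le.trans (hc' (i, j) hij)⟩
  obtain ⟨c, hc, hc'⟩ := hpos
  obtain ⟨k1, hk1⟩ := exists_nat_one_div_lt hc
  obtain ⟨k2, hk2⟩ := exists_nat_ge ‖x‖
  refine ⟨max k1 k2, ?_, fun i j hij => ?_⟩
  · rw [mem_closedBall_zero_iff]
    exact hk2.trans (Nat.cast_le.2 (le_max_right _ _))
  · refine le_trans ?_ (hk1.le.trans (hc' i j hij))
    have : (k1 : ℝ) ≤ (max k1 k2 : ℕ) := Nat.cast_le.2 (le_max_left _ _)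
    gcongr

/-- Finitely many proper linear subspaces `λ_i^0 = λ_j^0` cover the set. -/
lemma volume_not_generic : volume {x : DiagUni d n | lamOf x ∉ Generic d n} = 0 := by
  have hsub : {x : DiagUni d n | lamOf x ∉ Generic d n} ⊆
      ⋃ i, ⋃ j, ⋃ (_ : i ≠ j), {x | lamOf x i 0 = lamOf x j 0} := by
    intro x hx
    have hx' : ¬ Function.Injective fun j => lamOf x j 0 := hx
    rw [Function.Injective] at hx'
    push Not at hx'
    obtain ⟨i, j, hij, hne⟩ := hx'
    simp only [Set.mem_iUnion]
    exact ⟨i, j, hne, hij⟩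
  refine measure_mono_null hsub ?_
  simp only [measure_iUnion_null_iff]
  intro i j hij
  let f : DiagUni d n →ₗ[ℝ] ℂ :=
    { toFun := fun x => lamOf x i 0 - lamOf x j 0
      map_add' := fun x y => by
        change (lamOf x i 0 + lamOf y i 0) - (lamOf x j 0 + lamOf y j 0) = _
        ring
      map_smul' := fun c x => by
        change ((c : ℂ) * lamOf x i 0) - ((c : ℂ) * lamOf x j 0) =
          (c : ℂ) * (lamOf x i 0 - lamOf x j 0)
        ring }
  have hs : {x : DiagUni d n | lamOf x i 0 = lamOf x j 0} = (LinearMap.ker f : Set _) := by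
    ext x
    exact sub_eq_zero.symm
  rw [hs]
  refine Measure.addHaar_submodule volume _ fun htop => ?_
  have h1 : (WithLp.toLp 2 (Pi.single (Sum.inl (i, 0)) 1) : DiagUni d n) ∈ LinearMap.ker f := by
    rw [htop]; trivial
  have h2 : (Pi.single (Sum.inl (i, 0)) 1 : ((Fin n × Fin d) ⊕ UpperIdx n) → ℂ) (Sum.inl (i, 0)) -
    (Pi.single (Sum.inl (i, 0)) 1 : ((Fin n × Fin d) ⊕ UpperIdx n) → ℂ) (Sum.inl (j, 0)) = 0 := h1
  rw [Pi.single_eq_same, Pi.single_eq_of_ne (by simpa using hij.symm)] at h2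
  simp at h2

end Sorting

/-! ### Sets of tuples described by parameters and classes -/

section TupleSets

/-- The tuples conjugate to upper triangular ones with parameters in `A` by a unitary whose class
lies in `N`. -/
def tupleSet (A : Set (DiagUni d n)) (N : Set (FlagSpace n)) : Set (MatTuple d n) :=
  {X | ∃ x ∈ A, ∃ U : Matrix.unitaryGroup (Fin n) ℂ, QuotientGroup.mk U ∈ N ∧
    X = uconj U (triParam d n x)}

/-- A set of parameters is invariant if it is stable under the diagonal torus. -/
def TorusInvariant (A : Set (DiagUni d n)) : Prop :=
  ∀ t ∈ diagTorus n, ∀ x ∈ A, torusAct t x ∈ A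

lemma torusInvariant_sortSet (σ : Equiv.Perm (Fin n)) : TorusInvariant (sortSet d σ) :=
  fun _ _ _ hx => hx

lemma torusInvariant_genericCompact (k : ℕ) : TorusInvariant (genericCompact d n k) := by
  intro t ht x hx
  refine ⟨?_, hx.2⟩
  rw [mem_closedBall_zero_iff, norm_torusAct ht, ← mem_closedBall_zero_iff]
  exact hx.1

omit [NeZero d] in
lemma TorusInvariant.inter {A B : Set (DiagUni d n)} (hA : TorusInvariant A)
    (hB : TorusInvariant B) : TorusInvariant (A ∩ B) :=
  fun t ht x hx => ⟨hA t ht x hx.1, hB t ht x hx.2⟩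

/-- The map `((λ, A), u) ↦ U A D A⁻¹ U^*`, with `U = s u`. -/
noncomputable def flagParam (s : FlagSpace n → Matrix.unitaryGroup (Fin n) ℂ)
    (p : DiagUni d n × FlagSpace n) : MatTuple d n := uconj (s p.2) (triParam d n p.1)

omit [NeZero d] in
lemma measurable_flagParam {s : FlagSpace n → Matrix.unitaryGroup (Fin n) ℂ} (hs : IsSection s) :
    Measurable (flagParam (d := d) s) := by
  have h1 : Measurable fun p : DiagUni d n × FlagSpace n => triParam d n p.1 :=
    Measurable.comp (g := triParam d n) continuous_triParam.measurable measurable_fst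
  have h2 : Measurable fun p : DiagUni d n × FlagSpace n => s p.2 := hs.1.comp measurable_snd
  exact measurable_uconj_of h2 h1

omit [NeZero d] in
lemma eq_of_lamOf_of_uppOf {x y : DiagUni d n} (h1 : lamOf x = lamOf y) (h2 : uppOf x = uppOf y) :
    x = y := by
  ext k
  rcases k with ⟨j, r⟩ | p
  · exact congrFun (congrFun h1 j) r
  · exact congrFun h2 p

/-- Conjugate tuples have the same eigenvalues of the first component. Sorted along the same `σ`,
these agree entry by entry, and uniqueness of the triangular form applies. -/
lemma eq_of_uconj_triParam_eq {σ : Equiv.Perm (Fin n)} {x y : DiagUni d n}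
    (hx : x ∈ sortSet d σ) (hy : y ∈ sortSet d σ) {U V : Matrix.unitaryGroup (Fin n) ℂ}
    (h : uconj U (triParam d n x) = uconj V (triParam d n y)) :
    lamOf x = lamOf y ∧ V⁻¹ * U ∈ diagTorus n := by
  have h1 := roots_charpoly_uconj_triTuple U (lamOf x) (uppOf x)
  rw [← triParam_eq, h, triParam_eq, roots_charpoly_uconj_triTuple] at h1
  exact uconj_triTuple_injective (sortedBy_subset_generic σ hx)
    (eq_of_sortedBy_of_map_eq hx hy h1.symm) h

lemma eq_of_uconj_triParam_eq_same {σ : Equiv.Perm (Fin n)} {x y : DiagUni d n}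
    (hx : x ∈ sortSet d σ) {U : Matrix.unitaryGroup (Fin n) ℂ}
    (h : uconj U (triParam d n x) = uconj U (triParam d n y)) : x = y := by
  obtain ⟨h1, h2⟩ := triTuple_injective (sortedBy_subset_generic σ hx) (uconj_injective U h)
  exact eq_of_lamOf_of_uppOf h1 h2

lemma injOn_flagParam {s : FlagSpace n → Matrix.unitaryGroup (Fin n) ℂ} (hs : IsSection s)
    (σ : Equiv.Perm (Fin n)) : Set.InjOn (flagParam s) (sortSet d σ ×ˢ Set.univ) := by
  rintro ⟨x, u⟩ hx ⟨y, v⟩ hy h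
  have h1 := (eq_of_uconj_triParam_eq hx.1 hy.1 h).2
  have h2 : u = v := by
    rw [← hs.2 u, ← hs.2 v]
    exact (QuotientGroup.eq.2 h1).symm
  subst h2
  have h3 : x = y := eq_of_uconj_triParam_eq_same hx.1 h
  rw [h3]

-- A unitary and the chosen representative of its class differ by a torus element, which is absorbed
-- by the invariant set `A`.
omit [NeZero d] in
lemma tupleSet_eq_image {s : FlagSpace n → Matrix.unitaryGroup (Fin n) ℂ} (hs : IsSection s)
    {A : Set (DiagUni d n)} (hA : TorusInvariant A) (N : Set (FlagSpace n)) :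
    tupleSet A N = flagParam s '' (A ×ˢ N) := by
  ext X
  constructor
  · rintro ⟨x, hx, U, hU, rfl⟩
    have ht : (s (QuotientGroup.mk U))⁻¹ * U ∈ diagTorus n := QuotientGroup.eq.1 (hs.2 _)
    refine ⟨(torusAct ((s (QuotientGroup.mk U))⁻¹ * U) x, QuotientGroup.mk U),
      ⟨hA _ ht x hx, hU⟩, ?_⟩
    change uconj (s (QuotientGroup.mk U)) (triParam d n (torusAct _ x)) = _
    rw [triParam_torusAct ht, ← uconj_mul, mul_inv_cancel_left]
  · rintro ⟨⟨x, u⟩, ⟨hx, hu⟩, rfl⟩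
    exact ⟨x, hx, s u, by rwa [hs.2], rfl⟩

omit [NeZero d] in
lemma tupleSet_expBall {A : Set (DiagUni d n)} (hA : TorusInvariant A) (ε : ℝ) :
    tupleSet A (expBall n ε) = tubeParam d n '' prodBall (skewOff n) A ε := by
  ext X
  constructor
  · rintro ⟨x, hx, U, hU, rfl⟩
    obtain ⟨S, hS, hUS⟩ := mem_expBall.1 hU
    have ht : (expU S)⁻¹ * U ∈ diagTorus n := QuotientGroup.eq.1 hUS.symm
    refine ⟨WithLp.toLp 2 (torusAct ((expU S)⁻¹ * U) x, S), ⟨hA _ ht x hx, hS⟩, ?_⟩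
    change uconj (expU S) (triParam d n (torusAct _ x)) = _
    rw [triParam_torusAct ht, ← uconj_mul, mul_inv_cancel_left]
  · rintro ⟨y, ⟨hx, hS⟩, rfl⟩
    exact ⟨y.fst, hx, expU y.snd, mem_expBall.2 ⟨y.snd, hS, rfl⟩, rfl⟩

/-- An injective measurable image of a Borel set in a standard Borel space is Borel. -/
lemma measurableSet_tupleSet {σ : Equiv.Perm (Fin n)} {A : Set (DiagUni d n)}
    (hA : TorusInvariant A) (hAσ : A ⊆ sortSet d σ) (hAm : MeasurableSet A)
    {N : Set (FlagSpace n)} (hN : MeasurableSet N) : MeasurableSet (tupleSet A N) := by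
  obtain ⟨s, hs⟩ := exists_isSection n
  rw [tupleSet_eq_image hs hA]
  exact (hAm.prod hN).image_of_measurable_injOn (measurable_flagParam hs)
    ((injOn_flagParam hs σ).mono (Set.prod_mono hAσ (Set.subset_univ _)))

omit [NeZero d] in
lemma continuous_tubeParam : Continuous (tubeParam d n) := by
  have h1 : Continuous fun y : WithLp 2 (DiagUni d n × skewOff n) => y.fst :=
    (WithLp.fstL 2 ℝ (DiagUni d n) (skewOff n)).continuous
  have h2 : Continuous fun y : WithLp 2 (DiagUni d n × skewOff n) => y.snd :=
    (WithLp.sndL 2 ℝ (DiagUni d n) (skewOff n)).continuous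
  have h3 : Continuous fun y : WithLp 2 (DiagUni d n × skewOff n) => triParam d n y.fst :=
    Continuous.comp (g := triParam d n) continuous_triParam h1
  have h4 : Continuous fun y : WithLp 2 (DiagUni d n × skewOff n) => expU y.snd :=
    Continuous.comp (g := expU) continuous_expU h2
  exact continuous_uconj_of h4 h3

lemma exists_injOn_tubeParam (n : ℕ) : ∃ ε > 0, ∀ (d : ℕ) [NeZero d] (σ : Equiv.Perm (Fin n)),
    Set.InjOn (tubeParam d n) (prodBall (skewOff n) (sortSet d σ) ε) := by
  obtain ⟨ε, hε, h⟩ := exists_expU_injOn n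
  refine ⟨ε, hε, fun d _ σ y hy z hz hyz => ?_⟩
  have h1 := (eq_of_uconj_triParam_eq hy.1 hz.1 hyz).2
  have h2 : y.snd = z.snd := h _ _ hy.2 hz.2 h1
  refine WithLp.prod_ext (eq_of_uconj_triParam_eq_same (U := expU y.snd) hy.1 ?_) h2
  rw [tubeParam, tubeParam, ← h2] at hyz
  exact hyz

end TupleSets

end CommTuple

namespace CommTuple

variable {d n : ℕ}

/-! ### Product structure of the measure and the constant `C` -/

section Disintegration

/-- Hausdorff measure on tuples, of the dimension of the variety of commuting tuples. -/
noncomputable abbrev tupleVol (d n : ℕ) : Measure (MatTuple d n) :=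
  μHE[2 * (n * (n - 1)) + 2 * (d * n)]

lemma tupleVol_image_uconj (U : Matrix.unitaryGroup (Fin n) ℂ) (s : Set (MatTuple d n)) :
    tupleVol d n (uconj U '' s) = tupleVol d n s :=
  (isometry_uconj U).euclideanHausdorffMeasure_image s

lemma uconj_image_tupleSet (g : Matrix.unitaryGroup (Fin n) ℂ) (A : Set (DiagUni d n))
    (N : Set (FlagSpace n)) : uconj g '' tupleSet A ((g • ·) ⁻¹' N) = tupleSet A N := by
  ext X
  constructor
  · rintro ⟨_, ⟨x, hx, U, hU, rfl⟩, rfl⟩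
    exact ⟨x, hx, g * U, hU, (uconj_mul _ _ _).symm⟩
  · rintro ⟨x, hx, U, hU, rfl⟩
    refine ⟨_, ⟨x, hx, g⁻¹ * U, ?_, rfl⟩, by rw [← uconj_mul, mul_inv_cancel_left]⟩
    rw [Set.mem_preimage, ← mk_mul, mul_inv_cancel_left]
    exact hU

lemma tupleSet_iUnion {ι : Sort*} (A : Set (DiagUni d n)) (N : ι → Set (FlagSpace n)) :
    tupleSet A (⋃ i, N i) = ⋃ i, tupleSet A (N i) := by
  ext X
  simp only [tupleSet, Set.mem_iUnion, Set.mem_ofPred_eq]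
  constructor
  · rintro ⟨x, hx, U, ⟨i, hi⟩, rfl⟩
    exact ⟨i, x, hx, U, hi, rfl⟩
  · rintro ⟨i, x, hx, U, hi, rfl⟩
    exact ⟨x, hx, U, ⟨i, hi⟩, rfl⟩

lemma tupleSet_iUnion_left {ι : Sort*} (A : ι → Set (DiagUni d n)) (N : Set (FlagSpace n)) :
    tupleSet (⋃ i, A i) N = ⋃ i, tupleSet (A i) N := by
  ext X
  simp only [tupleSet, Set.mem_iUnion, Set.mem_ofPred_eq]
  constructor
  · rintro ⟨x, ⟨i, hi⟩, U, hU, rfl⟩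
    exact ⟨i, x, hi, U, hU, rfl⟩
  · rintro ⟨i, x, hi, U, hU, rfl⟩
    exact ⟨x, ⟨i, hi⟩, U, hU, rfl⟩

lemma tupleSet_mono {A A' : Set (DiagUni d n)} (hA : A ⊆ A') {N N' : Set (FlagSpace n)}
    (hN : N ⊆ N') : tupleSet A N ⊆ tupleSet A' N' := by
  rintro X ⟨x, hx, U, hU, rfl⟩
  exact ⟨x, hA hx, U, hN hU, rfl⟩

variable [NeZero d]

lemma disjoint_tupleSet {σ : Equiv.Perm (Fin n)} {A : Set (DiagUni d n)} (hA : A ⊆ sortSet d σ)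
    {N N' : Set (FlagSpace n)} (h : Disjoint N N') : Disjoint (tupleSet A N) (tupleSet A N') := by
  rw [Set.disjoint_left]
  rintro X ⟨x, hx, U, hU, rfl⟩ ⟨y, hy, V, hV, hXY⟩
  have h1 := (eq_of_uconj_triParam_eq (hA hx) (hA hy) hXY).2
  have h2 : (QuotientGroup.mk V : FlagSpace n) = QuotientGroup.mk U := QuotientGroup.eq.2 h1
  rw [h2] at hV
  exact Set.disjoint_left.1 h hU hV

/-- For an invariant set `A` of sorted parameters, the measure of `tupleSet A N` as a measure in
`N`. -/
noncomputable def tupleFlagMeasure {σ : Equiv.Perm (Fin n)} {A : Set (DiagUni d n)}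
    (hA : TorusInvariant A) (hAσ : A ⊆ sortSet d σ) (hAm : MeasurableSet A) :
    Measure (FlagSpace n) :=
  Measure.ofMeasurable (fun N _ => tupleVol d n (tupleSet A N))
    (by
      have h : tupleSet A (∅ : Set (FlagSpace n)) = ∅ := by
        rw [Set.eq_empty_iff_forall_notMem]
        rintro X ⟨x, hx, U, hU, rfl⟩
        exact hU
      rw [h, measure_empty])
    fun N hN hd => by
      rw [tupleSet_iUnion]
      exact measure_iUnion (fun i j hij => disjoint_tupleSet hAσ (hd hij))
        fun i => measurableSet_tupleSet hA hAσ hAm (hN i)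

lemma tupleFlagMeasure_apply {σ : Equiv.Perm (Fin n)} {A : Set (DiagUni d n)}
    (hA : TorusInvariant A) (hAσ : A ⊆ sortSet d σ) (hAm : MeasurableSet A)
    {N : Set (FlagSpace n)} (hN : MeasurableSet N) :
    tupleFlagMeasure hA hAσ hAm N = tupleVol d n (tupleSet A N) :=
  Measure.ofMeasurable_apply N hN

/-- The integral of the Jacobian of `tubeParam`. -/
noncomputable def jacInt (A : Set (DiagUni d n)) : ℝ≥0∞ := ∫⁻ x in A, ENNReal.ofReal (tubeJac x)

lemma tendsto_tupleSet_expBall {σ : Equiv.Perm (Fin n)} {k : ℕ} {A : Set (DiagUni d n)}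
    (hA : TorusInvariant A) (hAσ : A ⊆ sortSet d σ) (hAk : A ⊆ genericCompact d n k)
    (hAm : MeasurableSet A) :
    jacInt A ≠ ∞ ∧ Filter.Tendsto
      (fun ε => tupleVol d n (tupleSet A (expBall n ε)) / skewVol n {S | ‖S‖ < ε}) (𝓝[>] 0)
      (𝓝 (jacInt A)) := by
  obtain ⟨ε₀, hε₀, hinj⟩ := exists_injOn_tubeParam n
  have hinj' : Set.InjOn (tubeParam d n) (prodBall (skewOff n) A ε₀) :=
    (hinj d σ).mono (prodBall_mono hAσ le_rfl)
  have : StandardBorelSpace (WithLp 2 (DiagUni d n × skewOff n)) := standardBorel_of_polish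
  have h := tendsto_measure_image_prodBall (P := DiagUni d n) (S := skewOff n) (F := MatTuple d n)
    (f := tubeParam d n) (L := fun x => tubeDeriv x) (isCompact_genericCompact k)
    (fun p _ => hasStrictFDerivAt_tubeParam p)
    (fun p hp => tubeDeriv_injective (lamOf_mem_generic hp)) continuous_tubeJac.continuousOn hε₀
    hinj' (fun B hB hBm => hBm.image_of_measurable_injOn continuous_tubeParam.measurable
      (hinj'.mono hB)) hAk hAm
  rw [finrank_tube] at h
  simp only [← tupleSet_expBall hA] at h
  exact h

instance : (skewVol n).IsAddHaarMeasure :=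
  inferInstanceAs ((@volume (skewOff n) measureSpaceOfInnerProductSpace).IsAddHaarMeasure)

lemma skewVol_ball_ne_top (ε : ℝ) : skewVol n {S | ‖S‖ < ε} ≠ ∞ := by
  have h : {S : skewOff n | ‖S‖ < ε} = Metric.ball 0 ε := by ext; simp
  rw [h]
  exact measure_ball_lt_top.ne

lemma skewVol_ball_ne_zero {ε : ℝ} (hε : 0 < ε) : skewVol n {S | ‖S‖ < ε} ≠ 0 := by
  have h : {S : skewOff n | ‖S‖ < ε} = Metric.ball 0 ε := by ext; simp
  rw [h]
  exact (Metric.measure_ball_pos (skewVol n) (0 : skewOff n) hε).ne'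

/-- A thin tube has finite measure because its ratio to the ball volume has a finite limit. By
compactness of `U(n)`, finitely many conjugates of the tube cover the whole set, and conjugation
preserves the measure. -/
lemma tupleVol_tupleSet_ne_top {σ : Equiv.Perm (Fin n)} {k : ℕ} {A : Set (DiagUni d n)}
    (hA : TorusInvariant A) (hAσ : A ⊆ sortSet d σ) (hAk : A ⊆ genericCompact d n k)
    (hAm : MeasurableSet A) : tupleVol d n (tupleSet A Set.univ) ≠ ∞ := by
  obtain ⟨h1, h2⟩ := tendsto_tupleSet_expBall hA hAσ hAk hAm
  obtain ⟨ε, hε1, hε⟩ := ((h2.eventually_lt_const h1.lt_top).and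
    (self_mem_nhdsWithin (a := (0 : ℝ)) (s := Set.Ioi 0))).exists
  have hfin : tupleVol d n (tupleSet A (expBall n ε)) ≠ ∞ := by
    intro htop
    rw [htop, ENNReal.top_div_of_ne_top (skewVol_ball_ne_top ε)] at hε1
    exact lt_irrefl _ hε1
  obtain ⟨t, -, ht⟩ := isCompact_univ.elim_nhds_subcover
    (fun g : Matrix.unitaryGroup (Fin n) ℂ => (g⁻¹ * ·) ⁻¹' (QuotientGroup.mk ⁻¹' expBall n ε))
    (fun g _ => by
      refine (continuous_const_mul g⁻¹).continuousAt.preimage_mem_nhds ?_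
      rw [inv_mul_cancel]
      exact preimage_expBall_mem_nhds hε)
  have hsub : tupleSet A Set.univ ⊆ ⋃ g ∈ t, uconj g '' tupleSet A (expBall n ε) := by
    rintro X ⟨x, hx, U, -, rfl⟩
    obtain ⟨g, hg, hU⟩ := Set.mem_iUnion₂.1 (ht (Set.mem_univ U))
    refine Set.mem_iUnion₂.2 ⟨g, hg, _, ⟨x, hx, g⁻¹ * U, hU, rfl⟩, ?_⟩
    rw [← uconj_mul, mul_inv_cancel_left]
  refine ne_top_of_le_ne_top ?_ ((measure_mono hsub).trans (measure_biUnion_finset_le t _))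
  simp only [tupleVol_image_uconj]
  exact ENNReal.sum_ne_top.2 fun _ _ => hfin

/-- Conjugation by `g` is an isometry that translates the classes by `g`, so the measure in `N` is
finite and invariant, hence a multiple of `ν`. -/
lemma tupleVol_tupleSet_eq_mul {σ : Equiv.Perm (Fin n)} {k : ℕ} {A : Set (DiagUni d n)}
    (hA : TorusInvariant A) (hAσ : A ⊆ sortSet d σ) (hAk : A ⊆ genericCompact d n k)
    (hAm : MeasurableSet A) {N : Set (FlagSpace n)} (hN : MeasurableSet N) :
    tupleVol d n (tupleSet A N) = tupleVol d n (tupleSet A Set.univ) * nu n N := by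
  have happ := fun {N} hN => tupleFlagMeasure_apply (N := N) hA hAσ hAm hN
  have : IsFiniteMeasure (tupleFlagMeasure hA hAσ hAm) := by
    refine ⟨?_⟩
    rw [happ MeasurableSet.univ]
    exact (tupleVol_tupleSet_ne_top hA hAσ hAk hAm).lt_top
  rw [← happ hN, ← happ MeasurableSet.univ]
  refine eq_smul_nu_of_invariant _ (fun g N hN => ?_) hN
  have hg : Measurable fun u : FlagSpace n => g • u :=
    measurable_smul_flag.comp measurable_prodMk_left
  rw [happ (hN.preimage hg), happ hN, ← uconj_image_tupleSet g A N, tupleVol_image_uconj]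

lemma tendsto_mul_nu_div {σ : Equiv.Perm (Fin n)} {k : ℕ} {A : Set (DiagUni d n)}
    (hA : TorusInvariant A) (hAσ : A ⊆ sortSet d σ) (hAk : A ⊆ genericCompact d n k)
    (hAm : MeasurableSet A) :
    Filter.Tendsto (fun ε => tupleVol d n (tupleSet A Set.univ) *
      (nu n (expBall n ε) / skewVol n {S | ‖S‖ < ε})) (𝓝[>] 0) (𝓝 (jacInt A)) := by
  refine (tendsto_tupleSet_expBall hA hAσ hAk hAm).2.congr fun ε => ?_
  rw [tupleVol_tupleSet_eq_mul hA hAσ hAk hAm (measurableSet_expBall n ε), mul_div_assoc]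

lemma tubeJac_pos {x : DiagUni d n} (hx : lamOf x ∈ Generic d n) : 0 < tubeJac x := by
  refine lt_of_le_of_ne (LinearMap.normDet_nonneg _) fun h => ?_
  have h1 := LinearMap.normDet_eq_zero_iff_ker_ne_bot.1 h.symm
  exact h1 (LinearMap.ker_eq_bot.2 (tubeDeriv_injective hx))

lemma iUnion_sortSet_inter (d n : ℕ) [NeZero d] :
    {x : DiagUni d n | lamOf x ∈ Generic d n} ⊆
      ⋃ σ : Equiv.Perm (Fin n), ⋃ k : ℕ, sortSet d σ ∩ genericCompact d n k := by
  intro x hx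
  obtain ⟨σ, hσ⟩ := exists_mem_sortedBy hx
  obtain ⟨k, hk⟩ := exists_mem_genericCompact hx
  exact Set.mem_iUnion₂.2 ⟨σ, k, hσ, hk⟩

lemma exists_volume_sortSet_ne_zero (d n : ℕ) [NeZero d] :
    ∃ (σ : Equiv.Perm (Fin n)) (k : ℕ),
      volume (sortSet d σ ∩ genericCompact d n k) ≠ 0 := by
  by_contra! h
  have h1 : volume {x : DiagUni d n | lamOf x ∈ Generic d n} = 0 :=
    measure_mono_null (iUnion_sortSet_inter d n)
      (measure_iUnion_null fun σ => measure_iUnion_null fun k => h σ k)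
  have h2 : volume (Set.univ : Set (DiagUni d n)) = 0 := by
    refine measure_mono_null (t := {x : DiagUni d n | lamOf x ∈ Generic d n} ∪
      {x | lamOf x ∉ Generic d n}) (fun x _ => em _) (measure_union_null h1 volume_not_generic)
  exact (isOpen_univ.measure_pos volume ⟨0, trivial⟩).ne' h2

-- The ratio involves `n` only, so `d = 1` may be used. For a compact piece of sorted parameters of
-- positive volume, the total measure `M` of its tuples and the integral `I` of the Jacobian are
-- finite and nonzero, and `M · ν / vol → I`. Therefore `vol / ν → M / I`.
omit [NeZero d] in
lemma tendsto_div_nu (n : ℕ) : ∃ C : ℝ, 0 < C ∧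
    Filter.Tendsto (fun ε : ℝ => skewVol n {S | ‖S‖ < ε} / nu n (expBall n ε)) (𝓝[>] 0)
      (𝓝 (ENNReal.ofReal C)) := by
  obtain ⟨σ, k, hσk⟩ := exists_volume_sortSet_ne_zero 1 n
  set A : Set (DiagUni 1 n) := sortSet 1 σ ∩ genericCompact 1 n k with hAdef
  have hA : TorusInvariant A := (torusInvariant_sortSet σ).inter (torusInvariant_genericCompact k)
  have hAm : MeasurableSet A :=
    (measurableSet_sortSet σ).inter (isCompact_genericCompact k).measurableSet
  have hlim := tendsto_mul_nu_div hA Set.inter_subset_left Set.inter_subset_right hAm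
  have hMtop := tupleVol_tupleSet_ne_top hA Set.inter_subset_left Set.inter_subset_right hAm
  have hItop := (tendsto_tupleSet_expBall hA Set.inter_subset_left Set.inter_subset_right hAm).1
  have hI0 : jacInt A ≠ 0 := by
    intro h0
    have h1 : ∀ᵐ x ∂(volume.restrict A), ENNReal.ofReal (tubeJac x) = 0 :=
      (lintegral_eq_zero_iff (ENNReal.measurable_ofReal.comp continuous_tubeJac.measurable)).1 h0
    rw [ae_restrict_iff' hAm] at h1
    refine hσk (measure_mono_null (t := {x | ¬ (x ∈ A → ENNReal.ofReal (tubeJac x) = 0)})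
      (fun x hx h2 => ?_) h1)
    exact (ENNReal.ofReal_pos.2 (tubeJac_pos (lamOf_mem_generic hx.2))).ne' (h2 hx)
  set M := tupleVol 1 n (tupleSet A Set.univ)
  have hM0 : M ≠ 0 := by
    intro h0
    rw [h0] at hlim
    simp only [zero_mul] at hlim
    exact hI0 (tendsto_nhds_unique hlim tendsto_const_nhds)
  have hlim2 : Filter.Tendsto (fun ε => nu n (expBall n ε) / skewVol n {S | ‖S‖ < ε}) (𝓝[>] 0)
      (𝓝 (M⁻¹ * jacInt A)) := by
    refine (ENNReal.Tendsto.const_mul hlim (Or.inr (ENNReal.inv_ne_top.2 hM0))).congr fun ε => ?_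
    rw [← mul_assoc, ENNReal.inv_mul_cancel hM0 hMtop, one_mul]
  have hq0 : M⁻¹ * jacInt A ≠ 0 := mul_ne_zero (ENNReal.inv_ne_zero.2 hMtop) hI0
  have hqtop : M⁻¹ * jacInt A ≠ ∞ := ENNReal.mul_ne_top (ENNReal.inv_ne_top.2 hM0) hItop
  refine ⟨(M⁻¹ * jacInt A)⁻¹.toReal,
    ENNReal.toReal_pos (ENNReal.inv_ne_zero.2 hqtop) (ENNReal.inv_ne_top.2 hq0), ?_⟩
  rw [ENNReal.ofReal_toReal (ENNReal.inv_ne_top.2 hq0)]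
  refine (((continuous_inv (G := ℝ≥0∞)).tendsto _).comp hlim2).congr' ?_
  filter_upwards [self_mem_nhdsWithin] with ε hε
  have h0 := skewVol_ball_ne_zero (n := n) (ε := ε) hε
  exact ENNReal.inv_div (Or.inl (skewVol_ball_ne_top ε)) (Or.inl h0)

/-- With `M` the left side, `M · ν / vol` tends both to `M / C` and to the integral of the Jacobian.
-/
lemma tupleVol_tupleSet_of_compact {C : ℝ} (hC : 0 < C)
    (hlim : Filter.Tendsto (fun ε : ℝ => skewVol n {S | ‖S‖ < ε} / nu n (expBall n ε)) (𝓝[>] 0)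
      (𝓝 (ENNReal.ofReal C))) {σ : Equiv.Perm (Fin n)} {k : ℕ} {A : Set (DiagUni d n)}
    (hA : TorusInvariant A) (hAσ : A ⊆ sortSet d σ) (hAk : A ⊆ genericCompact d n k)
    (hAm : MeasurableSet A) :
    tupleVol d n (tupleSet A Set.univ) = ENNReal.ofReal C * jacInt A := by
  have hC0 : ENNReal.ofReal C ≠ 0 := (ENNReal.ofReal_pos.2 hC).ne'
  have h1 : Filter.Tendsto (fun ε => nu n (expBall n ε) / skewVol n {S | ‖S‖ < ε}) (𝓝[>] 0)
      (𝓝 (ENNReal.ofReal C)⁻¹) := by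
    refine (((continuous_inv (G := ℝ≥0∞)).tendsto _).comp hlim).congr' ?_
    filter_upwards [self_mem_nhdsWithin] with ε hε
    exact ENNReal.inv_div (Or.inl (measure_ne_top _ _)) (Or.inr (skewVol_ball_ne_zero hε))
  have h2 := ENNReal.Tendsto.const_mul (a := tupleVol d n (tupleSet A Set.univ)) h1
    (Or.inr (tupleVol_tupleSet_ne_top hA hAσ hAk hAm))
  have h3 := tendsto_nhds_unique h2 (tendsto_mul_nu_div hA hAσ hAk hAm)
  rw [← h3, mul_comm, mul_assoc, ENNReal.inv_mul_cancel hC0 ENNReal.ofReal_ne_top, mul_one]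

/-- Exhaust `A` by its intersections with the compact sets and use continuity of measure from below
on both sides. -/
lemma tupleVol_tupleSet {C : ℝ} (hC : 0 < C)
    (hlim : Filter.Tendsto (fun ε : ℝ => skewVol n {S | ‖S‖ < ε} / nu n (expBall n ε)) (𝓝[>] 0)
      (𝓝 (ENNReal.ofReal C))) {σ : Equiv.Perm (Fin n)} {A : Set (DiagUni d n)}
    (hA : TorusInvariant A) (hAσ : A ⊆ sortSet d σ) (hAm : MeasurableSet A) :
    tupleVol d n (tupleSet A Set.univ) = ENNReal.ofReal C * jacInt A := by
  have hAU : A = ⋃ k, A ∩ genericCompact d n k := by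
    rw [← Set.inter_iUnion]
    refine (Set.inter_eq_left.2 fun x hx => ?_).symm
    exact Set.mem_iUnion.2
      (exists_mem_genericCompact (sortedBy_subset_generic σ (hAσ hx)))
  have hmono : Monotone fun k => A ∩ genericCompact d n k :=
    fun i j hij => Set.inter_subset_inter_right _ (genericCompact_mono hij)
  have hk : ∀ k, tupleVol d n (tupleSet (A ∩ genericCompact d n k) Set.univ) =
      ENNReal.ofReal C * jacInt (A ∩ genericCompact d n k) := fun k =>
    tupleVol_tupleSet_of_compact hC hlim (hA.inter (torusInvariant_genericCompact k))
      (Set.inter_subset_left.trans hAσ) Set.inter_subset_right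
      (hAm.inter (isCompact_genericCompact k).measurableSet)
  have h1 : tupleVol d n (tupleSet A Set.univ) =
      ⨆ k, tupleVol d n (tupleSet (A ∩ genericCompact d n k) Set.univ) := by
    conv_lhs => rw [hAU, tupleSet_iUnion_left]
    exact Monotone.measure_iUnion fun i j hij => tupleSet_mono (hmono hij) le_rfl
  have h2 : jacInt A = ⨆ k, jacInt (A ∩ genericCompact d n k) := by
    have hJ : ∀ {B : Set (DiagUni d n)}, MeasurableSet B →
        (volume.withDensity fun x => ENNReal.ofReal (tubeJac x)) B = jacInt B :=
      fun hB => withDensity_apply _ hB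
    simp only [← hJ hAm, ← hJ (hAm.inter (isCompact_genericCompact _).measurableSet)]
    conv_lhs => rw [hAU]
    exact hmono.measure_iUnion
  rw [h1, h2, ENNReal.mul_iSup]
  exact iSup_congr hk

end Disintegration

end CommTuple

namespace CommTuple

variable {d n : ℕ}

/-! ### The change of variables for arbitrary integrands -/

section ChangeOfVariables

/-- A right translate of the Haar probability measure is again a Haar probability measure, hence the
same one. -/
instance : (haarU n).IsMulRightInvariant := by
  refine ⟨fun g => ?_⟩
  have : IsProbabilityMeasure ((haarU n).map (· * g)) :=
    Measure.isProbabilityMeasure_map (measurable_mul_const g).aemeasurable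
  exact Measure.isHaarMeasure_eq_of_isProbabilityMeasure _ _

variable [NeZero d]

/-- Eigenvalues can appear in any order on the diagonal of a triangular form, so the parameters
sorted along a single `σ` already reach every generic tuple. -/
lemma tupleSet_sortSet (σ : Equiv.Perm (Fin n)) :
    tupleSet (sortSet d σ) Set.univ = genericSet d n := by
  ext X
  constructor
  · rintro ⟨x, hx, U, -, rfl⟩
    exact ⟨U, lamOf x, uppOf x, sortedBy_subset_generic σ hx, rfl⟩
  · rintro ⟨U, l, a, hl, rfl⟩
    obtain ⟨τ, hτ⟩ := exists_mem_sortedBy hl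
    -- Reindexing by `τ σ⁻¹` turns a tuple sorted along `τ` into one sorted along `σ`.
    obtain ⟨V, b, hX⟩ := exists_uconj_triTuple_comp l a U (τ * σ⁻¹)
    refine ⟨WithLp.toLp 2 (Sum.elim (fun p => l ((τ * σ⁻¹ : Equiv.Perm (Fin n)) p.1) p.2) b), ?_,
      V, trivial, hX⟩
    have h3 : StrictMono fun i => embeddingReal ℂ (l ((τ * σ⁻¹ : Equiv.Perm (Fin n)) (σ i)) 0) := by
      have e : ∀ i, (τ * σ⁻¹ : Equiv.Perm (Fin n)) (σ i) = τ i := fun i => by simp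
      simp only [e]
      exact hτ
    exact h3

/-- The measure with density `C · tubeJac`. -/
noncomputable def jacMeasure (C : ℝ) : Measure (DiagUni d n) :=
  volume.withDensity fun x => ENNReal.ofReal C * ENNReal.ofReal (tubeJac x)

omit [NeZero d] in
lemma measurable_ofReal_tubeJac :
    Measurable fun x : DiagUni d n => ENNReal.ofReal (tubeJac x) :=
  ENNReal.measurable_ofReal.comp continuous_tubeJac.measurable

omit [NeZero d] in
lemma jacMeasure_apply (C : ℝ) {A : Set (DiagUni d n)} (hA : MeasurableSet A) :
    jacMeasure C A = ENNReal.ofReal C * jacInt A := by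
  rw [jacMeasure, withDensity_apply _ hA, jacInt, lintegral_const_mul _ measurable_ofReal_tubeJac]

omit [NeZero d] in
lemma measurePreserving_torusAct_jacMeasure (C : ℝ) {t : Matrix.unitaryGroup (Fin n) ℂ}
    (ht : t ∈ diagTorus n) :
    MeasurePreserving (torusAct t : DiagUni d n → DiagUni d n) (jacMeasure C) (jacMeasure C) := by
  have h := measurePreserving_torusAct (d := d) ht
  refine ⟨h.measurable, Measure.ext fun B hB => ?_⟩
  rw [Measure.map_apply h.measurable hB, jacMeasure_apply C (h.measurable hB),
    jacMeasure_apply C hB, jacInt, jacInt,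
    ← h.setLIntegral_comp_preimage hB measurable_ofReal_tubeJac]
  simp only [tubeJac_torusAct ht]

omit [NeZero d] in
lemma measurePreserving_uconj (U : Matrix.unitaryGroup (Fin n) ℂ) :
    MeasurePreserving (uconj U) (tupleVol d n) (tupleVol d n) := by
  refine ⟨(isometry_uconj U).continuous.measurable, ?_⟩
  rw [(isometry_uconj U).map_euclideanHausdorffMeasure]
  have h : Set.range (uconj U : MatTuple d n → MatTuple d n) = Set.univ :=
    Set.range_eq_univ.2 fun X => ⟨uconj U⁻¹ X, uconj_uconj_inv U X⟩
  rw [h, Measure.restrict_univ]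

lemma uconj_preimage_genericSet (U : Matrix.unitaryGroup (Fin n) ℂ) :
    uconj U ⁻¹' genericSet d n = genericSet d n := by
  ext X
  constructor
  · rintro ⟨V, l, a, hl, h⟩
    exact ⟨U⁻¹ * V, l, a, hl, by rw [uconj_mul, ← h, uconj_inv_uconj]⟩
  · rintro ⟨V, l, a, hl, rfl⟩
    exact ⟨U * V, l, a, hl, (uconj_mul _ _ _).symm⟩

lemma measurableSet_genericSet : MeasurableSet (genericSet d n) := by
  rw [← tupleSet_sortSet 1]
  exact measurableSet_tupleSet (torusInvariant_sortSet 1) subset_rfl (measurableSet_sortSet 1)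
    MeasurableSet.univ

variable {C : ℝ} (hC : 0 < C)
  (hlim : Filter.Tendsto (fun ε : ℝ => skewVol n {S | ‖S‖ < ε} / nu n (expBall n ε)) (𝓝[>] 0)
      (𝓝 (ENNReal.ofReal C)))

-- For a conjugation-invariant `H`, the generic tuples with `H` in a given set come from a
-- torus-invariant set of sorted parameters, whose measure is known. So the push-forwards under `H`
-- agree.
include hC hlim in
lemma lintegral_genericSet_of_invariant (σ : Equiv.Perm (Fin n)) {H : MatTuple d n → ℝ≥0∞}
    (hH : Measurable H) (hinv : ∀ U X, H (uconj U X) = H X) :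
    ∫⁻ X in genericSet d n, H X ∂tupleVol d n =
      ∫⁻ x in sortSet d σ, H (triParam d n x) ∂jacMeasure C := by
  have hHT : Measurable fun x => H (triParam d n x) :=
    Measurable.comp hH (continuous_triParam (d := d) (n := n)).measurable
  have hmap : ((tupleVol d n).restrict (genericSet d n)).map H =
      ((jacMeasure C).restrict (sortSet d σ)).map fun x => H (triParam d n x) := by
    refine Measure.ext fun B hB => ?_
    rw [Measure.map_apply hH hB, Measure.map_apply hHT hB, Measure.restrict_apply (hH hB),
      Measure.restrict_apply (hHT hB)]
    have hAm : MeasurableSet ((fun x => H (triParam d n x)) ⁻¹' B ∩ sortSet d σ) :=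
      (hHT hB).inter (measurableSet_sortSet σ)
    rw [jacMeasure_apply C hAm, ← tupleVol_tupleSet hC hlim (σ := σ) ?_ Set.inter_subset_right hAm,
      ← tupleSet_sortSet σ]
    · congr 1
      ext X
      constructor
      · rintro ⟨hX, x, hx, U, -, rfl⟩
        exact ⟨x, ⟨by simpa only [Set.mem_preimage, hinv] using hX, hx⟩, U, trivial, rfl⟩
      · rintro ⟨x, ⟨hX, hx⟩, U, -, rfl⟩
        exact ⟨by simpa only [Set.mem_preimage, hinv] using hX, x, hx, U, trivial, rfl⟩
    · rintro t ht x ⟨hx1, hx2⟩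
      refine ⟨?_, torusInvariant_sortSet σ t ht x hx2⟩
      simpa only [Set.mem_preimage, triParam_torusAct ht, hinv] using hx1
  have h1 := lintegral_map (μ := (tupleVol d n).restrict (genericSet d n)) measurable_id hH
  have h2 := lintegral_map (μ := (jacMeasure C).restrict (sortSet d σ)) measurable_id hHT
  rw [hmap, h2] at h1
  exact h1.symm

/-- The pieces from the compact exhaustion have finite measure. The exchange of integrals with Haar
measure below relies on this. -/
instance : SigmaFinite ((tupleVol d n).restrict (genericSet d n)) := by
  let A : ℕ → Set (DiagUni d n) := fun k => sortSet d 1 ∩ genericCompact d n k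
  have hcover : genericSet d n = ⋃ k, tupleSet (A k) Set.univ := by
    rw [← tupleSet_iUnion_left, ← tupleSet_sortSet 1, ← Set.inter_iUnion]
    congr 1
    exact (Set.inter_eq_left.2 fun x hx => Set.mem_iUnion.2
      (exists_mem_genericCompact (sortedBy_subset_generic 1 hx))).symm
  refine ⟨⟨⟨fun k => tupleSet (A k) Set.univ ∪ (genericSet d n)ᶜ, fun _ => trivial, fun k => ?_,
    ?_⟩⟩⟩
  · have h1 := tupleVol_tupleSet_ne_top (k := k) (A := A k)
      ((torusInvariant_sortSet 1).inter (torusInvariant_genericCompact k)) Set.inter_subset_left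
      Set.inter_subset_right
      ((measurableSet_sortSet 1).inter (isCompact_genericCompact k).measurableSet)
    rw [Measure.restrict_apply' measurableSet_genericSet]
    refine (measure_mono ?_).trans_lt h1.lt_top
    rintro X ⟨hX | hX, hX'⟩
    · exact hX
    · exact absurd hX' hX
  · rw [← Set.iUnion_union, ← hcover, Set.union_compl_self]

include hC hlim in
/-- The change of variables from tuples to parameters sorted along `σ`. -/
lemma lintegral_genericSet (σ : Equiv.Perm (Fin n))
    {s : FlagSpace n → Matrix.unitaryGroup (Fin n) ℂ} (hs : IsSection s)
    {F : MatTuple d n → ℝ≥0∞} (hF : Measurable F) :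
    ∫⁻ X in genericSet d n, F X ∂tupleVol d n =
      ∫⁻ p in sortSet d σ ×ˢ Set.univ, F (flagParam s p) ∂(jacMeasure C).prod (nu n) := by
  have : SFinite (jacMeasure (d := d) (n := n) C) := by unfold jacMeasure; infer_instance
  have hFu : Measurable fun p : MatTuple d n × Matrix.unitaryGroup (Fin n) ℂ =>
      F (uconj p.2 p.1) := hF.comp (measurable_uconj_of measurable_snd measurable_fst)
  -- Averaging over `U(n)` reduces to the invariant case: `H` is invariant by right invariance of
  -- Haar measure, and has the same integral as `F` because conjugations preserve the measure and
  -- `genericSet`.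
  let H : MatTuple d n → ℝ≥0∞ := fun X => ∫⁻ g, F (uconj g X) ∂haarU n
  have hH : Measurable H := hFu.lintegral_prod_right'
  have hinv : ∀ U X, H (uconj U X) = H X := by
    intro U X
    change ∫⁻ g, F (uconj g (uconj U X)) ∂haarU n = ∫⁻ g, F (uconj g X) ∂haarU n
    simp only [← uconj_mul]
    exact lintegral_mul_right_eq_self (fun g => F (uconj g X)) U
  have hleft : ∫⁻ X in genericSet d n, H X ∂tupleVol d n =
      ∫⁻ X in genericSet d n, F X ∂tupleVol d n := by
    change ∫⁻ X in genericSet d n, ∫⁻ g, F (uconj g X) ∂haarU n ∂tupleVol d n = _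
    rw [lintegral_lintegral_swap hFu.aemeasurable]
    have h1 : ∀ g, ∫⁻ X in genericSet d n, F (uconj g X) ∂tupleVol d n =
        ∫⁻ X in genericSet d n, F X ∂tupleVol d n := by
      intro g
      have h2 := (measurePreserving_uconj (d := d) g).setLIntegral_comp_preimage
        measurableSet_genericSet hF
      rwa [uconj_preimage_genericSet] at h2
    simp only [h1, lintegral_const, measure_univ, mul_one]
  have hTm : Measurable fun p : DiagUni d n × Matrix.unitaryGroup (Fin n) ℂ =>
      F (uconj p.2 (triParam d n p.1)) :=
    hF.comp (measurable_uconj_of measurable_snd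
      (Measurable.comp (g := triParam d n) continuous_triParam.measurable measurable_fst))
  have hsm : Measurable fun p : DiagUni d n × FlagSpace n => F (flagParam s p) :=
    hF.comp (measurable_flagParam hs)
  rw [← hleft, lintegral_genericSet_of_invariant hC hlim σ hH hinv]
  change ∫⁻ x in sortSet d σ, ∫⁻ g, F (uconj g (triParam d n x)) ∂haarU n ∂jacMeasure C = _
  rw [lintegral_lintegral_swap hTm.aemeasurable]
  -- For fixed `g`, passing to the representative of its class is a torus action on the parameters,
  -- which preserves `jacMeasure` and the sorted set. Afterwards only the class of `g` matters, and
  -- Haar measure pushes forward to `ν`.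
  have hg : ∀ g : Matrix.unitaryGroup (Fin n) ℂ,
      ∫⁻ x in sortSet d σ, F (uconj g (triParam d n x)) ∂jacMeasure C =
        ∫⁻ x in sortSet d σ, F (flagParam s (x, QuotientGroup.mk g)) ∂jacMeasure C := by
    intro g
    have ht : (s (QuotientGroup.mk g))⁻¹ * g ∈ diagTorus n := QuotientGroup.eq.1 (hs.2 _)
    have h1 : ∀ x, F (uconj g (triParam d n x)) =
        F (flagParam s (torusAct ((s (QuotientGroup.mk g))⁻¹ * g) x, QuotientGroup.mk g)) := by
      intro x
      rw [flagParam, triParam_torusAct ht, ← uconj_mul, mul_inv_cancel_left]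
    simp only [h1]
    exact (measurePreserving_torusAct_jacMeasure (d := d) C ht).setLIntegral_comp_preimage
      (measurableSet_sortSet σ) (hsm.comp measurable_prodMk_right)
  simp only [hg]
  have hsm' : Measurable fun p : FlagSpace n × DiagUni d n => F (flagParam s (p.2, p.1)) :=
    hsm.comp measurable_swap
  have h2 : Measurable fun u : FlagSpace n =>
      ∫⁻ x in sortSet d σ, F (flagParam s (x, u)) ∂jacMeasure C :=
    hsm'.lintegral_prod_right'
  rw [← lintegral_map (μ := haarU n) h2 measurable_mk]
  change ∫⁻ u, ∫⁻ x in sortSet d σ, F (flagParam s (x, u)) ∂jacMeasure C ∂nu n = _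
  rw [lintegral_lintegral_swap hsm'.aemeasurable, ← Measure.prod_restrict, Measure.restrict_univ,
    lintegral_prod _ hsm.aemeasurable]

end ChangeOfVariables

end CommTuple

lemma MeasureTheory.volume_preserving_sigmaUncurry (ι κ : Type*) [Fintype ι] [Fintype κ] :
    MeasurePreserving (fun (f : ι → κ → ℝ) (p : Σ _ : ι, κ) => f p.1 p.2) := by
  have hm : Measurable fun (f : ι → κ → ℝ) (p : Σ _ : ι, κ) => f p.1 p.2 :=
    measurable_pi_lambda _ fun p => (measurable_pi_apply p.2).comp (measurable_pi_apply p.1)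
  refine ⟨hm, (Measure.pi_eq fun s hs => ?_).symm⟩
  rw [Measure.map_apply hm (MeasurableSet.univ_pi hs)]
  have h : (fun (f : ι → κ → ℝ) (p : Σ _ : ι, κ) => f p.1 p.2) ⁻¹' Set.univ.pi s =
      Set.univ.pi fun i => Set.univ.pi fun j => s ⟨i, j⟩ := by
    ext f
    simp only [Set.mem_preimage, Set.mem_univ_pi, Sigma.forall]
  rw [h, volume_pi_pi, Fintype.prod_sigma]
  simp only [volume_pi_pi]

lemma EuclideanSpace.volume_preserving_toLp_complex (ι : Type*) [Fintype ι] :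
    MeasurePreserving (WithLp.toLp 2 : (ι → ℂ) → EuclideanSpace ℂ ι) := by
  let b : OrthonormalBasis (Σ _ : ι, Fin 2) ℝ (EuclideanSpace ℂ ι) :=
    Pi.orthonormalBasis fun _ : ι => Complex.orthonormalBasisOneI
  have h1 := volume_preserving_pi (α' := fun _ : ι => ℂ) (β' := fun _ : ι => Fin 2 → ℝ)
    (f := fun _ => Complex.measurableEquivPi) fun _ => Complex.volume_preserving_equiv_pi
  have h2 := volume_preserving_sigmaUncurry ι (Fin 2)
  have h3 := PiLp.volume_preserving_toLp (Σ _ : ι, Fin 2)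
  have h4 := (b.measurePreserving_repr_symm.comp h3).comp (h2.comp h1)
  have h5 : (b.repr.symm ∘ WithLp.toLp 2) ∘ (fun (f : ι → Fin 2 → ℝ) (p : Σ _ : ι, Fin 2) =>
      f p.1 p.2) ∘ (fun (a : ι → ℂ) i => Complex.measurableEquivPi (a i)) = WithLp.toLp 2 := by
    funext z
    refine b.repr.injective ?_
    ext ⟨i, k⟩
    have e1 : b.repr (WithLp.toLp 2 z) ⟨i, k⟩ = Complex.orthonormalBasisOneI.repr (z i) k := rfl
    rw [e1, Function.comp_apply, Function.comp_apply, LinearIsometryEquiv.apply_symm_apply]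
    fin_cases k <;> rfl
  rw [h5] at h4
  exact h4

namespace CommTuple

variable {d n : ℕ}

/-! ### Lebesgue measure in the coordinates `(λ, A)` -/

section Coordinates

/-- The Euclidean coordinates of the pair `(λ, A)`. -/
noncomputable def toDiagUni (p : (Fin n → Fin d → ℂ) × (UpperIdx n → ℂ)) : DiagUni d n :=
  WithLp.toLp 2 (Sum.elim (fun q => p.1 q.1 q.2) p.2)

@[simp] lemma lamOf_toDiagUni (p : (Fin n → Fin d → ℂ) × (UpperIdx n → ℂ)) :
    lamOf (toDiagUni p) = p.1 := rfl

@[simp] lemma uppOf_toDiagUni (p : (Fin n → Fin d → ℂ) × (UpperIdx n → ℂ)) :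
    uppOf (toDiagUni p) = p.2 := rfl

lemma measurePreserving_toDiagUni :
    MeasurePreserving (toDiagUni (d := d) (n := n)) (volume.prod volume) volume := by
  let g : (Fin n → Fin d → ℂ) × (UpperIdx n → ℂ) → ((Fin n × Fin d) ⊕ UpperIdx n → ℂ) :=
    fun p => Sum.elim (fun q => p.1 q.1 q.2) p.2
  have hg : MeasurePreserving g (volume.prod volume) volume := by
    have hm : Measurable g := by
      refine measurable_pi_lambda _ fun k => ?_
      rcases k with k | k
      · have h1 : Measurable fun l : Fin n → Fin d → ℂ => l k.1 k.2 :=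
          (measurable_pi_apply k.2).comp (measurable_pi_apply k.1)
        exact h1.comp measurable_fst
      · exact (measurable_pi_apply k).comp measurable_snd
    refine ⟨hm, (Measure.pi_eq fun s hs => ?_).symm⟩
    rw [Measure.map_apply hm (MeasurableSet.univ_pi hs)]
    have h : g ⁻¹' Set.univ.pi s =
        (Set.univ.pi fun j => Set.univ.pi fun r => s (Sum.inl (j, r))) ×ˢ
          Set.univ.pi fun p => s (Sum.inr p) := by
      ext p
      simp only [Set.mem_preimage, Set.mem_univ_pi, Sum.forall, Set.mem_prod, Prod.forall]
      rfl
    rw [h, Measure.prod_prod, volume_pi_pi, volume_pi_pi, Fintype.prod_sum_type,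
      Fintype.prod_prod_type]
    simp only [volume_pi_pi]
  exact (EuclideanSpace.volume_preserving_toLp_complex _).comp hg

lemma measurableEmbedding_toDiagUni : MeasurableEmbedding (toDiagUni (d := d) (n := n)) := by
  refine MeasurableEmbedding.of_measurable_inverse (g := fun x => (lamOf x, uppOf x))
    measurePreserving_toDiagUni.measurable ?_ ?_ fun p => rfl
  · have : Set.range (toDiagUni (d := d) (n := n)) = Set.univ :=
      Set.range_eq_univ.2 fun x => ⟨(lamOf x, uppOf x), eq_of_lamOf_of_uppOf rfl rfl⟩
    rw [this]
    exact MeasurableSet.univ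
  · exact continuous_lamOf.measurable.prodMk (measurable_pi_lambda _ fun p =>
      (contDiff_coord (m := 0) (Sum.inr p)).continuous.measurable)

/-- Parameters of `fullParam` in Euclidean coordinates. -/
noncomputable def toDiagFlag (p : (Fin n → Fin d → ℂ) × (UpperIdx n → ℂ) × FlagSpace n) :
    DiagUni d n × FlagSpace n := (toDiagUni (p.1, p.2.1), p.2.2)

lemma flagParam_toDiagFlag (s : FlagSpace n → Matrix.unitaryGroup (Fin n) ℂ)
    (p : (Fin n → Fin d → ℂ) × (UpperIdx n → ℂ) × FlagSpace n) :
    flagParam s (toDiagFlag p) = fullParam s p := rfl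

lemma measurePreserving_toDiagFlag :
    MeasurePreserving (toDiagFlag (d := d) (n := n)) (volume.prod (volume.prod (nu n)))
      (volume.prod (nu n)) := by
  have h1 : MeasurePreserving (MeasurableEquiv.prodAssoc (α := Fin n → Fin d → ℂ)
      (β := UpperIdx n → ℂ) (γ := FlagSpace n)).symm (volume.prod (volume.prod (nu n)))
      ((volume.prod volume).prod (nu n)) :=
    (measurePreserving_prodAssoc _ _ _).symm
  exact (measurePreserving_toDiagUni.prod (MeasurePreserving.id (nu n))).comp h1

lemma measurableEmbedding_toDiagFlag : MeasurableEmbedding (toDiagFlag (d := d) (n := n)) :=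
  (measurableEmbedding_toDiagUni.prodMap MeasurableEmbedding.id).comp
    (MeasurableEquiv.prodAssoc (α := Fin n → Fin d → ℂ)
      (β := UpperIdx n → ℂ) (γ := FlagSpace n)).symm.measurableEmbedding

end Coordinates

/-! ### Splitting the Gaussian weight -/

section Densities

/-- `A D A⁻¹` has the diagonal of `D`, so `A D A⁻¹ - D` is supported off the diagonal and is
orthogonal to `D`. -/
lemma norm_sq_triTuple (l : Fin n → Fin d → ℂ) (a : UpperIdx n → ℂ) :
    ‖(triTuple l a : MatTuple d n)‖ ^ 2 =
      ‖(diagTuple l : MatTuple d n)‖ ^ 2 + ‖(triTuple l a : MatTuple d n) - diagTuple l‖ ^ 2 := by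
  rw [norm_sq_eq_sum_comp, norm_sq_eq_sum_comp, norm_sq_eq_sum_comp, ← Finset.sum_add_distrib]
  refine Finset.sum_congr rfl fun r _ => ?_
  rw [← Finset.sum_add_distrib]
  refine Finset.sum_congr rfl fun i _ => ?_
  rw [← Finset.sum_add_distrib]
  refine Finset.sum_congr rfl fun j _ => ?_
  have h : comp (triTuple l a - diagTuple l) r i j =
      comp (triTuple l a) r i j - comp (diagTuple l) r i j := rfl
  rw [h]
  by_cases hij : i = j
  · subst hij
    rw [comp_triTuple_diag, comp_diagTuple, Matrix.diagonal_apply_eq]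
    simp
  · rw [comp_diagTuple, Matrix.diagonal_apply_ne _ hij]
    simp

lemma gauss_mul (c₁ c₂ γ s t : ℝ) : gauss c₁ γ s * gauss c₂ γ t = gauss (c₁ * c₂) γ (s + t) := by
  rw [gauss, gauss, gauss, mul_add, Real.exp_add]
  ring

/-- The Gaussian weight on tuples. -/
noncomputable def weight (c γ : ℝ) (X : MatTuple d n) : ℝ≥0∞ := ENNReal.ofReal (gauss c γ (‖X‖ ^ 2))

lemma measurable_weight (c γ : ℝ) : Measurable (weight (d := d) (n := n) c γ) := by
  refine ENNReal.measurable_ofReal.comp (Continuous.measurable ?_)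
  unfold gauss
  fun_prop

lemma weight_uconj (c γ : ℝ) (U : Matrix.unitaryGroup (Fin n) ℂ) (X : MatTuple d n) :
    weight c γ (uconj U X) = weight c γ X := by
  rw [weight, weight, norm_uconj]

variable [NeZero d]

/-- The density of the parameters in terms of the Jacobian of `tubeParam`. -/
lemma gauss_mul_innerDensity {l : Fin n → Fin d → ℂ} (hl : l ∈ Generic d n) (a : UpperIdx n → ℂ)
    (c₁ c₂ γ : ℝ) :
    gauss c₁ γ (‖(diagTuple l : MatTuple d n)‖ ^ 2) * innerDensity (gauss c₂ γ) l a =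
      gauss (c₁ * c₂) γ (‖triParam d n (toDiagUni (l, a))‖ ^ 2) * tubeJac (toDiagUni (l, a)) := by
  rw [tubeJac_eq (x := toDiagUni (l, a)) hl, triParam_eq, lamOf_toDiagUni, uppOf_toDiagUni,
    norm_sq_triTuple, ← gauss_mul, innerDensity]
  ring

lemma ofReal_density {l : Fin n → Fin d → ℂ} (hl : l ∈ Generic d n) (a : UpperIdx n → ℂ)
    {K c₁ c₂ : ℝ} (γ : ℝ) (hK : 0 ≤ K) (h₁ : 0 < c₁) (h₂ : 0 < c₂) :
    ENNReal.ofReal (K * gauss c₁ γ (‖(diagTuple l : MatTuple d n)‖ ^ 2) *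
        innerDensity (gauss c₂ γ) l a) =
      ENNReal.ofReal K * ENNReal.ofReal (tubeJac (toDiagUni (l, a))) *
        weight (c₁ * c₂) γ (triParam d n (toDiagUni (l, a))) := by
  have hg : 0 ≤ gauss (c₁ * c₂) γ (‖triParam d n (toDiagUni (l, a))‖ ^ 2) := by
    unfold gauss; positivity
  rw [mul_assoc, gauss_mul_innerDensity hl, ENNReal.ofReal_mul hK, ENNReal.ofReal_mul hg, weight]
  ring

end Densities

end CommTuple

namespace CommTuple

variable {d n : ℕ} [NeZero d]

/-! ### Parameter densities as weighted Jacobian measures -/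

section Parameters

lemma ae_lamOf_mem_generic :
    ∀ᵐ q ∂(volume : Measure (DiagUni d n)).prod (nu n), lamOf q.1 ∈ Generic d n := by
  have h : {q : DiagUni d n × FlagSpace n | ¬ lamOf q.1 ∈ Generic d n} =
      {x : DiagUni d n | lamOf x ∉ Generic d n} ×ˢ Set.univ := by
    ext q; simp
  rw [ae_iff, h, Measure.prod_prod, volume_not_generic, zero_mul]

lemma ae_mem_generic :
    ∀ᵐ l : Fin n → Fin d → ℂ, l ∈ Generic d n := by
  have h1 : (volume.prod volume) {p : (Fin n → Fin d → ℂ) × (UpperIdx n → ℂ) |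
      p.1 ∉ Generic d n} = 0 := by
    have h2 := (measurePreserving_toDiagUni (d := d) (n := n)).measure_preimage_emb
      measurableEmbedding_toDiagUni {x | lamOf x ∉ Generic d n}
    rw [volume_not_generic] at h2
    exact h2
  have h3 : {p : (Fin n → Fin d → ℂ) × (UpperIdx n → ℂ) | p.1 ∉ Generic d n} =
      {l | l ∉ Generic d n} ×ˢ Set.univ := by
    ext p; simp
  rw [h3, Measure.prod_prod, mul_eq_zero] at h1
  exact h1.resolve_right (isOpen_univ.measure_pos volume ⟨0, trivial⟩).ne'

omit [NeZero d] in
lemma measurable_jacDensity (K : ℝ) :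
    Measurable fun x : DiagUni d n => ENNReal.ofReal K * ENNReal.ofReal (tubeJac x) :=
  measurable_ofReal_tubeJac.const_mul _

omit [NeZero d] in
lemma jacMeasure_prod (K : ℝ) : (jacMeasure (d := d) K).prod (nu n) =
    ((volume : Measure (DiagUni d n)).prod (nu n)).withDensity
      fun q => ENNReal.ofReal K * ENNReal.ofReal (tubeJac q.1) :=
  prod_withDensity_left (measurable_jacDensity K)

omit [NeZero d] in
lemma jacMeasure_mul (K C : ℝ) (hK : 0 ≤ K) :
    jacMeasure (d := d) (n := n) (K * C) = ENNReal.ofReal K • jacMeasure C := by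
  rw [jacMeasure, jacMeasure, ← withDensity_smul _ (measurable_jacDensity C)]
  congr 1
  funext x
  rw [ENNReal.ofReal_mul hK, Pi.smul_apply, smul_eq_mul, mul_assoc]

/-- Rewrites the explicit density as the weight on tuples times the Jacobian of the tube. The two
agree only for generic `λ`, hence almost everywhere. -/
lemma lintegral_paramDensity {s : FlagSpace n → Matrix.unitaryGroup (Fin n) ℂ} (hs : IsSection s)
    {K c₁ c₂ : ℝ} (γ : ℝ) (hK : 0 ≤ K) (h₁ : 0 < c₁) (h₂ : 0 < c₂) {F : MatTuple d n → ℝ≥0∞}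
    (hF : Measurable F) {B : Set ((Fin n → Fin d → ℂ) × (UpperIdx n → ℂ) × FlagSpace n)}
    (hB : MeasurableSet B) :
    ∫⁻ p in B, F (fullParam s p) * ENNReal.ofReal
        (K * gauss c₁ γ (‖(diagTuple p.1 : MatTuple d n)‖ ^ 2) *
          innerDensity (gauss c₂ γ) p.1 p.2.1) ∂(volume.prod (volume.prod (nu n))) =
      ∫⁻ q in toDiagFlag '' B, F (flagParam s q) * weight (c₁ * c₂) γ (flagParam s q)
        ∂(jacMeasure K).prod (nu n) := by
  have hG : Measurable fun q : DiagUni d n × FlagSpace n =>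
      F (flagParam s q) * weight (c₁ * c₂) γ (flagParam s q) :=
    (hF.mul (measurable_weight _ _)).comp (measurable_flagParam hs)
  have hJ : Measurable fun q : DiagUni d n × FlagSpace n =>
      ENNReal.ofReal K * ENNReal.ofReal (tubeJac q.1) :=
    (measurable_jacDensity K).comp measurable_fst
  rw [jacMeasure_prod, setLIntegral_withDensity_eq_setLIntegral_mul _ hJ hG
    (measurableEmbedding_toDiagFlag.measurableSet_image.2 hB),
    ← measurePreserving_toDiagFlag.setLIntegral_comp_emb measurableEmbedding_toDiagFlag]
  refine lintegral_congr_ae (ae_restrict_of_ae ?_)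
  filter_upwards [measurePreserving_toDiagFlag.quasiMeasurePreserving.ae
    (ae_lamOf_mem_generic (d := d) (n := n))] with p hp
  rw [ofReal_density (l := p.1) hp _ _ hK h₁ h₂, Pi.mul_apply, flagParam_toDiagFlag]
  have h3 : weight (c₁ * c₂) γ (fullParam s p) =
      weight (c₁ * c₂) γ (triParam d n (toDiagUni (p.1, p.2.1))) := weight_uconj _ _ _ _
  have h4 : (toDiagFlag p).1 = toDiagUni (p.1, p.2.1) := rfl
  rw [h3, h4]
  ring

end Parameters

/-! ### Transport of measure, locally and globally -/

section Transport

variable {C : ℝ} (hC : 0 < C)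
  (hlim : Filter.Tendsto (fun ε : ℝ => skewVol n {S | ‖S‖ < ε} / nu n (expBall n ε)) (𝓝[>] 0)
      (𝓝 (ENNReal.ofReal C)))

-- Apply the global formula to `G` times the indicator of the image. By injectivity on sorted
-- parameters, that indicator pulls back to the indicator of `B`.
include hC hlim in
lemma setLIntegral_image_sorted {σ : Equiv.Perm (Fin n)}
    {s : FlagSpace n → Matrix.unitaryGroup (Fin n) ℂ} (hs : IsSection s)
    {G : MatTuple d n → ℝ≥0∞} (hG : Measurable G) {B : Set (DiagUni d n × FlagSpace n)}
    (hB : MeasurableSet B) (hBσ : B ⊆ sortSet d σ ×ˢ Set.univ) :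
    ∫⁻ X in flagParam s '' B, G X ∂tupleVol d n =
      ∫⁻ q in B, G (flagParam s q) ∂(jacMeasure C).prod (nu n) := by
  have hinj := injOn_flagParam (d := d) hs σ
  have hR : MeasurableSet (flagParam s '' B) :=
    hB.image_of_measurable_injOn (measurable_flagParam hs) (hinj.mono hBσ)
  have hRW : flagParam s '' B ⊆ genericSet d n := by
    rintro _ ⟨q, hq, rfl⟩
    exact ⟨s q.2, lamOf q.1, uppOf q.1, sortedBy_subset_generic σ (hBσ hq).1, rfl⟩
  have h1 := lintegral_genericSet hC hlim σ hs (hG.indicator hR)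
  rw [setLIntegral_indicator hR, Set.inter_eq_left.2 hRW] at h1
  rw [h1, ← Set.inter_eq_left.2 hBσ, ← setLIntegral_indicator hB]
  refine setLIntegral_congr_fun ((measurableSet_sortSet σ).prod MeasurableSet.univ) fun q hq => ?_
  by_cases hqB : q ∈ B
  · rw [Set.indicator_of_mem (Set.mem_image_of_mem _ (by rwa [Set.inter_eq_left.2 hBσ])),
      Set.indicator_of_mem hqB]
  · rw [Set.indicator_of_notMem, Set.indicator_of_notMem hqB]
    rintro ⟨q', hq', h⟩
    rw [Set.inter_eq_left.2 hBσ] at hq'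
    exact hqB (hinj (hBσ hq') hq h ▸ hq')

/-- Almost every set of parameters splits according to the sorting permutation. -/
lemma lintegral_eq_sum_sorted (K : ℝ) {g : DiagUni d n × FlagSpace n → ℝ≥0∞}
    {B : Set (DiagUni d n × FlagSpace n)} (hB : MeasurableSet B) :
    ∫⁻ q in B, g q ∂(jacMeasure K).prod (nu n) =
      ∑ σ : Equiv.Perm (Fin n), ∫⁻ q in B ∩ sortSet d σ ×ˢ Set.univ, g q
        ∂(jacMeasure K).prod (nu n) := by
  have hac : (jacMeasure (d := d) K).prod (nu n) ≪
      (volume : Measure (DiagUni d n)).prod (nu n) := by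
    rw [jacMeasure_prod]
    exact withDensity_absolutelyContinuous _ _
  have hE : ∀ σ : Equiv.Perm (Fin n),
      MeasurableSet (sortSet d σ ×ˢ (Set.univ : Set (FlagSpace n))) := fun σ =>
    (measurableSet_sortSet σ).prod MeasurableSet.univ
  have hae : (B : Set _) =ᵐ[(jacMeasure (d := d) K).prod (nu n)]
      ⋃ σ : Equiv.Perm (Fin n), B ∩ sortSet d σ ×ˢ Set.univ := by
    rw [← Set.inter_iUnion]
    filter_upwards [hac (ae_lamOf_mem_generic (d := d) (n := n))] with q hq
    obtain ⟨σ, hσ⟩ := exists_mem_sortedBy hq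
    refine propext ⟨fun h => ⟨h, Set.mem_iUnion.2 ⟨σ, hσ, trivial⟩⟩, fun h => h.1⟩
  rw [setLIntegral_congr hae, lintegral_iUnion (fun σ => hB.inter (hE σ)), tsum_fintype]
  intro σ τ hστ
  rw [Function.onFun, Set.disjoint_left]
  rintro q ⟨-, h1, -⟩ ⟨-, h2, -⟩
  exact hστ (eq_of_mem_sortedBy h1 h2)

lemma genericSet_subset_commVar : genericSet d n ⊆ commVar d n := by
  rintro X ⟨U, l, a, -, rfl⟩
  exact uconj_mem_commVar (triTuple_mem_commVar l a) U

lemma lintegral_volComm (hnull : volComm d n (genericSet d n)ᶜ = 0) (G : MatTuple d n → ℝ≥0∞) :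
    ∫⁻ X, G X ∂volComm d n = ∫⁻ X in genericSet d n, G X ∂tupleVol d n := by
  have h1 : volComm d n = (tupleVol d n).restrict (genericSet d n) := by
    rw [← Measure.restrict_eq_self_of_ae_mem (μ := volComm d n) (s := genericSet d n) hnull, volComm,
      Measure.restrict_restrict measurableSet_genericSet,
      Set.inter_eq_left.2 genericSet_subset_commVar]
  rw [h1]

-- Cut `B` according to the sorting permutation. Non-generic parameters are null and have
-- non-generic images, since the spectrum can be read off the image; injectivity on `B` makes the
-- images of the pieces disjoint.
include hC hlim in
lemma setLIntegral_image_flagParam (hnull : volComm d n (genericSet d n)ᶜ = 0)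
    {s : FlagSpace n → Matrix.unitaryGroup (Fin n) ℂ} (hs : IsSection s)
    {G : MatTuple d n → ℝ≥0∞} (hG : Measurable G) {B : Set (DiagUni d n × FlagSpace n)}
    (hB : MeasurableSet B) (hinj : Set.InjOn (flagParam s) B) :
    ∫⁻ X in flagParam s '' B, G X ∂volComm d n =
      ∫⁻ q in B, G (flagParam s q) ∂(jacMeasure C).prod (nu n) := by
  have hE : ∀ σ : Equiv.Perm (Fin n),
      MeasurableSet (B ∩ sortSet d σ ×ˢ (Set.univ : Set (FlagSpace n))) := fun σ =>
    hB.inter ((measurableSet_sortSet σ).prod MeasurableSet.univ)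
  have hR : MeasurableSet (flagParam s '' B) :=
    hB.image_of_measurable_injOn (measurable_flagParam hs) hinj
  have hsplit : flagParam s '' B ∩ genericSet d n =
      ⋃ σ : Equiv.Perm (Fin n), flagParam s '' (B ∩ sortSet d σ ×ˢ Set.univ) := by
    ext X
    simp only [Set.mem_iUnion]
    constructor
    · rintro ⟨⟨q, hq, rfl⟩, U, l, a, hl, h⟩
      have hgen : lamOf q.1 ∈ Generic d n := by
        have h1 := roots_charpoly_uconj_triTuple (s q.2) (lamOf q.1) (uppOf q.1)
        have h2 : uconj (s q.2) (triTuple (lamOf q.1) (uppOf q.1)) = flagParam s q := rfl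
        rw [h2, h, roots_charpoly_uconj_triTuple] at h1
        obtain ⟨τ, hτ⟩ := exists_perm_of_map_eq hl h1.symm
        have h3 : Function.Injective fun j => lamOf q.1 j 0 := by
          rw [hτ]
          exact Function.Injective.comp hl τ.injective
        exact h3
      obtain ⟨σ, hσ⟩ := exists_mem_sortedBy hgen
      exact ⟨σ, q, ⟨hq, hσ, trivial⟩, rfl⟩
    · rintro ⟨σ, q, ⟨hq, hσ, -⟩, rfl⟩
      exact ⟨⟨q, hq, rfl⟩, s q.2, lamOf q.1, uppOf q.1, sortedBy_subset_generic σ hσ, rfl⟩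
  rw [← lintegral_indicator hR, lintegral_volComm hnull, setLIntegral_indicator hR, hsplit,
    lintegral_iUnion (fun σ => (hE σ).image_of_measurable_injOn (measurable_flagParam hs)
      (hinj.mono Set.inter_subset_left)), tsum_fintype, lintegral_eq_sum_sorted C hB]
  · exact Finset.sum_congr rfl fun σ _ =>
      setLIntegral_image_sorted hC hlim hs hG (hE σ) Set.inter_subset_right
  · intro σ τ hστ
    rw [Function.onFun, Set.disjoint_left]
    rintro X ⟨q, ⟨hq, hσ, -⟩, rfl⟩ ⟨q', ⟨hq', hτ, -⟩, h⟩
    rw [hinj hq' hq h] at hτ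
    exact hστ (eq_of_mem_sortedBy hσ hτ)

-- Each of the `n!` sorting classes parametrizes all generic tuples and contributes the same
-- integral.
include hC hlim in
lemma lintegral_flagParam (hnull : volComm d n (genericSet d n)ᶜ = 0)
    {s : FlagSpace n → Matrix.unitaryGroup (Fin n) ℂ} (hs : IsSection s)
    {G : MatTuple d n → ℝ≥0∞} (hG : Measurable G) :
    ∫⁻ q, G (flagParam s q) ∂(jacMeasure C).prod (nu n) =
      (n.factorial : ℝ≥0∞) * ∫⁻ X, G X ∂volComm d n := by
  rw [lintegral_volComm hnull, ← setLIntegral_univ, lintegral_eq_sum_sorted C MeasurableSet.univ]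
  simp only [Set.univ_inter, ← lintegral_genericSet hC hlim _ hs hG, Finset.sum_const,
    Finset.card_univ, Fintype.card_perm, Fintype.card_fin, nsmul_eq_mul]

end Transport

/-! ### The law of the eigenvalues -/

section Spectrum

/-- A generic tuple has, for each `σ`, exactly one ordering sorted along `σ`, namely `e σ`, and
these are all its `n!` orderings. Counting the orderings in `S` is therefore a sum over `σ`, and
each term is the indicator of a set of tuples given by sorted parameters. -/
lemma orderingProb_eq {X : MatTuple d n} (hX : X ∈ genericSet d n)
    (S : Set (Fin n → Fin d → ℂ)) :
    orderingProb X S = (∑ σ : Equiv.Perm (Fin n),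
      (tupleSet {x : DiagUni d n | x ∈ sortSet d σ ∧ lamOf x ∈ S} Set.univ).indicator 1 X) /
        (n.factorial : ℝ≥0∞) := by
  classical
  obtain ⟨U, l, a, hl, rfl⟩ := hX
  obtain ⟨τ, hτ⟩ := exists_mem_sortedBy hl
  have hord := orderings_uconj_triTuple hl a U
  let e : Equiv.Perm (Fin n) → Fin n → Fin d → ℂ := fun σ => l ∘ (τ * σ⁻¹ : Equiv.Perm (Fin n))
  have he : Function.Injective e := by
    intro σ ρ h
    have h1 : τ * σ⁻¹ = τ * ρ⁻¹ := by
      ext j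
      have h2 : l ((τ * σ⁻¹ : Equiv.Perm (Fin n)) j) = l ((τ * ρ⁻¹ : Equiv.Perm (Fin n)) j) :=
        congrFun h j
      rw [hl (congrFun h2 0)]
    exact inv_injective (mul_left_cancel h1)
  have hrange : orderings (uconj U (triTuple l a)) = Set.range e := by
    rw [hord]
    ext m
    constructor
    · rintro ⟨ρ, rfl⟩
      have h1 : τ * (ρ⁻¹ * τ)⁻¹ = ρ := by group
      exact ⟨ρ⁻¹ * τ, by simp only [e, h1]⟩
    · rintro ⟨σ, rfl⟩
      exact ⟨_, rfl⟩
  have hmem : ∀ σ, e σ ∈ sortedBy d σ := by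
    intro σ
    have h1 : ∀ i, (τ * σ⁻¹ : Equiv.Perm (Fin n)) (σ i) = τ i := fun i => by simp
    have h2 : StrictMono fun i =>
        embeddingReal ℂ (l ((τ * σ⁻¹ : Equiv.Perm (Fin n)) (σ i)) 0) := by
      simp only [h1]
      exact hτ
    exact h2
  have htuple : ∀ σ, uconj U (triTuple l a) ∈
      tupleSet {x : DiagUni d n | x ∈ sortSet d σ ∧ lamOf x ∈ S} Set.univ ↔ e σ ∈ S := by
    intro σ
    constructor
    · rintro ⟨x, ⟨hx, hxS⟩, V, -, h⟩
      have h1 : lamOf x ∈ orderings (uconj U (triTuple l a)) := by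
        rw [h, triParam_eq, orderings_uconj_triTuple (sortedBy_subset_generic σ hx)]
        exact ⟨1, rfl⟩
      rw [hrange] at h1
      obtain ⟨ρ, hρ⟩ := h1
      have hx' : lamOf x ∈ sortedBy d σ := hx
      have h2 : ρ = σ := eq_of_mem_sortedBy (hmem ρ) (hρ ▸ hx')
      rw [← h2, hρ]
      exact hxS
    · intro h
      obtain ⟨V, b, hV⟩ := exists_uconj_triTuple_comp l a U (τ * σ⁻¹)
      exact ⟨toDiagUni (e σ, b), ⟨hmem σ, h⟩, V, trivial, hV⟩
  have hcard : (orderings (uconj U (triTuple l a))).ncard = n.factorial := by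
    rw [hrange, ← Set.image_univ, Set.ncard_image_of_injective _ he, Set.ncard_univ,
      Nat.card_eq_fintype_card, Fintype.card_perm, Fintype.card_fin]
  have hcard2 : (orderings (uconj U (triTuple l a)) ∩ S).ncard =
      (Finset.univ.filter fun σ => e σ ∈ S).card := by
    rw [hrange, Set.inter_comm, ← Set.image_preimage_eq_inter_range,
      Set.ncard_image_of_injective _ he, ← Set.ncard_coe_finset]
    congr 1
    ext σ
    simp
  rw [orderingProb, hcard, hcard2, Finset.card_filter]
  congr 1
  push_cast
  refine Finset.sum_congr rfl fun σ _ => ?_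
  by_cases h : e σ ∈ S
  · rw [Set.indicator_of_mem ((htuple σ).2 h), if_pos h, Pi.one_apply]
  · rw [Set.indicator_of_notMem (fun h' => h ((htuple σ).1 h')), if_neg h]

variable {C : ℝ} (hC : 0 < C)
  (hlim : Filter.Tendsto (fun ε : ℝ => skewVol n {S | ‖S‖ < ε} / nu n (expBall n ε)) (𝓝[>] 0)
      (𝓝 (ENNReal.ofReal C)))

-- Each indicator in `orderingProb_eq` restricts the integral to the image of the parameters sorted
-- along its `σ` with eigenvalues in `S`. Transporting each piece and summing over `σ` reassembles
-- all parameters with eigenvalues in `S`.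
include hC hlim in
lemma lintegral_orderingProb (hnull : volComm d n (genericSet d n)ᶜ = 0)
    {s : FlagSpace n → Matrix.unitaryGroup (Fin n) ℂ} (hs : IsSection s)
    {G : MatTuple d n → ℝ≥0∞} (hG : Measurable G) {S : Set (Fin n → Fin d → ℂ)}
    (hS : MeasurableSet S) :
    ∫⁻ X, orderingProb X S * G X ∂volComm d n = (n.factorial : ℝ≥0∞)⁻¹ *
      ∫⁻ q in {q | lamOf q.1 ∈ S}, G (flagParam s q) ∂(jacMeasure C).prod (nu n) := by
  have hSm : MeasurableSet {x : DiagUni d n | lamOf x ∈ S} :=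
    hS.preimage continuous_lamOf.measurable
  have hSm' : MeasurableSet {q : DiagUni d n × FlagSpace n | lamOf q.1 ∈ S} :=
    hSm.preimage measurable_fst
  have hA : ∀ σ : Equiv.Perm (Fin n),
      MeasurableSet {x : DiagUni d n | x ∈ sortSet d σ ∧ lamOf x ∈ S} := fun σ =>
    (measurableSet_sortSet σ).inter hSm
  have hAinv : ∀ σ : Equiv.Perm (Fin n),
      TorusInvariant {x : DiagUni d n | x ∈ sortSet d σ ∧ lamOf x ∈ S} := fun σ _ _ _ hx => hx
  have hAsub : ∀ σ : Equiv.Perm (Fin n),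
      {x : DiagUni d n | x ∈ sortSet d σ ∧ lamOf x ∈ S} ⊆ sortSet d σ := fun σ _ hx => hx.1
  have hTm : ∀ σ : Equiv.Perm (Fin n), MeasurableSet
      (tupleSet {x : DiagUni d n | x ∈ sortSet d σ ∧ lamOf x ∈ S} Set.univ) := fun σ =>
    measurableSet_tupleSet (hAinv σ) (hAsub σ) (hA σ) MeasurableSet.univ
  rw [lintegral_volComm hnull, lintegral_eq_sum_sorted C hSm', Finset.mul_sum]
  have h1 : ∫⁻ X in genericSet d n, orderingProb X S * G X ∂tupleVol d n =
      ∫⁻ X in genericSet d n, ∑ σ : Equiv.Perm (Fin n), (n.factorial : ℝ≥0∞)⁻¹ *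
        (tupleSet {x : DiagUni d n | x ∈ sortSet d σ ∧ lamOf x ∈ S} Set.univ).indicator G X
        ∂tupleVol d n := by
    refine setLIntegral_congr_fun measurableSet_genericSet fun X hX => ?_
    rw [orderingProb_eq hX, ENNReal.div_eq_inv_mul, mul_assoc, Finset.sum_mul, ← Finset.mul_sum]
    congr 1
    refine Finset.sum_congr rfl fun σ _ => ?_
    by_cases h : X ∈ tupleSet {x : DiagUni d n | x ∈ sortSet d σ ∧ lamOf x ∈ S} Set.univ
    · rw [Set.indicator_of_mem h, Set.indicator_of_mem h, Pi.one_apply, one_mul]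
    · rw [Set.indicator_of_notMem h, Set.indicator_of_notMem h, zero_mul]
  rw [h1, lintegral_finsetSum _ fun σ _ => (hG.indicator (hTm σ)).const_mul _]
  refine Finset.sum_congr rfl fun σ _ => ?_
  rw [lintegral_const_mul _ (hG.indicator (hTm σ)), setLIntegral_indicator (hTm σ)]
  congr 1
  have h2 : tupleSet {x : DiagUni d n | x ∈ sortSet d σ ∧ lamOf x ∈ S} Set.univ ⊆
      genericSet d n := by
    rw [← tupleSet_sortSet σ]
    exact tupleSet_mono (hAsub σ) le_rfl
  have h3 : {x : DiagUni d n | x ∈ sortSet d σ ∧ lamOf x ∈ S} ×ˢ (Set.univ : Set (FlagSpace n)) =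
      {q | lamOf q.1 ∈ S} ∩ sortSet d σ ×ˢ Set.univ := by
    ext q
    constructor
    · rintro ⟨⟨h1, h2⟩, -⟩
      exact ⟨h2, h1, trivial⟩
    · rintro ⟨h2, h1, -⟩
      exact ⟨⟨h1, h2⟩, trivial⟩
  rw [Set.inter_eq_left.2 h2, tupleSet_eq_image hs (hAinv σ), h3]
  exact setLIntegral_image_sorted hC hlim hs hG
    (hSm'.inter ((measurableSet_sortSet σ).prod MeasurableSet.univ)) Set.inter_subset_right

omit [NeZero d] in
lemma inv_factorial_mul_lintegral {K : ℝ} {m : ℕ} (g : DiagUni d n × FlagSpace n → ℝ≥0∞)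
    (B : Set (DiagUni d n × FlagSpace n)) :
    (m.factorial : ℝ≥0∞)⁻¹ * ∫⁻ q in B, g q ∂(jacMeasure K).prod (nu n) =
      ∫⁻ q in B, g q ∂(jacMeasure (K / m.factorial)).prod (nu n) := by
  have h1 : ENNReal.ofReal (m.factorial : ℝ)⁻¹ = (m.factorial : ℝ≥0∞)⁻¹ := by
    rw [ENNReal.ofReal_inv_of_pos (by positivity), ENNReal.ofReal_natCast]
  rw [div_eq_inv_mul, jacMeasure_mul _ _ (by positivity), Measure.prod_smul_left,
    Measure.restrict_smul, lintegral_smul_measure, h1, smul_eq_mul]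

/-- The weight is conjugation invariant and `ν` has mass one, so the class integrates out; Tonelli
then leaves the inner integral over `A`. -/
lemma lintegral_eigenvalueDensity {s : FlagSpace n → Matrix.unitaryGroup (Fin n) ℂ}
    (hs : IsSection s) {K c₁ c₂ : ℝ} (γ : ℝ) (hK : 0 ≤ K) (h₁ : 0 < c₁) (h₂ : 0 < c₂)
    {S : Set (Fin n → Fin d → ℂ)} (hS : MeasurableSet S) :
    ∫⁻ q in {q | lamOf q.1 ∈ S}, weight (c₁ * c₂) γ (flagParam (d := d) s q)
        ∂(jacMeasure K).prod (nu n) =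
      ∫⁻ l in S, ENNReal.ofReal (K * gauss c₁ γ (‖(diagTuple l : MatTuple d n)‖ ^ 2)) *
        ∫⁻ a : UpperIdx n → ℂ, ENNReal.ofReal (innerDensity (gauss c₂ γ) l a) := by
  have hSm : MeasurableSet {x : DiagUni d n | lamOf x ∈ S} :=
    hS.preimage continuous_lamOf.measurable
  have hW : Measurable fun q : DiagUni d n × FlagSpace n =>
      weight (c₁ * c₂) γ (flagParam s q) :=
    (measurable_weight _ _).comp (measurable_flagParam hs)
  have hw : Measurable fun x : DiagUni d n => weight (c₁ * c₂) γ (triParam d n x) :=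
    Measurable.comp (g := weight (c₁ * c₂) γ) (measurable_weight _ _) continuous_triParam.measurable
  have : SFinite (jacMeasure (d := d) (n := n) K) := by unfold jacMeasure; infer_instance
  have hset : {q : DiagUni d n × FlagSpace n | lamOf q.1 ∈ S} =
      {x : DiagUni d n | lamOf x ∈ S} ×ˢ Set.univ := by
    ext q; simp
  have hset2 : toDiagUni (d := d) (n := n) ⁻¹' {x : DiagUni d n | lamOf x ∈ S} =
      S ×ˢ Set.univ := by
    ext p; simp
  have hinner : ∀ x : DiagUni d n, ∫⁻ u, weight (c₁ * c₂) γ (flagParam s (x, u)) ∂nu n =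
      weight (c₁ * c₂) γ (triParam d n x) := by
    intro x
    simp only [flagParam, weight_uconj, lintegral_const, measure_univ, mul_one]
  have hJw : Measurable fun x : DiagUni d n => ENNReal.ofReal K * ENNReal.ofReal (tubeJac x) *
      weight (c₁ * c₂) γ (triParam d n x) := (measurable_jacDensity K).mul hw
  rw [hset, ← Measure.prod_restrict, Measure.restrict_univ, lintegral_prod _ hW.aemeasurable]
  simp only [hinner]
  rw [jacMeasure, setLIntegral_withDensity_eq_setLIntegral_mul _ (measurable_jacDensity K) hw hSm]
  simp only [Pi.mul_apply]
  have hJw' : Measurable fun p : (Fin n → Fin d → ℂ) × (UpperIdx n → ℂ) =>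
      ENNReal.ofReal K * ENNReal.ofReal (tubeJac (toDiagUni p)) *
        weight (c₁ * c₂) γ (triParam d n (toDiagUni p)) :=
    hJw.comp measurePreserving_toDiagUni.measurable
  rw [← measurePreserving_toDiagUni.setLIntegral_comp_preimage hSm hJw, hset2,
    ← Measure.prod_restrict, Measure.restrict_univ, lintegral_prod _ hJw'.aemeasurable]
  refine lintegral_congr_ae (ae_restrict_of_ae ?_)
  filter_upwards [ae_mem_generic (d := d) (n := n)] with l hl
  have hKg : 0 ≤ K * gauss c₁ γ (‖(diagTuple l : MatTuple d n)‖ ^ 2) := by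
    unfold gauss; positivity
  rw [← lintegral_const_mul' _ _ ENNReal.ofReal_ne_top]
  refine lintegral_congr fun a => ?_
  rw [← ENNReal.ofReal_mul hKg, ofReal_density hl _ _ hK h₁ h₂]

end Spectrum

end CommTuple

/-! ### The main theorem -/

theorem theorem4p5 (n : ℕ) (hn : 1 ≤ n) :
    -- the quotient by the torus has measurable choices of representatives
    (∃ s : FlagSpace n → Matrix.unitaryGroup (Fin n) ℂ, IsSection s) ∧
    -- the constant depends on `n` only, and is the Jacobian constant of the exponential map
    ∃ C : ℝ, 0 < C ∧
      Filter.Tendsto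
        (fun ε : ℝ => skewVol n {S | ‖S‖ < ε} / nu n (expBall n ε))
        (𝓝[>] 0) (𝓝 (ENNReal.ofReal C)) ∧
      ∀ (d : ℕ), 1 ≤ d → IsIrreducibleSet (commVar d n) →
      ∀ (γ c₁ c₂ : ℝ), 0 < γ → 0 < c₁ → 0 < c₂ →
        (∀ s : FlagSpace n → Matrix.unitaryGroup (Fin n) ℂ, IsSection s →
          -- where the parametrization is injective, it transports the density to `w(X) dX`
          (∀ B : Set ((Fin n → Fin d → ℂ) × (UpperIdx n → ℂ) × FlagSpace n),
            MeasurableSet B → Set.InjOn (fullParam s) B →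
            ∀ F : MatTuple d n → ℝ≥0∞, Measurable F →
              ∫⁻ X in fullParam s '' B,
                  F X * ENNReal.ofReal (gauss (c₁ * c₂) γ (‖X‖ ^ 2)) ∂(volComm d n) =
                ∫⁻ p in B, F (fullParam s p) *
                  ENNReal.ofReal (C * gauss c₁ γ (‖diagTuple p.1‖ ^ 2) *
                    innerDensity (gauss c₂ γ) p.1 p.2.1)
                  ∂(volume.prod (volume.prod (nu n)))) ∧
          -- globally, almost every `X` is hit once for each of the `n!` orderings
          (∀ F : MatTuple d n → ℝ≥0∞, Measurable F →
              ∫⁻ X, F X * ENNReal.ofReal (gauss (c₁ * c₂) γ (‖X‖ ^ 2)) ∂(volComm d n) =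
                ∫⁻ p, F (fullParam s p) *
                  ENNReal.ofReal (C / (n.factorial : ℝ) * gauss c₁ γ (‖diagTuple p.1‖ ^ 2) *
                    innerDensity (gauss c₂ γ) p.1 p.2.1)
                  ∂(volume.prod (volume.prod (nu n))))) ∧
        -- the law of the randomly ordered eigenvalues
        (∀ S : Set (Fin n → Fin d → ℂ), MeasurableSet S →
          ∫⁻ X, orderingProb X S *
              ENNReal.ofReal (gauss (c₁ * c₂) γ (‖X‖ ^ 2)) ∂(volComm d n) =
            ∫⁻ l in S, ENNReal.ofReal (C / (n.factorial : ℝ) *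
                gauss c₁ γ (‖diagTuple l‖ ^ 2)) *
              ∫⁻ a : UpperIdx n → ℂ, ENNReal.ofReal (innerDensity (gauss c₂ γ) l a)) := by
  refine ⟨exists_isSection n, ?_⟩
  obtain ⟨C, hC, hlim⟩ := tendsto_div_nu n
  refine ⟨C, hC, hlim, fun d hd hV γ c₁ c₂ _ h₁ h₂ => ?_⟩
  have : NeZero d := ⟨Nat.one_le_iff_ne_zero.1 hd⟩
  have hnull := volComm_compl_genericSet (d := d) hn hV
  have hfac : (n.factorial : ℝ≥0∞) ≠ 0 := Nat.cast_ne_zero.2 n.factorial_ne_zero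
  have hCn : 0 ≤ C / (n.factorial : ℝ) := by positivity
  refine ⟨fun s hs => ⟨fun B hB hinj F hF => ?_, fun F hF => ?_⟩, fun S hS => ?_⟩
  · have himg : fullParam s '' B = flagParam s '' (toDiagFlag '' B) := by
      rw [Set.image_image]
      rfl
    have hinj' : Set.InjOn (flagParam s) (toDiagFlag '' B) := by
      rintro _ ⟨p, hp, rfl⟩ _ ⟨q, hq, rfl⟩ h
      rw [hinj hp hq h]
    rw [lintegral_paramDensity hs γ hC.le h₁ h₂ hF hB, himg]
    exact setLIntegral_image_flagParam hC hlim hnull hs (hF.mul (measurable_weight _ _))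
      (measurableEmbedding_toDiagFlag.measurableSet_image.2 hB) hinj'
  · have h3 := lintegral_paramDensity (d := d) hs γ hCn h₁ h₂ hF MeasurableSet.univ
    have hsurj : toDiagFlag (d := d) (n := n) '' Set.univ = Set.univ := by
      rw [Set.image_univ]
      exact Set.range_eq_univ.2 fun q =>
        ⟨(lamOf q.1, uppOf q.1, q.2), Prod.ext (eq_of_lamOf_of_uppOf rfl rfl) rfl⟩
    rw [hsurj, setLIntegral_univ, ← inv_factorial_mul_lintegral, setLIntegral_univ,
      lintegral_flagParam hC hlim hnull hs (G := fun X => F X * weight (c₁ * c₂) γ X)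
        (hF.mul (measurable_weight _ _)),
      ← mul_assoc, ENNReal.inv_mul_cancel hfac (ENNReal.natCast_ne_top _), one_mul] at h3
    exact h3.symm
  -- The eigenvalue law does not involve a section; an arbitrary one is used to integrate out the
  -- class.
  · obtain ⟨s, hs⟩ := exists_isSection n
    have h3 := lintegral_orderingProb hC hlim hnull hs (measurable_weight (c₁ * c₂) γ) hS
    rw [inv_factorial_mul_lintegral, lintegral_eigenvalueDensity hs γ hCn h₁ h₂ hS] at h3
    exact h3
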